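/- **Theorem.** Let $A=\varinjlim(A_n,\varphi_n)$ be an AF-algebra, that is, the $C^*$-algebraic direct limit of a sequence of finite-dimensional $C^*$-algebras $A_n$ and injective (not necessarily unital) $*$-homomorphisms $\varphi_n:A_n\to A_{n+1}$. Then there are a Bratteli diagram $E$ for $A$ and a set $S$ of vertices of $E$ such that $$C^*(\mathcal G_E|_S)\cong A .$$ Here the following terminology is used. *Bratteli diagram.* If $(D_n,\psi_n)$ is a sequence of finite-dimensional $C^*$-algebras and injective $*$-homomorphisms, write $D_n\cong\bigoplus_{j=1}^{p_n}M_{[n,j]}$ with $[n,j]\ge 1$, and let $k^{(n)}_{i,j}$ be the multiplicity of the partial map $M_{[n,j]}\to M_{[n+1,i]}$ of $\psi_n$. The Bratteli diagram corresponding to $(D_n,\psi_n)$ is the directed graph with vertices $v^n_j$ ($1\le j\le p_n$) and exactly $k^{(n)}_{i,j}$ edges from $v^n_j$ to $v^{n+1}_i$. A Bratteli diagram for $A$ is a Bratteli diagram corresponding to some such system with $\varinjlim(D_n,\psi_n)\cong A$. *Path groupoid.* For a directed graph $E$ with source and range maps $s,r$, let $E^\infty$ be the set of infinite paths $x=x_1x_2\cdots$,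 $s(x_{i+1})=r(x_i)$. The groupoid $\mathcal G_E$ consists of all triples $(x,k,y)$ with $x,y\in E^\infty$, $k\in\mathbb Z$ and $x_i=y_{i+k}$ for all large $i$, with $(x,k,y)(y,l,z)=(x,k+l,z)$ and $(x,k,y)^{-1}=(y,-k,x)$. Its topology is generated by the sets $Z(\alpha,\beta)=\{(\alpha x',|\beta|-|\alpha|,\beta x')\}$, where $\alpha,\beta$ are finite paths (possibly of length $0$) with $r(\alpha)=r(\beta)$ and $x'$ runs over the infinite paths starting at $r(\alpha)$. For a set $S$ of vertices, $\mathcal G_E|_S$ is the reduction of $\mathcal G_E$ to the infinite paths whose source lies in $S$, with the subspace topology. *Groupoid $C^*$-algebra.* $C^*(\mathcal G_E|_S)$ is the completion of the convolution $*$-algebra $C_c(\mathcal G_E|_S)$ (with counting measures on the range fibres) in the norm $\|f\|=\sup_\pi\|\pi(f)\|$, where $\pi$ runs over the $*$-representations on Hilbert spaces with $\|\pi(f)\|\le\|f\|_I$ for all $f$, and $$\|f\|_I=\max\Bigl(\sup_u\sum_{r(\gamma)=u}|f(\gamma)|,\ \sup_u\sum_{s(\gamma)=u}|f(\gamma)|\Bigr).$$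 -/

import Mathlib

open scoped ENNReal CompactlySupported

noncomputable section

/-! ## Directed graphs, paths, and the path groupoid -/

/-- A directed graph: a set of vertices, a set of edges (multiple edges are allowed), and the
source and range of every edge. -/
structure DirGraph where
  V : Type
  Edge : Type
  src : Edge → V
  rng : Edge → V

namespace DirGraph

/-- The list `e₁ e₂ … eₙ` of edges is a path from `v` to `w`; the empty list is the path of
length zero at a vertex. -/
def IsPath (E : DirGraph) : E.V → List E.Edge → E.V → Prop
  | v, [], w => v = w
  | v, e :: l, w => E.src e = v ∧ E.IsPath (E.rng e) l w

/-- Finite paths (of length `≥ 0`). -/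
structure FinPath (E : DirGraph) where
  source : E.V
  edges : List E.Edge
  target : E.V
  isPath : E.IsPath source edges target

/-- The length of a finite path. -/
def FinPath.length {E : DirGraph} (α : E.FinPath) : ℕ := α.edges.length

/-- The infinite path space: sequences of edges `x₀ x₁ x₂ …` with `s(xᵢ₊₁) = r(xᵢ)`. -/
structure InfPath (E : DirGraph) where
  edge : ℕ → E.Edge
  chain : ∀ i, E.src (edge (i + 1)) = E.rng (edge i)

/-- The source of an infinite path. -/
def InfPath.start {E : DirGraph} (x : E.InfPath) : E.V := E.src (x.edge 0)

/-- `x = α x'`: the infinite path `x` is the finite path `α` followed by the infinite path `x'`,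
which starts at the end of `α`. -/
def InfPath.IsConcat {E : DirGraph} (x : E.InfPath) (α : E.FinPath) (x' : E.InfPath) : Prop :=
  α.target = x'.start ∧ (∀ i : Fin α.edges.length, x.edge i = α.edges.get i) ∧
    ∀ i, x.edge (α.length + i) = x'.edge i

/-- Tail equivalence with lag `k`: `xᵢ = yᵢ₊ₖ` for all large `i`. -/
def TailEquiv {E : DirGraph} (x : E.InfPath) (k : ℤ) (y : E.InfPath) : Prop :=
  ∃ N : ℕ, ∀ i j : ℕ, N ≤ i → (j : ℤ) = i + k → x.edge i = y.edge j

theorem TailEquiv.symm {E : DirGraph} {x y : E.InfPath} {k : ℤ} (h : TailEquiv x k y) :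
    TailEquiv y (-k) x := by
  obtain ⟨N, hN⟩ := h
  refine ⟨N + k.natAbs, fun i j hi hj => (hN j i ?_ ?_).symm⟩ <;> omega

theorem TailEquiv.trans {E : DirGraph} {x y z : E.InfPath} {k l : ℤ} (h : TailEquiv x k y)
    (h' : TailEquiv y l z) : TailEquiv x (k + l) z := by
  obtain ⟨N, hN⟩ := h
  obtain ⟨M, hM⟩ := h'
  refine ⟨N + M + k.natAbs, fun i j hi hj => ?_⟩
  rw [hN i (i + k).toNat (by omega) (by omega), hM (i + k).toNat j (by omega) (by omega)]

/-- The path groupoid `𝒢_E` of `E`: the triples `(x, k, y)` with `x ∼ₖ y`. Here `rng` is `x`,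
`lag` is `k` and `src` is `y`; the unit space is identified with the infinite path space. -/
@[ext] structure PathGroupoid (E : DirGraph) where
  rng : E.InfPath
  lag : ℤ
  src : E.InfPath
  tail : TailEquiv rng lag src

namespace PathGroupoid

variable {E : DirGraph}

/-- `(x, k, y)⁻¹ = (y, -k, x)`. -/
def inv (γ : E.PathGroupoid) : E.PathGroupoid := ⟨γ.src, -γ.lag, γ.rng, γ.tail.symm⟩

/-- `(x, k, y) (y, l, z) = (x, k + l, z)`. -/
def mul (γ η : E.PathGroupoid) (h : γ.src = η.rng) : E.PathGroupoid :=
  ⟨γ.rng, γ.lag + η.lag, η.src, γ.tail.trans (h ▸ η.tail)⟩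

/-- `Z(α, β) = {(α x', |β| - |α|, β x')}`, for finite paths `α`, `β` with the same end. -/
def Z (α β : E.FinPath) : Set E.PathGroupoid :=
  {γ | ∃ x' : E.InfPath, γ.rng.IsConcat α x' ∧ γ.src.IsConcat β x' ∧
    γ.lag = (β.length : ℤ) - α.length}

/-- The topology of `𝒢_E` is generated by the sets `Z(α, β)` with `r(α) = r(β)`. -/
instance : TopologicalSpace E.PathGroupoid :=
  TopologicalSpace.generateFrom {U | ∃ α β : E.FinPath, α.target = β.target ∧ U = Z α β}

end PathGroupoid

/-- The reduction `𝒢_E|_S` of the path groupoid to the set of infinite paths whose source lies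
in `S`. It carries the subspace topology. -/
abbrev Reduction (E : DirGraph) (S : Set E.V) : Type :=
  {γ : E.PathGroupoid // γ.rng.start ∈ S ∧ γ.src.start ∈ S}

namespace Reduction

variable {E : DirGraph} {S : Set E.V}

/-- Inversion in `𝒢_E|_S`. -/
def inv (γ : E.Reduction S) : E.Reduction S := ⟨γ.1.inv, γ.2.2, γ.2.1⟩

/-- Multiplication in `𝒢_E|_S`. -/
def mul (γ η : E.Reduction S) (h : γ.1.src = η.1.rng) : E.Reduction S :=
  ⟨γ.1.mul η.1 h, γ.2.1, η.2.2⟩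

/-! ## The C⋆-algebra of the groupoid

`C_c(𝒢)` is a ⋆-algebra under convolution with respect to the counting measures on the (discrete)
range fibres; `C*(𝒢)` is its completion in the supremum of the operator norms over all
representations on Hilbert spaces that are bounded by the `I`-norm. -/

/-- The convolution `(f * g)(γ) = ∑_{r(η) = r(γ)} f(η) g(η⁻¹ γ)`. For compactly supported
continuous `f` and `g` only finitely many terms are nonzero. -/
def conv (f g : E.Reduction S → ℂ) (γ : E.Reduction S) : ℂ :=
  ∑' η : {η : E.Reduction S // η.1.rng = γ.1.rng}, f η.1 * g (η.1.inv.mul γ η.2)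

/-- The involution `f^*(γ) = conj f(γ⁻¹)`. -/
def invol (f : E.Reduction S → ℂ) (γ : E.Reduction S) : ℂ := star (f γ.inv)

/-- The `I`-norm
`‖f‖_I = max (sup_u ∑_{r(η) = u} |f(η)|) (sup_u ∑_{s(η) = u} |f(η)|)`. -/
def iNorm (f : E.Reduction S → ℂ) : ℝ≥0∞ :=
  max (⨆ u : E.InfPath, ∑' η : {η : E.Reduction S // η.1.rng = u}, ‖f η.1‖ₑ)
    (⨆ u : E.InfPath, ∑' η : {η : E.Reduction S // η.1.src = u}, ‖f η.1‖ₑ)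

end Reduction

theorem InfPath.ext' {E : DirGraph} {x y : E.InfPath} (h : ∀ i, x.edge i = y.edge i) : x = y := by
  cases x; cases y; congr; exact funext h

theorem InfPath.IsConcat.unique {E : DirGraph} {x y x' : E.InfPath} {α : E.FinPath}
    (hx : x.IsConcat α x') (hy : y.IsConcat α x') : x = y := by
  refine InfPath.ext' fun i => ?_
  by_cases hi : i < α.edges.length
  · exact (hx.2.1 ⟨i, hi⟩).trans (hy.2.1 ⟨i, hi⟩).symm
  · obtain ⟨j, rfl⟩ := Nat.exists_eq_add_of_le (not_lt.1 hi)
    exact (hx.2.2 j).trans (hy.2.2 j).symm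

theorem InfPath.IsConcat.unique_tail {E : DirGraph} {x x' x'' : E.InfPath} {α : E.FinPath}
    (hx : x.IsConcat α x') (hy : x.IsConcat α x'') : x' = x'' :=
  InfPath.ext' fun i => (hx.2.2 i).symm.trans (hy.2.2 i)

namespace PathGroupoid

variable {E : DirGraph}

theorem Z_rng_inj {α β : E.FinPath} {γ η : E.PathGroupoid} (hγ : γ ∈ Z α β) (hη : η ∈ Z α β)
    (h : γ.rng = η.rng) : γ = η := by
  obtain ⟨x, h1, h2, h3⟩ := hγ
  obtain ⟨y, k1, k2, k3⟩ := hη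
  rw [h] at h1
  obtain rfl := h1.unique_tail k1
  exact PathGroupoid.ext h (h3.trans k3.symm) (h2.unique k2)

theorem Z_src_inj {α β : E.FinPath} {γ η : E.PathGroupoid} (hγ : γ ∈ Z α β) (hη : η ∈ Z α β)
    (h : γ.src = η.src) : γ = η := by
  obtain ⟨x, h1, h2, h3⟩ := hγ
  obtain ⟨y, k1, k2, k3⟩ := hη
  rw [h] at h2
  obtain rfl := h2.unique_tail k2
  exact PathGroupoid.ext (h1.unique k1) (h3.trans k3.symm) h

theorem isPath_ofFn (x : E.InfPath) (n : ℕ) :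
    ∀ m, E.IsPath (E.src (x.edge m)) (List.ofFn fun i : Fin n => x.edge (m + i))
      (E.src (x.edge (m + n))) := by
  induction n with
  | zero => intro m; simp [IsPath]
  | succ n ih =>
    intro m
    rw [List.ofFn_succ]
    refine ⟨by simp, ?_⟩
    have := ih (m + 1)
    simp only [Fin.val_zero, add_zero, Fin.val_succ]
    rw [← x.chain m]
    rw [show m + (n + 1) = m + 1 + n by omega]
    have e : (fun i : Fin n => x.edge (m + (i.1 + 1))) = fun i : Fin n => x.edge (m + 1 + i.1) := by
      funext i
      congr 1
      omega
    rw [e]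
    exact this

/-- The initial segment of length `n` of an infinite path. -/
def initSeg (x : E.InfPath) (n : ℕ) : E.FinPath where
  source := E.src (x.edge 0)
  edges := List.ofFn fun i : Fin n => x.edge i
  target := E.src (x.edge n)
  isPath := by simpa using isPath_ofFn x n 0

theorem get_initSeg (x : E.InfPath) (n : ℕ) (i : Fin (initSeg x n).edges.length) :
    (initSeg x n).edges.get i = x.edge i :=
  (List.get_ofFn (fun j : Fin n => x.edge j) i).trans rfl

theorem exists_mem_Z (γ : E.PathGroupoid) : ∃ α β : E.FinPath, α.target = β.target ∧ γ ∈ Z α β := by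
  obtain ⟨N, hN⟩ := γ.tail
  set n := N + γ.lag.natAbs with hn
  set m := (n + γ.lag).toNat with hm
  have hmn : (m : ℤ) = n + γ.lag := by omega
  have e0 := hN n m (by omega) hmn
  refine ⟨initSeg γ.rng n, initSeg γ.src m, congrArg E.src e0,
    ⟨fun i => γ.rng.edge (n + i), fun i => γ.rng.chain (n + i)⟩, ⟨rfl, ?_, ?_⟩, ⟨?_, ?_, ?_⟩, ?_⟩
  · intro i; exact (get_initSeg _ _ _).symm
  · intro i; simp [initSeg, FinPath.length]
  · exact congrArg E.src e0.symm
  · intro i; exact (get_initSeg _ _ _).symm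
  · intro i
    simp only [initSeg, FinPath.length, List.length_ofFn]
    exact (hN (n + i) (m + i) (by omega) (by push_cast; omega)).symm
  · simp only [initSeg, FinPath.length, List.length_ofFn]; omega

end PathGroupoid

namespace Reduction

variable {E : DirGraph} {S : Set E.V}

theorem tsum_fibre_le {X : Type} (q : E.Reduction S → X) (f : E.Reduction S → ℂ) (C : ℝ≥0∞)
    (hC : ∀ γ, ‖f γ‖ₑ ≤ C) (T : Finset (Set (E.Reduction S))) (hT : ∀ γ, f γ ≠ 0 → ∃ U ∈ T, γ ∈ U)
    (hinj : ∀ U ∈ T, Set.InjOn q U) (u : X) :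
    ∑' η : {η : E.Reduction S // q η = u}, ‖f η.1‖ₑ ≤ T.card * C := by
  classical
  calc ∑' η : {η : E.Reduction S // q η = u}, ‖f η.1‖ₑ
      ≤ ∑' η : {η : E.Reduction S // q η = u}, ∑ U ∈ T, U.indicator (fun γ => ‖f γ‖ₑ) η.1 := by
        refine ENNReal.tsum_le_tsum fun η => ?_
        by_cases h : f η.1 = 0
        · simp [h]
        · obtain ⟨U, hU, hη⟩ := hT _ h
          refine le_trans ?_ (Finset.single_le_sum (fun _ _ => zero_le) hU)
          simp [hη]
    _ = ∑ U ∈ T, ∑' η : {η : E.Reduction S // q η = u}, U.indicator (fun γ => ‖f γ‖ₑ) η.1 :=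
        Summable.tsum_finsetSum fun _ _ => ENNReal.summable
    _ ≤ ∑ _U ∈ T, C := by
        refine Finset.sum_le_sum fun U hU => ?_
        by_cases h : ∃ η : {η : E.Reduction S // q η = u}, η.1 ∈ U
        · obtain ⟨η₀, h₀⟩ := h
          rw [tsum_eq_single η₀]
          · exact (Set.indicator_le_self' (fun _ _ => zero_le) _).trans (hC _)
          · intro η hη
            refine Set.indicator_of_notMem (fun hU' => hη ?_) _
            exact Subtype.ext (hinj U hU hU' h₀ (η.2.trans η₀.2.symm))
        · have h0 : ∀ η : {η : E.Reduction S // q η = u},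
              U.indicator (fun γ => ‖f γ‖ₑ) η.1 = 0 :=
            fun η => Set.indicator_of_notMem (fun h' => h ⟨η, h'⟩) _
          simp [h0]
    _ = T.card * C := by simp

/-- The `I`-norm of a compactly supported continuous function is finite. -/
theorem iNorm_ne_top (f : C_c(E.Reduction S, ℂ)) : iNorm (⇑f) ≠ ⊤ := by
  classical
  let 𝒰 : Set (Set (E.Reduction S)) :=
    {U | ∃ α β : E.FinPath, α.target = β.target ∧ U = Subtype.val ⁻¹' PathGroupoid.Z α β}
  obtain ⟨T, hT, hTf, hcov⟩ := f.hasCompactSupport.isCompact.elim_finite_subcover_image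
    (b := 𝒰) (c := id)
    (by
      rintro _ ⟨α, β, h, rfl⟩
      have hZ : IsOpen (PathGroupoid.Z α β) :=
        TopologicalSpace.isOpen_generateFrom_of_mem ⟨α, β, h, rfl⟩
      exact hZ.preimage continuous_subtype_val)
    (by
      intro γ _
      obtain ⟨α, β, h, hγ⟩ := PathGroupoid.exists_mem_Z γ.1
      exact Set.mem_biUnion (show Subtype.val ⁻¹' PathGroupoid.Z α β ∈ 𝒰 from ⟨α, β, h, rfl⟩) hγ)
  obtain ⟨C, hC⟩ := f.hasCompactSupport.exists_bound_of_continuous f.continuous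
  have hC' : ∀ γ, ‖f γ‖ₑ ≤ ENNReal.ofReal C := fun γ => by
    rw [← ofReal_norm]; exact ENNReal.ofReal_le_ofReal (hC γ)
  have hT' : ∀ γ, f γ ≠ 0 → ∃ U ∈ hTf.toFinset, γ ∈ U := fun γ h => by
    have := hcov (subset_tsupport f h)
    simpa using this
  have key : iNorm (⇑f) ≤ hTf.toFinset.card * ENNReal.ofReal C := by
    refine max_le (iSup_le fun u => ?_) (iSup_le fun u => ?_)
    · refine tsum_fibre_le (fun γ => γ.1.rng) f _ hC' _ hT' (fun U hU => ?_) u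
      obtain ⟨α, β, -, rfl⟩ := hT (hTf.mem_toFinset.1 hU)
      exact fun a ha b hb h => Subtype.ext (PathGroupoid.Z_rng_inj ha hb h)
    · refine tsum_fibre_le (fun γ => γ.1.src) f _ hC' _ hT' (fun U hU => ?_) u
      obtain ⟨α, β, -, rfl⟩ := hT (hTf.mem_toFinset.1 hU)
      exact fun a ha b hb h => Subtype.ext (PathGroupoid.Z_src_inj ha hb h)
  exact ne_top_of_le_ne_top (ENNReal.mul_ne_top (by simp) ENNReal.ofReal_ne_top) key

end Reduction

/-- An (`I`-norm bounded) representation of the convolution ⋆-algebra `C_c(𝒢_E|_S)` on a Hilbert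
space: a linear map that takes convolution products to products and the involution to adjoints. -/
structure BoundedRep (E : DirGraph) (S : Set E.V) where
  H : Type
  [normed : NormedAddCommGroup H]
  [inner : InnerProductSpace ℂ H]
  [complete : CompleteSpace H]
  π : C_c(E.Reduction S, ℂ) →ₗ[ℂ] (H →L[ℂ] H)
  map_conv : ∀ f g h : C_c(E.Reduction S, ℂ), ⇑h = Reduction.conv f g → π h = π f * π g
  map_invol : ∀ f g : C_c(E.Reduction S, ℂ), ⇑g = Reduction.invol f → π g = star (π f)
  bound : ∀ f, ‖π f‖ₑ ≤ Reduction.iNorm f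

attribute [instance] BoundedRep.normed BoundedRep.inner BoundedRep.complete

/-- The C⋆-algebra of all bounded families of operators indexed by the representations. -/
abbrev RepProduct (E : DirGraph) (S : Set E.V) : Type 1 :=
  lp (fun π : BoundedRep E S => π.H →L[ℂ] π.H) ∞

/-- The universal representation `f ↦ (π(f))_π` of `C_c(𝒢_E|_S)`. -/
def universalRep (E : DirGraph) (S : Set E.V) (f : C_c(E.Reduction S, ℂ)) : RepProduct E S :=
  ⟨fun π => π.π f, by
    refine memℓp_infty ⟨(Reduction.iNorm f).toReal, ?_⟩
    rintro _ ⟨π, rfl⟩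
    have := ENNReal.toReal_mono (Reduction.iNorm_ne_top f) (π.bound f)
    simpa using this⟩

/-- The closed ⋆-subalgebra generated by the image of `C_c(𝒢_E|_S)` under the universal
representation. -/
def groupoidSubalgebra (E : DirGraph) (S : Set E.V) : NonUnitalStarSubalgebra ℂ (RepProduct E S) :=
  (NonUnitalStarAlgebra.adjoin ℂ (Set.range (universalRep E S))).topologicalClosure

/-- The groupoid C⋆-algebra `C*(𝒢_E|_S)`: the C⋆-algebra generated by the image of
`C_c(𝒢_E|_S)` under the universal representation, that is, the completion of `C_c(𝒢_E|_S)` in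
the norm `‖f‖ = sup_π ‖π(f)‖`. -/
def GroupoidCStarAlgebra (E : DirGraph) (S : Set E.V) : Type 1 := groupoidSubalgebra E S

instance (E : DirGraph) (S : Set E.V) : NonUnitalCStarAlgebra (GroupoidCStarAlgebra E S) :=
  NonUnitalStarSubalgebra.nonUnitalCStarAlgebra (groupoidSubalgebra E S)
    (h_closed := NonUnitalStarSubalgebra.isClosed_topologicalClosure _)

end DirGraph

/-! ## Inductive systems of finite-dimensional C⋆-algebras and Bratteli diagrams -/

/-- A sequence of finite-dimensional C⋆-algebras with injective ⋆-homomorphisms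
`φₙ : Aₙ → Aₙ₊₁` (not necessarily unital). -/
structure FDSystem where
  alg : ℕ → Type*
  [cstar : ∀ n, NonUnitalCStarAlgebra (alg n)]
  [finiteDimensional : ∀ n, FiniteDimensional ℂ (alg n)]
  map : ∀ n, alg n →⋆ₙₐ[ℂ] alg (n + 1)
  map_injective : ∀ n, Function.Injective (map n)

attribute [instance] FDSystem.cstar FDSystem.finiteDimensional

/-- The C⋆-algebra `A` is the C⋆-algebraic direct limit of the system: there are compatible
embeddings of the `Aₙ` into `A` whose ranges have dense union. -/
def FDSystem.HasLimit (D : FDSystem) (A : Type*) [NonUnitalCStarAlgebra A] : Prop :=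
  ∃ ι : ∀ n, D.alg n →⋆ₙₐ[ℂ] A, (∀ n a, ι (n + 1) (D.map n a) = ι n a) ∧
    (∀ n, Function.Injective (ι n)) ∧ Dense (⋃ n, Set.range (ι n))

/-- The map `φ : M_m → M_n` has multiplicity `k`: up to a unitary of `M_n` it is
`a ↦ a ⊕ ⋯ ⊕ a ⊕ 0` with `k` copies of `a`. -/
def HasMultiplicity {m n : ℕ} (φ : Matrix (Fin m) (Fin m) ℂ → Matrix (Fin n) (Fin n) ℂ)
    (k : ℕ) : Prop :=
  ∃ (l : ℕ) (e : (Fin m × Fin k) ⊕ Fin l ≃ Fin n) (u : Matrix.unitaryGroup (Fin n) ℂ),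
    ∀ a, φ a = (u : Matrix (Fin n) (Fin n) ℂ) *
      Matrix.reindex e e (Matrix.fromBlocks (Matrix.blockDiagonal fun _ : Fin k => a) 0 0 0) *
      star (u : Matrix (Fin n) (Fin n) ℂ)

/-- The combinatorial data of a Bratteli diagram: level `n` has the vertices `v^n_j`, `j < p n`,
and there are `k n i j` edges from `v^n_j` to `v^{n+1}_i`. -/
structure BratteliDiagram where
  p : ℕ → ℕ
  k : ∀ n, Fin (p (n + 1)) → Fin (p n) → ℕ

namespace BratteliDiagram

/-- The directed graph of a Bratteli diagram. -/
def graph (B : BratteliDiagram) : DirGraph where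
  V := Σ n, Fin (B.p n)
  Edge := Σ (n : ℕ) (i : Fin (B.p (n + 1))) (j : Fin (B.p n)), Fin (B.k n i j)
  src e := ⟨e.1, e.2.2.1⟩
  rng e := ⟨e.1 + 1, e.2.1⟩

/-- `B` is the Bratteli diagram corresponding to the system `(Dₙ, ψₙ)`: the algebra `Dₙ` is a
direct sum of `p n` full matrix algebras of sizes `[n, j] ≥ 1`, indexed by the vertices of level
`n`, and `k n i j` is the multiplicity of the partial embedding of the `j`-th summand of `Dₙ`
into the `i`-th summand of `Dₙ₊₁`. -/
def Corresponds (B : BratteliDiagram) (D : FDSystem) : Prop :=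
  ∃ (d : ∀ n, Fin (B.p n) → ℕ)
    (θ : ∀ n, D.alg n ≃⋆ₐ[ℂ] (∀ j : Fin (B.p n), Matrix (Fin (d n j)) (Fin (d n j)) ℂ)),
    (∀ n j, 0 < d n j) ∧
    ∀ n i j, HasMultiplicity
      (fun a => θ (n + 1) (D.map n ((θ n).symm (Pi.single j a))) i) (B.k n i j)

/-- `B` is a Bratteli diagram for the C⋆-algebra `A`: it corresponds to some system
of finite-dimensional C⋆-algebras whose limit is `A`. (Every finite-dimensional C⋆-algebra is
isomorphic to one in the lowest universe.) -/
def IsDiagramFor (B : BratteliDiagram) (A : Type*) [NonUnitalCStarAlgebra A] : Prop :=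
  ∃ D : FDSystem.{0}, D.HasLimit A ∧ B.Corresponds D

end BratteliDiagram

end

/-!
Let `G 0 = 0 ⊆ G 1 ⊆ G 2 ⊆ ⋯` be finite-dimensional ⋆-subalgebras of `A` with dense union. The
diagram is built inside `A`: the vertices of level `n` are nonzero projections of `G n`. To pass to
the next level, each vertex projection is decomposed into minimal projections of `G n`. The
pieces are the edges, and one piece from each Murray–von Neumann class is a vertex of the next
level; the partial isometry from the representative to the piece realises the edge. In addition,
the difference of the units of `G (n + 1)` and `G n` is decomposed into minimal projections of
`G (n + 1)`. These are further vertices of level `n + 1`, and they form the set `S`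
(`FiniteDimCStar.exists_step`, `BratteliDiagram.exists_realization`). By construction every vertex
emits an edge and is reached from `S`, whether or not the inclusions are unital. In particular
every finite path from `S` extends to an infinite one.

A path from `S` has a partial isometry in `A`, the product of those of its edges, and two paths
`α`, `β` to a common vertex give the matrix unit `e_α e_β^*`. The matrix units of level `n + 1`
span a ⋆-algebra that contains `G n`, because a vertex of level `n + 1` has a one-dimensional corner
in `G n`, and distinct vertices have disjoint corners (`BratteliDiagram.Realization.mem_range_hom`).
Hence `A` is the limit of the path algebras `⨁_j M_{paths from S to j}`, which the diagram
prescribes together with their connecting maps.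

The groupoid algebra is a limit of the same system. Its matrix units are the characteristic
functions of the cylinder sets `Z(α, β)`. They are nonzero because the regular representation on
`ℓ²` of the unit space is bounded by the `I`-norm, by Schur's test
(`BratteliDiagram.universalRep_ne_zero`). They generate, because every function in `C_c` is
approximated in the `I`-norm by functions that are constant on cylinder sets
(`BratteliDiagram.exists_iNorm_sub_le`). The theorem follows from the uniqueness of C⋆-algebraic
limits (`FDSystem.HasLimit.unique`).
-/


noncomputable section

/-! ### Projections in finite-dimensional ⋆-subalgebras -/

namespace FiniteDimCStar

variable {A : Type*} [NonUnitalCStarAlgebra A] {F : NonUnitalStarSubalgebra ℂ A}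

theorem isClosed_of_finiteDimensional (F : NonUnitalStarSubalgebra ℂ A) [FiniteDimensional ℂ F] :
    IsClosed (F : Set A) := by
  have : FiniteDimensional ℂ F.toSubmodule := ‹_›
  exact Submodule.closed_of_finiteDimensional F.toSubmodule

/-- A selfadjoint element of a finite-dimensional ⋆-subalgebra has finite spectrum: a linear
relation between its powers is a polynomial that vanishes on the spectrum. -/
theorem finite_quasispectrum [FiniteDimensional ℂ F] {c : A} (hc : c ∈ F)
    (hsa : IsSelfAdjoint c) : (quasispectrum ℝ c).Finite := by
  have hcl : IsClosed (F : Set A) := isClosed_of_finiteDimensional F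
  have : FiniteDimensional ℝ F := FiniteDimensional.complexToReal F
  let g : ℕ → F := fun i => ⟨cfcₙ (fun x : ℝ => x ^ (i + 1)) c, cfcₙ_mem (s := F) (𝕜' := ℂ) _ hc⟩
  have hdep : ¬ LinearIndependent ℝ g := fun h => by
    have := h.finite
    exact not_finite ℕ
  rw [not_linearIndependent_iff] at hdep
  obtain ⟨s, a, hsum, i, his, hi⟩ := hdep
  let P : Polynomial ℝ := ∑ j ∈ s, Polynomial.monomial (j + 1) (a j)
  have hP : P ≠ 0 := by
    intro h
    have h1 : P.coeff (i + 1) = a i := by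
      simp only [P, Polynomial.finsetSum_coeff, Polynomial.coeff_monomial, add_left_inj]
      rw [Finset.sum_ite_eq_of_mem' s i a his]
    rw [h] at h1
    exact hi (by simpa using h1.symm)
  have hz : cfcₙ (fun x => ∑ j ∈ s, a j * x ^ (j + 1)) c = cfcₙ (fun _ => (0 : ℝ)) c := by
    have h1 : (fun x : ℝ => ∑ j ∈ s, a j * x ^ (j + 1)) = ∑ j ∈ s, fun x : ℝ => a j * x ^ (j + 1) := by
      ext x; simp
    rw [h1, cfcₙ_sum _ c s (fun j _ => by fun_prop) (fun j _ => by simp), cfcₙ_const_zero]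
    have h2 := congrArg (Subtype.val : F → A) hsum
    simp only [AddSubmonoidClass.coe_finsetSum, ZeroMemClass.coe_zero] at h2
    rw [← h2]
    refine Finset.sum_congr rfl fun j _ => ?_
    exact cfcₙ_smul (a j) (fun x : ℝ => x ^ (j + 1)) c (by fun_prop) (by simp)
  rw [cfcₙ_eq_cfcₙ_iff_eqOn (a := c) hsa (by fun_prop) (by simp) (by fun_prop) rfl] at hz
  refine (Polynomial.finite_setOfPred_isRoot hP).subset fun x hx => ?_
  have := hz hx
  simpa [P, Polynomial.IsRoot, Polynomial.eval_finsetSum] using this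

/-- A selfadjoint element with finite spectrum has a nonzero eigenvalue `r`, and the function that is
`1` at `r` and `0` elsewhere is continuous on the spectrum and gives the eigenprojection. -/
theorem exists_spectral_projection [FiniteDimensional ℂ F] {c : A} (hc : c ∈ F)
    (hsa : IsSelfAdjoint c) (h0 : c ≠ 0) :
    ∃ r : ℝ, r ≠ 0 ∧ ∃ q ∈ F, IsStarProjection q ∧ q ≠ 0 ∧ c * q = (r : ℂ) • q := by
  have hfin := finite_quasispectrum hc hsa
  have hdisc : DiscreteTopology (quasispectrum ℝ c) := by
    have := hfin.to_subtype
    infer_instance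
  have hcont : ∀ f : ℝ → ℝ, ContinuousOn f (quasispectrum ℝ c) := fun f => by
    rw [continuousOn_iff_continuous_domRestrict]
    exact continuous_of_discreteTopology
  have hex : ∃ r ∈ quasispectrum ℝ c, r ≠ 0 := by
    by_contra! h
    apply h0
    rw [← cfcₙ_id' ℝ c]
    rw [cfcₙ_congr (g := fun _ => 0) (fun x hx => h x hx)]
    exact cfcₙ_const_zero ℝ c
  obtain ⟨r, hr, hr0⟩ := hex
  set f : ℝ → ℝ := fun x => if x = r then 1 else 0 with hf
  have hf0 : f 0 = 0 := by simp [hf, hr0.symm]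
  have hmem : cfcₙ f c ∈ F := by
    have hcl : IsClosed (F : Set A) := isClosed_of_finiteDimensional F
    exact cfcₙ_mem (s := F) (𝕜' := ℂ) f hc
  refine ⟨r, hr0, cfcₙ f c, hmem, ⟨?_, ?_⟩, ?_, ?_⟩
  · rw [IsIdempotentElem, ← cfcₙ_mul f f c (hcont _) hf0 (hcont _) hf0]
    congr 1; ext x; simp [hf]
  · exact cfcₙ_predicate f c
  · intro h
    have : cfcₙ f c = cfcₙ (fun _ => (0:ℝ)) c := by rw [h, cfcₙ_const_zero]
    rw [cfcₙ_eq_cfcₙ_iff_eqOn (a := c) hsa (hcont _) hf0 (hcont _) rfl] at this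
    simpa [hf] using this hr
  · nth_rewrite 1 [← cfcₙ_id ℝ c]
    rw [← cfcₙ_mul id f c (hcont _) rfl (hcont _) hf0]
    rw [show ((r:ℂ) • cfcₙ f c) = r • cfcₙ f c from rfl, ← cfcₙ_smul r f c (hcont _) hf0]
    congr 1; ext x; by_cases h : x = r <;> simp [hf, h]

/-- A minimal projection of `F`: a nonzero projection `p` with `p F p = ℂ p`. -/
structure IsMinimalProjection (F : NonUnitalStarSubalgebra ℂ A) (p : A) : Prop where
  mem : p ∈ F
  proj : IsStarProjection p
  ne_zero : p ≠ 0
  corner : ∀ a ∈ F, ∃ z : ℂ, p * a * p = z • p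

/-- The right ideal `e F`, whose dimension measures the size of the projection `e`. -/
def rightIdeal (F : NonUnitalStarSubalgebra ℂ A) (e : A) : Submodule ℂ A where
  carrier := {a | a ∈ F ∧ e * a = a}
  zero_mem' := ⟨zero_mem F, mul_zero e⟩
  add_mem' ha hb := ⟨add_mem ha.1 hb.1, by rw [mul_add, ha.2, hb.2]⟩
  smul_mem' z a ha := ⟨SMulMemClass.smul_mem z ha.1, by rw [mul_smul_comm, ha.2]⟩

theorem mul_comm_of_mul_eq {e q : A} (he : IsStarProjection e) (hq : IsStarProjection q)
    (h : e * q = q) : q * e = q := by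
  have := congrArg star h
  rwa [star_mul, hq.isSelfAdjoint.star_eq, he.isSelfAdjoint.star_eq] at this

theorem finrank_rightIdeal_lt [FiniteDimensional ℂ F] {e q : A} (heF : e ∈ F)
    (he : IsStarProjection e) (hq : IsStarProjection q) (h : e * q = q) (hne : q ≠ e) :
    Module.finrank ℂ (rightIdeal F q) < Module.finrank ℂ (rightIdeal F e) := by
  have hfd : FiniteDimensional ℂ F.toSubmodule := ‹_›
  have : FiniteDimensional ℂ (rightIdeal F e) :=
    Submodule.finiteDimensional_of_le (S₂ := F.toSubmodule) fun a ha => ha.1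
  refine Submodule.finrank_lt_finrank_of_lt (lt_of_le_of_ne (fun a ha => ⟨ha.1, ?_⟩) fun heq => ?_)
  · rw [← ha.2, ← mul_assoc, h]
  · have h1 : e ∈ rightIdeal F q := heq ▸ ⟨heF, he.isIdempotentElem⟩
    exact hne ((mul_comm_of_mul_eq he hq h).symm.trans h1.2)

/-- A nonzero projection without proper subprojections in `F` is minimal, since the spectral
projections of the selfadjoint elements of its corner are trivial. -/
theorem isMinimalProjection_or_exists [FiniteDimensional ℂ F] {e : A} (heF : e ∈ F)
    (he : IsStarProjection e) (h0 : e ≠ 0) :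
    IsMinimalProjection F e ∨
      ∃ q ∈ F, IsStarProjection q ∧ q ≠ 0 ∧ q ≠ e ∧ e * q = q := by
  by_contra! hcon
  obtain ⟨hmin, hq⟩ := hcon
  have hsa : ∀ b ∈ F, IsSelfAdjoint b → ∃ z : ℂ, e * b * e = z • e := by
    intro b hb hbs
    by_cases hc0 : e * b * e = 0
    · exact ⟨0, by rw [hc0, zero_smul]⟩
    have hcs : IsSelfAdjoint (e * b * e) := by
      rw [IsSelfAdjoint, star_mul, star_mul, hbs.star_eq, he.isSelfAdjoint.star_eq, mul_assoc]
    obtain ⟨r, hr, q, hqF, hqp, hq0, hcq⟩ :=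
      exists_spectral_projection (mul_mem (mul_mem heF hb) heF) hcs hc0
    have heq : e * q = q := by
      have h1 : e * ((r : ℂ) • q) = (r : ℂ) • q := by
        rw [← hcq]; simp only [← mul_assoc, he.isIdempotentElem.eq]
      rw [mul_smul_comm] at h1
      exact smul_right_injective A (Complex.ofReal_ne_zero.2 hr) h1
    have hqe : q = e := by
      by_contra hne
      exact hq q hqF hqp hq0 hne heq
    refine ⟨r, ?_⟩
    rw [hqe, mul_assoc, he.isIdempotentElem.eq] at hcq
    exact hcq
  -- A general element is a combination of two selfadjoint ones.
  refine hmin ⟨heF, he, h0, fun a ha => ?_⟩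
  obtain ⟨z, hz⟩ := hsa (a + star a) (add_mem ha (star_mem ha)) (IsSelfAdjoint.add_star_self a)
  obtain ⟨w, hw⟩ := hsa (Complex.I • (a - star a))
    (SMulMemClass.smul_mem _ (sub_mem ha (star_mem ha))) (by
      rw [IsSelfAdjoint, star_smul, star_sub, star_star, Complex.star_def, Complex.conj_I, neg_smul,
        ← smul_neg, neg_sub])
  refine ⟨(1 / 2 : ℂ) * z - (Complex.I / 2) * w, ?_⟩
  have hdec : a = (1 / 2 : ℂ) • (a + star a) - (Complex.I / 2) • (Complex.I • (a - star a)) := by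
    rw [smul_smul, show Complex.I / 2 * Complex.I = -(1 / 2) by
      rw [div_mul_eq_mul_div, Complex.I_mul_I]; norm_num]
    module
  rw [hdec, mul_sub, sub_mul, mul_smul_comm, mul_smul_comm, smul_mul_assoc, smul_mul_assoc, hz, hw]
  module

/-- `M` is a finite set of pairwise orthogonal minimal projections of `F` with sum `e`. -/
structure IsMinimalDecomposition (F : NonUnitalStarSubalgebra ℂ A) (e : A) (M : Finset A) :
    Prop where
  minimal : ∀ p ∈ M, IsMinimalProjection F p
  orthogonal : ∀ p ∈ M, ∀ q ∈ M, p ≠ q → p * q = 0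
  sum_eq : ∑ p ∈ M, p = e

theorem IsMinimalDecomposition.mul_eq {e : A} {M : Finset A} (h : IsMinimalDecomposition F e M)
    {p : A} (hp : p ∈ M) : e * p = p := by
  rw [← h.sum_eq, Finset.sum_mul, Finset.sum_eq_single p]
  · exact (h.minimal p hp).proj.isIdempotentElem
  · exact fun q hq hne => h.orthogonal q hq p hp hne
  · exact fun h' => absurd hp h'

theorem IsMinimalDecomposition.mul_eq' {e : A} {M : Finset A} (h : IsMinimalDecomposition F e M)
    {p : A} (hp : p ∈ M) : p * e = p := by
  rw [← h.sum_eq, Finset.mul_sum, Finset.sum_eq_single p]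
  · exact (h.minimal p hp).proj.isIdempotentElem
  · exact fun q hq hne => h.orthogonal p hp q hq hne.symm
  · exact fun h' => absurd hp h'

/-- In a finite-dimensional algebra every projection is an orthogonal sum of minimal ones. -/
theorem exists_minimalDecomposition [FiniteDimensional ℂ F] {e : A} (heF : e ∈ F)
    (he : IsStarProjection e) : ∃ M : Finset A, IsMinimalDecomposition F e M := by
  classical
  induction hn : Module.finrank ℂ (rightIdeal F e) using Nat.strong_induction_on
    generalizing e with
  | _ n ih =>
  by_cases h0 : e = 0
  · exact ⟨∅, by simp, by simp, by simp [h0]⟩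
  rcases isMinimalProjection_or_exists heF he h0 with hmin | ⟨q, hqF, hq, hq0, hqe, heq⟩
  · refine ⟨{e}, by simpa using hmin, ?_, by simp⟩
    intro p hp q hq hne
    rw [Finset.mem_singleton] at hp hq
    exact absurd (hp.trans hq.symm) hne
  have hqe' := mul_comm_of_mul_eq he hq heq
  have hr : IsStarProjection (e - q) := hq.sub_of_mul_eq_left he hqe'
  have her : e * (e - q) = e - q := by rw [mul_sub, he.isIdempotentElem.eq, heq]
  obtain ⟨M, hM⟩ := ih _ (hn ▸ finrank_rightIdeal_lt heF he hq heq hqe) hqF hq rfl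
  obtain ⟨N, hN⟩ := ih _ (hn ▸ finrank_rightIdeal_lt heF he hr her (by simpa using hq0))
    (sub_mem heF hqF) hr rfl
  have hqr : q * (e - q) = 0 := by rw [mul_sub, hqe', hq.isIdempotentElem.eq, sub_self]
  have hMN : ∀ p ∈ M, ∀ s ∈ N, p * s = 0 := fun p hp s hs => by
    rw [← hM.mul_eq' hp, ← hN.mul_eq hs, mul_assoc, ← mul_assoc q, hqr, zero_mul, mul_zero]
  have hNM : ∀ p ∈ M, ∀ s ∈ N, s * p = 0 := fun p hp s hs => by
    have := congrArg star (hMN p hp s hs)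
    rwa [star_mul, (hM.minimal p hp).proj.isSelfAdjoint.star_eq,
      (hN.minimal s hs).proj.isSelfAdjoint.star_eq, star_zero] at this
  have hdis : Disjoint M N := by
    refine Finset.disjoint_left.2 fun p hp hp' => (hM.minimal p hp).ne_zero ?_
    rw [← (hM.minimal p hp).proj.isIdempotentElem.eq, hMN p hp p hp']
  refine ⟨M ∪ N, fun p hp => ?_, fun p hp s hs hne => ?_, ?_⟩
  · rcases Finset.mem_union.1 hp with hp | hp
    exacts [hM.minimal p hp, hN.minimal p hp]
  · rcases Finset.mem_union.1 hp with hp | hp <;> rcases Finset.mem_union.1 hs with hs | hs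
    exacts [hM.orthogonal p hp s hs hne, hMN p hp s hs, hNM s hs p hp, hN.orthogonal p hp s hs hne]
  · rw [Finset.sum_union hdis, hM.sum_eq, hN.sum_eq, add_sub_cancel]

/-- A finite-dimensional ⋆-subalgebra of a C⋆-algebra has a unit: if the projection `u` is not a unit,
a spectral projection of some `b b^*` with `u b = 0` can be added to it, and this enlarges `u F`. -/
theorem exists_unit (F : NonUnitalStarSubalgebra ℂ A) [FiniteDimensional ℂ F] :
    ∃ u ∈ F, IsStarProjection u ∧ ∀ a ∈ F, u * a = a := by
  have hfd : FiniteDimensional ℂ F.toSubmodule := ‹_›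
  suffices ∀ u ∈ F, IsStarProjection u → ∃ u ∈ F, IsStarProjection u ∧ ∀ a ∈ F, u * a = a from
    this 0 (zero_mem F) (IsStarProjection.zero A)
  intro u huF hu
  induction hn : Module.finrank ℂ F.toSubmodule - Module.finrank ℂ (rightIdeal F u)
    using Nat.strong_induction_on generalizing u with
  | _ n ih =>
  by_cases hunit : ∀ a ∈ F, u * a = a
  · exact ⟨u, huF, hu, hunit⟩
  push Not at hunit
  obtain ⟨a, haF, ha⟩ := hunit
  have hb : a - u * a ≠ 0 := fun h => ha (sub_eq_zero.1 h).symm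
  have hub : u * (a - u * a) = 0 := by
    rw [mul_sub, ← mul_assoc, hu.isIdempotentElem.eq, sub_self]
  have hbF : a - u * a ∈ F := sub_mem haF (mul_mem huF haF)
  obtain ⟨r, hr, q, hqF, hq, hq0, hcq⟩ := exists_spectral_projection
    (mul_mem hbF (star_mem hbF)) (IsSelfAdjoint.mul_star_self _)
    (fun h => hb (CStarRing.mul_star_self_eq_zero_iff _ |>.1 h))
  have huq : u * q = 0 := by
    have h1 : u * ((r : ℂ) • q) = 0 := by
      rw [← hcq, ← mul_assoc, ← mul_assoc, hub, zero_mul, zero_mul]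
    rw [mul_smul_comm] at h1
    exact (smul_eq_zero.1 h1).resolve_left (Complex.ofReal_ne_zero.2 hr)
  have hqu : q * u = 0 := by
    have := congrArg star huq
    rwa [star_mul, hq.isSelfAdjoint.star_eq, hu.isSelfAdjoint.star_eq, star_zero] at this
  have hv : IsStarProjection (u + q) := hu.add hq huq
  have hvu : (u + q) * u = u := by rw [add_mul, hu.isIdempotentElem.eq, hqu, add_zero]
  have hlt := finrank_rightIdeal_lt (add_mem huF hqF) hv hu hvu (by simpa using hq0)
  have hle : Module.finrank ℂ (rightIdeal F (u + q)) ≤ Module.finrank ℂ F.toSubmodule :=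
    Submodule.finrank_mono fun a ha => ha.1
  exact ih _ (by omega) (u + q) (add_mem huF hqF) hv rfl

/-- Murray–von Neumann equivalence of projections within `F`. -/
def MvNEquiv (F : NonUnitalStarSubalgebra ℂ A) (p q : A) : Prop :=
  ∃ w ∈ F, w * star w = p ∧ star w * w = q

theorem IsMinimalProjection.mvnEquiv_refl {p : A} (hp : IsMinimalProjection F p) :
    MvNEquiv F p p := by
  refine ⟨p, hp.mem, ?_, ?_⟩ <;>
  rw [hp.proj.isSelfAdjoint.star_eq, hp.proj.isIdempotentElem.eq]

theorem MvNEquiv.symm {p q : A} (h : MvNEquiv F p q) : MvNEquiv F q p := by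
  obtain ⟨w, hw, h1, h2⟩ := h
  exact ⟨star w, star_mem hw, by rwa [star_star], by rwa [star_star]⟩

theorem MvNEquiv.trans {p q r : A} (hp : IsStarProjection p) (hr : IsStarProjection r)
    (h : MvNEquiv F p q) (h' : MvNEquiv F q r) : MvNEquiv F p r := by
  obtain ⟨w, hw, h1, h2⟩ := h
  obtain ⟨v, hv, h3, h4⟩ := h'
  refine ⟨w * v, mul_mem hw hv, ?_, ?_⟩
  · calc w * v * star (w * v) = w * (v * star v) * star w := by rw [star_mul]; noncomm_ring
      _ = (w * star w) * (w * star w) := by rw [h3, ← h2]; noncomm_ring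
      _ = p := by rw [h1, hp.isIdempotentElem.eq]
  · calc star (w * v) * (w * v) = star v * (star w * w) * v := by rw [star_mul]; noncomm_ring
      _ = (star v * v) * (star v * v) := by rw [h2, ← h3]; noncomm_ring
      _ = r := by rw [h4, hr.isIdempotentElem.eq]

/-- Two minimal projections are equivalent unless they are disjoint: a nonzero element of `p F q` is
a multiple of a partial isometry from `q` to `p`. -/
theorem IsMinimalProjection.mvnEquiv_of_ne_zero {p q a : A} (hp : IsMinimalProjection F p)
    (hq : IsMinimalProjection F q) (ha : a ∈ F) (h : p * a * q ≠ 0) : MvNEquiv F p q := by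
  let _ := CStarAlgebra.spectralOrder A
  let _ := CStarAlgebra.spectralOrderedRing A
  set b := p * a * q with hb
  have hbF : b ∈ F := mul_mem (mul_mem hp.mem ha) hq.mem
  have hpb : p * b = b := by rw [hb, ← mul_assoc, ← mul_assoc, hp.proj.isIdempotentElem.eq]
  have hbq : b * q = b := by rw [hb, mul_assoc, hq.proj.isIdempotentElem.eq]
  obtain ⟨z, hz⟩ := hp.corner (b * star b) (mul_mem hbF (star_mem hbF))
  obtain ⟨w, hw⟩ := hq.corner (star b * b) (mul_mem (star_mem hbF) hbF)
  have hbp : star b * p = star b := by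
    have := congrArg star hpb
    rwa [star_mul, hp.proj.isSelfAdjoint.star_eq] at this
  have hqb : q * star b = star b := by
    have := congrArg star hbq
    rwa [star_mul, hq.proj.isSelfAdjoint.star_eq] at this
  rw [← mul_assoc, hpb, mul_assoc, hbp] at hz
  rw [← mul_assoc, hqb, mul_assoc, hbq] at hw
  have hzw : z = w := by
    have h1 : b * star b * b = z • b := by rw [hz, smul_mul_assoc, hpb]
    have h2 : b * star b * b = w • b := by rw [mul_assoc, hw, mul_smul_comm, hbq]
    exact smul_left_injective ℂ h (h1.symm.trans h2)
  have hz0 : z ≠ 0 := by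
    rintro rfl
    rw [zero_smul] at hz
    exact h ((CStarRing.mul_star_self_eq_zero_iff b).1 hz)
  have hzr : (starRingEnd ℂ) z = z := by
    have h1 : star (z • p) = z • p := by rw [← hz, star_mul, star_star]
    rw [star_smul, hp.proj.isSelfAdjoint.star_eq] at h1
    exact smul_left_injective ℂ hp.ne_zero h1
  obtain ⟨t, rfl⟩ := Complex.conj_eq_iff_real.1 hzr
  have ht : 0 < t := by
    by_contra! hneg
    have h1 : (0 : A) ≤ (t : ℂ) • p := hz ▸ mul_star_self_nonneg b
    have h2 : (0 : A) ≤ (-t) • p := smul_nonneg (by linarith) hp.proj.nonneg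
    have h3 : (t : ℂ) • p = 0 := by
      refine le_antisymm ?_ h1
      rw [neg_smul] at h2
      exact neg_nonneg.1 h2
    exact (smul_ne_zero hz0 hp.ne_zero) h3
  have hs : ((Real.sqrt t)⁻¹ : ℂ) * ((Real.sqrt t)⁻¹ : ℂ) * (t : ℂ) = 1 := by
    have : Real.sqrt t * Real.sqrt t = t := Real.mul_self_sqrt ht.le
    have h4 : Real.sqrt t ≠ 0 := (Real.sqrt_pos.2 ht).ne'
    rw [← mul_inv, ← Complex.ofReal_mul, this, inv_mul_cancel₀ hz0]
  have hstar : star (((Real.sqrt t)⁻¹ : ℂ) • b) = ((Real.sqrt t)⁻¹ : ℂ) • star b := by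
    rw [star_smul, Complex.star_def, map_inv₀, Complex.conj_ofReal]
  refine ⟨((Real.sqrt t)⁻¹ : ℂ) • b, SMulMemClass.smul_mem _ hbF, ?_, ?_⟩
  · rw [hstar, smul_mul_smul_comm, hz, smul_smul, hs, one_smul]
  · rw [hstar, smul_mul_smul_comm, hw, ← hzw, smul_smul, hs, one_smul]

end FiniteDimCStar
end

noncomputable section

/-! ### One step of the diagram -/

namespace FiniteDimCStar

variable {A : Type*} [NonUnitalCStarAlgebra A] {F F' : NonUnitalStarSubalgebra ℂ A}

/-- A finite set contains a set of representatives for a symmetric relation. -/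
theorem exists_representatives {X : Type*} (r : X → X → Prop) (hs : ∀ a b, r a b → r b a)
    (N : Finset X) (hr : ∀ a ∈ N, r a a) :
    ∃ R ⊆ N, (∀ m ∈ N, ∃ v ∈ R, r m v) ∧ ∀ v ∈ R, ∀ v' ∈ R, r v v' → v = v' := by
  classical
  induction N using Finset.induction_on with
  | empty => exact ⟨∅, by simp⟩
  | insert a N _ ih =>
    obtain ⟨R, hR, h1, h2⟩ := ih fun b hb => hr b (Finset.mem_insert_of_mem hb)
    by_cases h : ∃ v ∈ R, r a v
    · refine ⟨R, hR.trans (Finset.subset_insert a N), fun m hm => ?_, h2⟩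
      rcases Finset.mem_insert.1 hm with rfl | hm
      exacts [h, h1 m hm]
    · push Not at h
      refine ⟨insert a R, Finset.insert_subset_insert a hR, fun m hm => ?_, fun v hv v' hv' hvv => ?_⟩
      · rcases Finset.mem_insert.1 hm with rfl | hm
        · exact ⟨m, Finset.mem_insert_self m R, hr m (Finset.mem_insert_self m N)⟩
        · obtain ⟨v, hv, hmv⟩ := h1 m hm
          exact ⟨v, Finset.mem_insert_of_mem hv, hmv⟩
      · rcases Finset.mem_insert.1 hv with h3 | h3 <;>
          rcases Finset.mem_insert.1 hv' with h4 | h4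
        · exact h3.trans h4.symm
        · exact absurd (h3 ▸ hvv) (h v' h4)
        · exact absurd (h4 ▸ hs _ _ hvv) (h v h3)
        · exact h2 v h3 v' h4 hvv

/-- A partial isometry satisfies `w w^* w = w`. -/
theorem mul_star_mul_self_eq {w v : A} (hv : IsStarProjection v) (hw : star w * w = v) :
    w * v = w := by
  subst hw
  rw [← sub_eq_zero, ← CStarRing.star_mul_self_eq_zero_iff]
  have hh := hv.isIdempotentElem.eq
  have : star (w * (star w * w) - w) * (w * (star w * w) - w)
      = (star w * w) * (star w * w) * (star w * w) - (star w * w) * (star w * w)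
        - (star w * w) * (star w * w) + star w * w := by
    simp only [star_sub, star_mul, star_star]; noncomm_ring
  rw [this, hh, hh, sub_self, zero_sub, neg_add_cancel]

/-- The vertices of one level of a Bratteli diagram realised in a C⋆-algebra: one projection of
`F` for every vertex, together with the unit of `F`. -/
structure Level (F : NonUnitalStarSubalgebra ℂ A) where
  p : ℕ
  proj : Fin p → A
  unit : A
  proj_mem : ∀ j, proj j ∈ F
  isProj : ∀ j, IsStarProjection (proj j)
  proj_ne_zero : ∀ j, proj j ≠ 0
  unit_mem : unit ∈ F
  unit_proj : IsStarProjection unit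
  unit_mul : ∀ a ∈ F, unit * a = a

/-- The edges between two consecutive levels, realised as partial isometries `t` of `F`. An edge
from `j` to `i` has source projection `proj i` and range projection below `proj j`, and the ranges
of the edges that leave `j` decompose `proj j`. The vertices in `S` are the new ones, orthogonal
to `F`; they account for the difference of the units. -/
structure Step (X : Level F) (Y : Level F') where
  S : Finset (Fin Y.p)
  k : Fin Y.p → Fin X.p → ℕ
  t : ∀ i j, Fin (k i j) → A
  t_mem : ∀ i j e, t i j e ∈ F
  star_t_mul_t : ∀ i j e, star (t i j e) * t i j e = Y.proj i
  t_orth : ∀ j, ∀ x y : Σ i, Fin (k i j), x ≠ y → star (t x.1 j x.2) * t y.1 j y.2 = 0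
  t_mul_proj : ∀ i j e, t i j e * Y.proj i = t i j e
  sum_t : ∀ j, ∑ i, ∑ e, t i j e * star (t i j e) = X.proj j
  unit_eq : Y.unit = X.unit + ∑ i ∈ S, Y.proj i
  proj_mul : ∀ i ∈ S, ∀ a ∈ F, Y.proj i * a = 0
  corner : ∀ i, ∀ a ∈ F, ∃ z : ℂ, Y.proj i * a * Y.proj i = z • Y.proj i
  corner_ne : ∀ i i', i ≠ i' → ∀ a ∈ F, Y.proj i * a * Y.proj i' = 0
  exists_in : ∀ i, i ∉ S → ∃ j, 0 < k i j
  exists_out : ∀ j, ∃ i, 0 < k i j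
  S_orth : ∀ i ∈ S, ∀ i' ∈ S, i ≠ i' → Y.proj i * Y.proj i' = 0

/-- Every level can be continued. The new vertices are of two kinds: a set `R` of representatives
of the minimal projections of `F` that occur in decompositions `M j` of the projections of the
vertices `j`, and a decomposition `Q` of the difference of the units of `F'` and `F`. -/
theorem exists_step [FiniteDimensional ℂ F] [FiniteDimensional ℂ F'] (hF : F ≤ F') (X : Level F) :
    ∃ Y : Level F', Nonempty (Step X Y) := by
  classical
  choose M hM using fun j => exists_minimalDecomposition (X.proj_mem j) (X.isProj j)
  set N : Finset A := Finset.univ.biUnion M with hN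
  have hNmin : ∀ m ∈ N, IsMinimalProjection F m := fun m hm => by
    obtain ⟨j, -, hj⟩ := Finset.mem_biUnion.1 hm
    exact (hM j).minimal m hj
  have hMN : ∀ j, ∀ m ∈ M j, m ∈ N := fun j m hm =>
    Finset.mem_biUnion.2 ⟨j, Finset.mem_univ j, hm⟩
  obtain ⟨R, hRN, hR, hR'⟩ := exists_representatives (MvNEquiv F) (fun _ _ => MvNEquiv.symm) N
    fun m hm => (hNmin m hm).mvnEquiv_refl
  obtain ⟨u', hu'F, hu', hu'm⟩ := exists_unit F'
  have hu'u : u' * X.unit = X.unit := hu'm _ (hF X.unit_mem)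
  obtain ⟨Q, hQ⟩ := exists_minimalDecomposition (sub_mem hu'F (hF X.unit_mem))
    (X.unit_proj.sub_of_mul_eq_right hu' hu'u)
  have hQF : ∀ q ∈ Q, ∀ a ∈ F, q * a = 0 := fun q hq a ha => by
    rw [← hQ.mul_eq' hq, mul_assoc, sub_mul, hu'm a (hF ha), X.unit_mul a ha, sub_self, mul_zero]
  have hFQ : ∀ q ∈ Q, ∀ a ∈ F, a * q = 0 := fun q hq a ha => by
    have := congrArg star (hQF q hq (star a) (star_mem ha))
    rwa [star_mul, star_star, (hQ.minimal q hq).proj.isSelfAdjoint.star_eq, star_zero] at this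
  have hRQ : Disjoint R Q := Finset.disjoint_left.2 fun r hr hr' => (hQ.minimal r hr').ne_zero <| by
    rw [← (hQ.minimal r hr').proj.isIdempotentElem.eq]
    exact hQF r hr' r (hNmin r (hRN hr)).mem
  have hW : ∀ m v : A, ∃ w : A, MvNEquiv F m v → w ∈ F ∧ w * star w = m ∧ star w * w = v :=
    fun m v => by
      by_cases h : MvNEquiv F m v
      · obtain ⟨w, hw⟩ := h
        exact ⟨w, fun _ => hw⟩
      · exact ⟨0, fun h' => absurd h' h⟩
  choose W hW using hW
  set V := R ∪ Q with hV
  -- The edges from `j` to `v` are the pieces of `proj j` that are equivalent to `v`. For `v` in `Q`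
  -- there are none.
  let K : A → Fin X.p → Finset A := fun v j =>
    if v ∈ R then (M j).filter fun m => MvNEquiv F m v else ∅
  have hK : ∀ v j m, m ∈ K v j ↔ v ∈ R ∧ m ∈ M j ∧ MvNEquiv F m v := fun v j m => by
    by_cases h : v ∈ R <;> simp [K, h]
  have hproj : ∀ v ∈ V, IsStarProjection v ∧ v ≠ 0 ∧ v ∈ F' := fun v hv => by
    rcases Finset.mem_union.1 hv with h | h
    · exact ⟨(hNmin v (hRN h)).proj, (hNmin v (hRN h)).ne_zero, hF (hNmin v (hRN h)).mem⟩
    · exact ⟨(hQ.minimal v h).proj, (hQ.minimal v h).ne_zero, (hQ.minimal v h).mem⟩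
  let P : Fin V.card → A := fun i => (V.equivFin.symm i : A)
  have hPV : ∀ i, P i ∈ V := fun i => (V.equivFin.symm i).2
  have hPinj : ∀ i i', P i = P i' → i = i' := fun i i' h =>
    V.equivFin.symm.injective (Subtype.ext h)
  have hPsurj : ∀ v ∈ V, ∃ i, P i = v := fun v hv =>
    ⟨V.equivFin ⟨v, hv⟩, by simp [P]⟩
  let m : ∀ i j, Fin (K (P i) j).card → A := fun i j e => ((K (P i) j).equivFin.symm e : A)
  have hm : ∀ i j e, m i j e ∈ K (P i) j := fun i j e => ((K (P i) j).equivFin.symm e).2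
  have hminj : ∀ i j e e', m i j e = m i j e' → e = e' := fun i j e e' h =>
    (K (P i) j).equivFin.symm.injective (Subtype.ext h)
  have hm' := fun i j e => (hK (P i) j (m i j e)).1 (hm i j e)
  have hw := fun i j e => hW (m i j e) (P i) (hm' i j e).2.2
  let Y : Level F' :=
    { p := V.card
      proj := P
      unit := u'
      proj_mem := fun i => (hproj _ (hPV i)).2.2
      isProj := fun i => (hproj _ (hPV i)).1
      proj_ne_zero := fun i => (hproj _ (hPV i)).2.1
      unit_mem := hu'F
      unit_proj := hu'
      unit_mul := hu'm }
  have hsumV : ∀ (T : Finset A) (hT : T ⊆ V) (g : A → A),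
      ∑ i ∈ Finset.univ.filter (fun i => P i ∈ T), g (P i) = ∑ v ∈ T, g v := by
    intro T hT g
    refine Finset.sum_bij (fun i _ => P i) (fun i hi => (Finset.mem_filter.1 hi).2)
      (fun i _ i' _ h => hPinj i i' h) (fun v hv => ?_) fun _ _ => rfl
    obtain ⟨i, rfl⟩ := hPsurj v (hT hv)
    exact ⟨i, by simpa using hv, rfl⟩
  have hWid : ∀ i j e, W (m i j e) (P i) * P i = W (m i j e) (P i) := fun i j e =>
    mul_star_mul_self_eq (hproj _ (hPV i)).1 (hw i j e).2.2
  have hmW : ∀ i j e, m i j e * W (m i j e) (P i) = W (m i j e) (P i) := fun i j e => by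
    calc m i j e * W (m i j e) (P i)
        = W (m i j e) (P i) * (star (W (m i j e) (P i)) * W (m i j e) (P i)) := by
          rw [← mul_assoc, (hw i j e).2.1]
      _ = W (m i j e) (P i) := by rw [(hw i j e).2.2, hWid i j e]
  have hWm : ∀ i j e, star (W (m i j e) (P i)) * m i j e = star (W (m i j e) (P i)) :=
    fun i j e => by
      have := congrArg star (hmW i j e)
      rwa [star_mul, ((hM j).minimal _ (hm' i j e).2.1).proj.isSelfAdjoint.star_eq] at this
  refine ⟨Y, ⟨{
    S := Finset.univ.filter fun i => P i ∈ Q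
    k := fun i j => (K (P i) j).card
    t := fun i j e => W (m i j e) (P i)
    t_mem := fun i j e => (hw i j e).1
    star_t_mul_t := fun i j e => (hw i j e).2.2
    t_orth := ?_
    t_mul_proj := hWid
    sum_t := ?_
    unit_eq := ?_
    proj_mul := fun i hi a ha => hQF _ (Finset.mem_filter.1 hi).2 a ha
    corner := ?_
    corner_ne := ?_
    exists_in := ?_
    exists_out := ?_
    S_orth := fun i hi i' hi' hne => hQ.orthogonal _ (Finset.mem_filter.1 hi).2 _
      (Finset.mem_filter.1 hi').2 fun h => hne (hPinj i i' h) }⟩⟩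
  · rintro j ⟨i, e⟩ ⟨i', e'⟩ hne
    show star (W (m i j e) (P i)) * W (m i' j e') (P i') = 0
    by_cases h : m i j e = m i' j e'
    · refine absurd ?_ hne
      have h1 : P i = P i' := by
        refine hR' _ (hm' i j e).1 _ (hm' i' j e').1 ?_
        refine (hm' i j e).2.2.symm.trans (hproj _ (hPV i)).1 (hproj _ (hPV i')).1 ?_
        rw [h]
        exact (hm' i' j e').2.2
      obtain rfl := hPinj _ _ h1
      obtain rfl := hminj _ _ _ _ h
      rfl
    · rw [← hWm i j e, ← hmW i' j e', mul_assoc, ← mul_assoc (m i j e),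
        (hM j).orthogonal _ (hm' i j e).2.1 _ (hm' i' j e').2.1 h, zero_mul, mul_zero]
  · intro j
    calc ∑ i, ∑ e, W (m i j e) (P i) * star (W (m i j e) (P i))
        = ∑ i, ∑ e, m i j e :=
          Finset.sum_congr rfl fun i _ => Finset.sum_congr rfl fun e _ => (hw i j e).2.1
      _ = ∑ i, ∑ x ∈ K (P i) j, x := Finset.sum_congr rfl fun i _ => by
          rw [← Finset.sum_coe_sort (K (P i) j)]
          exact Equiv.sum_comp (K (P i) j).equivFin.symm fun x => (x : A)
      _ = ∑ v ∈ V, ∑ x ∈ K v j, x := by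
          rw [← hsumV V subset_rfl fun v => ∑ x ∈ K v j, x]
          exact Finset.sum_congr (by ext i; simp [hPV]) fun _ _ => rfl
      _ = ∑ v ∈ R, ∑ x ∈ K v j, x := by
          refine (Finset.sum_subset Finset.subset_union_left fun v _ hv => ?_).symm
          simp [K, hv]
      _ = ∑ v ∈ R, ∑ x ∈ M j, if MvNEquiv F x v then x else 0 :=
          Finset.sum_congr rfl fun v hv => by simp [K, hv, Finset.sum_filter]
      _ = ∑ x ∈ M j, ∑ v ∈ R, if MvNEquiv F x v then x else 0 := Finset.sum_comm
      _ = ∑ x ∈ M j, x := by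
          refine Finset.sum_congr rfl fun x hx => ?_
          obtain ⟨v, hv, hxv⟩ := hR x (hMN j x hx)
          rw [Finset.sum_eq_single v]
          · exact if_pos hxv
          · intro v' hv' hne
            refine if_neg fun h => hne ?_
            exact hR' v' hv' v hv (h.symm.trans (hNmin _ (hRN hv')).proj (hNmin _ (hRN hv)).proj hxv)
          · exact fun h => absurd hv h
      _ = X.proj j := (hM j).sum_eq
  · rw [show ∑ i ∈ Finset.univ.filter (fun i => P i ∈ Q), Y.proj i = ∑ v ∈ Q, v from
      hsumV Q Finset.subset_union_right fun v => v, hQ.sum_eq]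
    exact (add_sub_cancel X.unit u').symm
  · intro i a ha
    rcases Finset.mem_union.1 (hPV i) with h | h
    · exact (hNmin _ (hRN h)).corner a ha
    · refine ⟨0, ?_⟩
      show P i * a * P i = 0 • P i
      rw [hQF _ h a ha, zero_mul, zero_smul]
  · intro i i' hne a ha
    show P i * a * P i' = 0
    rcases Finset.mem_union.1 (hPV i) with h | h
    · rcases Finset.mem_union.1 (hPV i') with h' | h'
      · by_contra h0
        refine hne (hPinj _ _ (hR' _ h _ h' ?_))
        exact (hNmin _ (hRN h)).mvnEquiv_of_ne_zero (hNmin _ (hRN h')) ha h0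
      · rw [mul_assoc, hFQ _ h' a ha, mul_zero]
    · rw [hQF _ h a ha, zero_mul]
  · intro i hi
    have hiR : P i ∈ R := (Finset.mem_union.1 (hPV i)).resolve_right fun h => hi (by simpa using h)
    obtain ⟨j, -, hj⟩ := Finset.mem_biUnion.1 (hRN hiR)
    exact ⟨j, Finset.card_pos.2 ⟨P i, (hK _ _ _).2 ⟨hiR, hj, (hNmin _ (hRN hiR)).mvnEquiv_refl⟩⟩⟩
  · intro j
    have hne : (M j).Nonempty := by
      rw [Finset.nonempty_iff_ne_empty]
      intro h
      have := (hM j).sum_eq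
      rw [h, Finset.sum_empty] at this
      exact X.proj_ne_zero j this.symm
    obtain ⟨x, hx⟩ := hne
    obtain ⟨v, hv, hxv⟩ := hR x (hMN j x hx)
    obtain ⟨i, rfl⟩ := hPsurj v (Finset.mem_union_left Q hv)
    exact ⟨i, Finset.card_pos.2 ⟨x, (hK _ _ _).2 ⟨hv, hx, hxv⟩⟩⟩

end FiniteDimCStar
end

noncomputable section

/-! ### Finite paths in a Bratteli diagram -/

namespace BratteliDiagram

/-- The finite paths in a Bratteli diagram that start at a vertex of `S` and end at the `j`-th
vertex of level `n`. -/
inductive PathTo (B : BratteliDiagram) (S : ∀ n, Finset (Fin (B.p n))) :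
    ∀ n, Fin (B.p n) → Type
  | start {n : ℕ} {j : Fin (B.p n)} (h : j ∈ S n) : PathTo B S n j
  | snoc {n : ℕ} {i : Fin (B.p (n + 1))} {j : Fin (B.p n)} (e : Fin (B.k n i j))
      (α : PathTo B S n j) : PathTo B S (n + 1) i

variable {B : BratteliDiagram} {S : ∀ n, Finset (Fin (B.p n))}

namespace PathTo

/-- A path to level `0` is a vertex of `S`. -/
def zeroEquiv (j : Fin (B.p 0)) : PathTo B S 0 j ≃ PLift (j ∈ S 0) where
  toFun α := match α with | start h => ⟨h⟩
  invFun h := start h.down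
  left_inv α := by cases α; rfl
  right_inv _ := rfl

/-- A path to level `n + 1` is a vertex of `S` or a path to level `n` followed by an edge. -/
def succEquiv {n : ℕ} (i : Fin (B.p (n + 1))) :
    PathTo B S (n + 1) i ≃
      PLift (i ∈ S (n + 1)) ⊕ Σ jk : (Σ j, Fin (B.k n i j)), PathTo B S n jk.1 where
  toFun α := match α with
    | start h => Sum.inl ⟨h⟩
    | @snoc _ _ _ _ j e α => Sum.inr ⟨⟨j, e⟩, α⟩
  invFun x := match x with
    | Sum.inl h => start h.down
    | Sum.inr ⟨⟨_, e⟩, α⟩ => snoc e α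
  left_inv α := by cases α <;> rfl
  right_inv x := by rcases x with h | ⟨⟨j, e⟩, α⟩ <;> rfl

instance instFintype : ∀ (n : ℕ) (j : Fin (B.p n)), Fintype (PathTo B S n j)
  | 0, j => Fintype.ofEquiv _ (zeroEquiv j).symm
  | n + 1, i =>
    have := instFintype n
    Fintype.ofEquiv _ (succEquiv i).symm

instance {n : ℕ} {j : Fin (B.p n)} : DecidableEq (PathTo B S n j) := Classical.decEq _

theorem sum_succ {X : Type*} [AddCommMonoid X] {n : ℕ} {i : Fin (B.p (n + 1))}
    (g : PathTo B S (n + 1) i → X) :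
    ∑ α, g α = (∑ h : PLift (i ∈ S (n + 1)), g (start h.down)) +
      ∑ j, ∑ e : Fin (B.k n i j), ∑ α : PathTo B S n j, g (snoc e α) := by
  rw [← Equiv.sum_comp (succEquiv i).symm, Fintype.sum_sum_type, Fintype.sum_sigma,
    Fintype.sum_sigma]
  rfl

end PathTo

/-! ### The system of path algebras -/

open scoped Matrix.Norms.L2Operator in
/-- The path algebra of level `n`: one full matrix algebra for every vertex `j`, whose matrices
are indexed by the paths from `S` to `j`. -/
abbrev PathAlg (B : BratteliDiagram) (S : ∀ n, Finset (Fin (B.p n))) (n : ℕ) : Type :=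
  ∀ j : Fin (B.p n), Matrix (PathTo B S n j) (PathTo B S n j) ℂ

open scoped Matrix.Norms.L2Operator in
instance (n : ℕ) : NonUnitalCStarAlgebra (PathAlg B S n) := inferInstance

/-- The blocks of the image of `a` at the vertex `i`, one for every edge to `i`. -/
abbrev pathBlocks {n : ℕ} (a : PathAlg B S n) (i : Fin (B.p (n + 1))) :
    ∀ jk : (Σ j, Fin (B.k n i j)), Matrix (PathTo B S n jk.1) (PathTo B S n jk.1) ℂ :=
  fun jk => a jk.1

/-- The matrix of `a` with respect to the paths to a vertex of the next level: the entry at two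
paths with the same last edge is the entry of `a` at the truncated paths. -/
def pathMapFun {n : ℕ} (a : PathAlg B S n) : PathAlg B S (n + 1) := fun i =>
  (Matrix.fromBlocks 0 0 0 (Matrix.blockDiagonal' (pathBlocks a i))).submatrix
    (PathTo.succEquiv i) (PathTo.succEquiv i)

theorem pathMapFun_start_left {n : ℕ} (a : PathAlg B S n) {i : Fin (B.p (n + 1))}
    (h : i ∈ S (n + 1)) (y : PathTo B S (n + 1) i) : pathMapFun a i (.start h) y = 0 := by
  cases y <;> simp [pathMapFun, PathTo.succEquiv]

theorem pathMapFun_start_right {n : ℕ} (a : PathAlg B S n) {i : Fin (B.p (n + 1))}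
    (h : i ∈ S (n + 1)) (y : PathTo B S (n + 1) i) : pathMapFun a i y (.start h) = 0 := by
  cases y <;> simp [pathMapFun, PathTo.succEquiv]

theorem pathMapFun_snoc {n : ℕ} (a : PathAlg B S n) {i : Fin (B.p (n + 1))} {j : Fin (B.p n)}
    (e : Fin (B.k n i j)) (α β : PathTo B S n j) :
    pathMapFun a i (.snoc e α) (.snoc e β) = a j α β := by
  simp only [pathMapFun, PathTo.succEquiv, Matrix.submatrix_apply, Equiv.coe_fn_mk,
    Matrix.fromBlocks_apply₂₂]
  exact Matrix.blockDiagonal'_apply_eq (pathBlocks a i) ⟨j, e⟩ α β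

theorem pathMapFun_snoc_ne {n : ℕ} (a : PathAlg B S n) {i : Fin (B.p (n + 1))} {j j' : Fin (B.p n)}
    (e : Fin (B.k n i j)) (e' : Fin (B.k n i j')) (α : PathTo B S n j) (β : PathTo B S n j')
    (h : (⟨j, e⟩ : Σ j, Fin (B.k n i j)) ≠ ⟨j', e'⟩) :
    pathMapFun a i (.snoc e α) (.snoc e' β) = 0 := by
  simp only [pathMapFun, PathTo.succEquiv, Matrix.submatrix_apply, Equiv.coe_fn_mk,
    Matrix.fromBlocks_apply₂₂]
  exact Matrix.blockDiagonal'_apply_ne (pathBlocks a i) α β h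

/-- The embedding of the path algebra of level `n` into the one of level `n + 1`. -/
def pathMap (B : BratteliDiagram) (S : ∀ n, Finset (Fin (B.p n))) (n : ℕ) :
    PathAlg B S n →⋆ₙₐ[ℂ] PathAlg B S (n + 1) where
  toFun := pathMapFun
  map_smul' z a := by
    funext i
    show pathMapFun (z • a) i = z • pathMapFun a i
    have : pathBlocks (z • a) i = z • pathBlocks a i := rfl
    rw [pathMapFun, pathMapFun, this, Matrix.blockDiagonal'_smul]
    show _ = (z • Matrix.fromBlocks 0 0 0 (Matrix.blockDiagonal' (pathBlocks a i))).submatrix _ _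
    rw [Matrix.fromBlocks_smul]
    simp
  map_zero' := by
    funext i
    have : pathBlocks (0 : PathAlg B S n) i = 0 := rfl
    rw [pathMapFun, this, Matrix.blockDiagonal'_zero, Matrix.fromBlocks_zero, Matrix.submatrix_zero]
    rfl
  map_add' a b := by
    funext i
    show pathMapFun (a + b) i = pathMapFun a i + pathMapFun b i
    have : pathBlocks (a + b) i = pathBlocks a i + pathBlocks b i := rfl
    rw [pathMapFun, pathMapFun, pathMapFun, this, Matrix.blockDiagonal'_add]
    show _ = (Matrix.fromBlocks 0 0 0 (Matrix.blockDiagonal' (pathBlocks a i)) +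
      Matrix.fromBlocks 0 0 0 (Matrix.blockDiagonal' (pathBlocks b i))).submatrix _ _
    rw [Matrix.fromBlocks_add]
    simp
  map_mul' a b := by
    funext i
    show pathMapFun (a * b) i = pathMapFun a i * pathMapFun b i
    have : pathBlocks (a * b) i = fun jk => pathBlocks a i jk * pathBlocks b i jk := rfl
    rw [pathMapFun, pathMapFun, pathMapFun, this, Matrix.blockDiagonal'_mul,
      Matrix.submatrix_mul_equiv, Matrix.fromBlocks_multiply]
    simp
  map_star' a := by
    funext i
    show pathMapFun (star a) i = (pathMapFun a i).conjTranspose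
    have : pathBlocks (star a) i = fun jk => (pathBlocks a i jk).conjTranspose := rfl
    rw [pathMapFun, pathMapFun, this, ← Matrix.blockDiagonal'_conjTranspose,
      Matrix.conjTranspose_submatrix, Matrix.fromBlocks_conjTranspose]
    simp

theorem pathMap_injective (hout : ∀ n j, ∃ i, 0 < B.k n i j) (n : ℕ) :
    Function.Injective (pathMap B S n) := by
  intro a b hab
  funext j
  ext α β
  obtain ⟨i, hi⟩ := hout n j
  have := congrFun (congrFun (congrFun hab i) (.snoc ⟨0, hi⟩ α)) (.snoc ⟨0, hi⟩ β)
  simpa only [pathMap, NonUnitalStarAlgHom.coe_mk', NonUnitalAlgHom.coe_mk, pathMapFun_snoc]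
    using this

/-- The path algebras form an inductive system as soon as every vertex emits an edge. -/
def pathSystem (B : BratteliDiagram) (S : ∀ n, Finset (Fin (B.p n)))
    (hout : ∀ n j, ∃ i, 0 < B.k n i j) : FDSystem.{0} where
  alg := PathAlg B S
  cstar _ := inferInstance
  finiteDimensional _ := by unfold PathAlg; infer_instance
  map := pathMap B S
  map_injective := pathMap_injective hout

/-- A map of matrix algebras that places `k` copies of a matrix in disjoint diagonal blocks has
multiplicity `k`. -/
theorem hasMultiplicity_of_embedding {m n k : ℕ}
    (φ : Matrix (Fin m) (Fin m) ℂ → Matrix (Fin n) (Fin n) ℂ) (g : Fin m × Fin k → Fin n)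
    (hg : Function.Injective g)
    (h1 : ∀ a x c y c', φ a (g (x, c)) (g (y, c')) = if c = c' then a x y else 0)
    (h2 : ∀ a x y, x ∉ Set.range g → φ a x y = 0) (h3 : ∀ a x y, y ∉ Set.range g → φ a x y = 0) :
    HasMultiplicity φ k := by
  classical
  let e : (Fin m × Fin k) ⊕ Fin (Fintype.card ↥(Set.range g)ᶜ) ≃ Fin n :=
    (Equiv.sumCongr (Equiv.ofInjective g hg) (Fintype.equivFin ↥(Set.range g)ᶜ).symm).trans
      (Equiv.Set.sumCompl (Set.range g))
  have he1 : ∀ x, e (Sum.inl x) = g x := fun x => by simp [e]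
  have he2 : ∀ x, e (Sum.inr x) ∉ Set.range g := fun x => by
    simp only [e, Equiv.trans_apply, Equiv.sumCongr_apply, Sum.map_inr, Equiv.Set.sumCompl_apply_inr]
    exact ((Fintype.equivFin ↥(Set.range g)ᶜ).symm x).2
  refine ⟨_, e, 1, fun a => ?_⟩
  rw [OneMemClass.coe_one, star_one, one_mul, mul_one]
  ext x y
  obtain ⟨x, rfl⟩ := e.surjective x
  obtain ⟨y, rfl⟩ := e.surjective y
  rw [Matrix.reindex_apply, Matrix.submatrix_apply, Equiv.symm_apply_apply, Equiv.symm_apply_apply]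
  rcases x with ⟨x, c⟩ | x <;> rcases y with ⟨y, c'⟩ | y
  · rw [he1, he1, h1, Matrix.fromBlocks_apply₁₁, Matrix.blockDiagonal_apply]
  · rw [h3 _ _ _ (he2 y)]; rfl
  · rw [h2 _ _ _ (he2 x)]; rfl
  · rw [h2 _ _ _ (he2 x)]; rfl

theorem corresponds_pathSystem (hout : ∀ n j, ∃ i, 0 < B.k n i j)
    (hin : ∀ n j, Nonempty (PathTo B S n j)) : B.Corresponds (pathSystem B S hout) := by
  classical
  let E : ∀ n j, PathTo B S n j ≃ Fin (Fintype.card (PathTo B S n j)) :=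
    fun n j => Fintype.equivFin _
  let θ : ∀ n, PathAlg B S n ≃⋆ₐ[ℂ]
      (∀ j, Matrix (Fin (Fintype.card (PathTo B S n j))) (Fin (Fintype.card (PathTo B S n j))) ℂ) :=
    fun n =>
    { toFun := fun a j => (a j).submatrix (E n j).symm (E n j).symm
      invFun := fun a j => (a j).submatrix (E n j) (E n j)
      left_inv := fun a => by funext j; simp
      right_inv := fun a => by funext j; simp
      map_mul' := fun a b => by funext j; simp [Matrix.submatrix_mul_equiv]
      map_add' := fun a b => by funext j; rfl
      map_star' := fun a => by funext j; rfl
      map_smul' := fun z a => by funext j; rfl }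
  refine ⟨fun n j => Fintype.card (PathTo B S n j), θ, fun n j => Fintype.card_pos_iff.2 (hin n j),
    fun n i j => ?_⟩
  let g : Fin (Fintype.card (PathTo B S n j)) × Fin (B.k n i j) →
      Fin (Fintype.card (PathTo B S (n + 1) i)) :=
    fun x => E (n + 1) i (.snoc x.2 ((E n j).symm x.1))
  have hφ : ∀ a x y, (fun a => θ (n + 1) ((pathSystem B S hout).map n ((θ n).symm (Pi.single j a))) i)
      a (E _ _ x) (E _ _ y) = pathMapFun ((θ n).symm (Pi.single j a)) i x y := fun a x y => by
    show pathMapFun ((θ n).symm (Pi.single j a)) i ((E _ _).symm (E _ _ x)) ((E _ _).symm (E _ _ y))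
      = _
    rw [Equiv.symm_apply_apply, Equiv.symm_apply_apply]
  have hθ : ∀ a j' α β, j' ≠ j → (θ n).symm (Pi.single j a) j' α β = 0 := fun a j' α β hne => by
    show (Pi.single j a : ∀ j, Matrix (Fin (Fintype.card (PathTo B S n j)))
      (Fin (Fintype.card (PathTo B S n j))) ℂ) j' (E n j' α) (E n j' β) = 0
    rw [Pi.single_eq_of_ne hne]; rfl
  have hθ' : ∀ a x y, (θ n).symm (Pi.single j a) j ((E n j).symm x) ((E n j).symm y) = a x y :=
    fun a x y => by
      show (Pi.single j a : ∀ j, Matrix (Fin (Fintype.card (PathTo B S n j)))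
        (Fin (Fintype.card (PathTo B S n j))) ℂ) j (E n j _) (E n j _) = _
      rw [Pi.single_eq_same, Equiv.apply_symm_apply, Equiv.apply_symm_apply]
  have hz : ∀ a (x y : PathTo B S (n + 1) i), (E _ _ x ∉ Set.range g ∨ E _ _ y ∉ Set.range g) →
      pathMapFun ((θ n).symm (Pi.single j a)) i x y = 0 := by
    intro a x y hxy
    cases x with
    | start h => exact pathMapFun_start_left _ h y
    | @snoc _ _ j₁ e α =>
      cases y with
      | start h => exact pathMapFun_start_right _ h _
      | @snoc _ _ j₂ e' β =>
        by_cases h : (⟨j₁, e⟩ : Σ j, Fin (B.k n i j)) = ⟨j₂, e'⟩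
        · obtain ⟨rfl, h⟩ := Sigma.mk.inj h
          obtain rfl := eq_of_heq h
          rw [pathMapFun_snoc]
          refine hθ a j₁ α β ?_
          rintro rfl
          rcases hxy with hx | hx
          · exact hx ⟨(E n j₁ α, e), by simp [g]⟩
          · exact hx ⟨(E n j₁ β, e), by simp [g]⟩
        · exact pathMapFun_snoc_ne _ _ _ _ _ h
  refine hasMultiplicity_of_embedding _ g ?_ ?_ ?_ ?_
  · rintro ⟨x, c⟩ ⟨y, c'⟩ h
    have := (E (n + 1) i).injective h
    simp only [PathTo.snoc.injEq, heq_eq_eq, true_and] at this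
    rw [this.1, (E n j).symm.injective this.2]
  · intro a x c y c'
    refine (hφ a (.snoc c ((E n j).symm x)) (.snoc c' ((E n j).symm y))).trans ?_
    by_cases h : c = c'
    · subst h
      rw [if_pos rfl, pathMapFun_snoc, hθ']
    · rw [if_neg h]
      refine pathMapFun_snoc_ne _ _ _ _ _ fun h' => h ?_
      simpa using h'
  · intro a x y hx
    obtain ⟨x, rfl⟩ := (E _ _).surjective x
    obtain ⟨y, rfl⟩ := (E _ _).surjective y
    exact (hφ a x y).trans (hz a x y (Or.inl hx))
  · intro a x y hy
    obtain ⟨x, rfl⟩ := (E _ _).surjective x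
    obtain ⟨y, rfl⟩ := (E _ _).surjective y
    exact (hφ a x y).trans (hz a x y (Or.inr hy))

/-! ### Matrix units -/

/-- Matrix units in `X` indexed by the pairs of paths from `S` with a common end. -/
structure MatrixUnits (B : BratteliDiagram) (S : ∀ n, Finset (Fin (B.p n)))
    (X : Type*) [NonUnitalCStarAlgebra X] where
  e : ∀ n j, PathTo B S n j → PathTo B S n j → X
  star_e : ∀ n j α β, star (e n j α β) = e n j β α
  mul_e : ∀ n j α β δ, e n j α β * e n j β δ = e n j α δ
  mul_e_of_ne : ∀ n j α β γ δ, β ≠ γ → e n j α β * e n j γ δ = 0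
  mul_e_of_vertex_ne : ∀ n j j' α β γ δ, j ≠ j' → e n j α β * e n j' γ δ = 0
  ne_zero : ∀ n j α, e n j α α ≠ 0
  e_eq_sum : ∀ n j α β, e n j α β =
    ∑ i, ∑ k : Fin (B.k n i j), e (n + 1) i (.snoc k α) (.snoc k β)

namespace MatrixUnits

variable {X : Type*} [NonUnitalCStarAlgebra X] (U : MatrixUnits B S X)

/-- The homomorphism from the path algebra of level `n` that is given by the matrix units. -/
def hom (n : ℕ) : PathAlg B S n →⋆ₙₐ[ℂ] X where
  toFun a := ∑ j, ∑ α, ∑ β, a j α β • U.e n j α β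
  map_smul' z a := by
    simp only [Pi.smul_apply, Matrix.smul_apply, smul_assoc, MonoidHom.id_apply, Finset.smul_sum]
  map_zero' := by simp
  map_add' a b := by
    simp only [Pi.add_apply, Matrix.add_apply, add_smul, Finset.sum_add_distrib]
  map_mul' a b := by
    rw [Finset.sum_mul]
    refine Finset.sum_congr rfl fun j _ => ?_
    rw [Finset.mul_sum, Finset.sum_eq_single j]
    · rw [Finset.sum_mul]
      refine Finset.sum_congr rfl fun α _ => ?_
      have h : ∀ β, (a j α β • U.e n j α β) * ∑ γ, ∑ δ, b j γ δ • U.e n j γ δ =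
          ∑ δ, (a j α β * b j β δ) • U.e n j α δ := fun β => by
        rw [Finset.mul_sum, Finset.sum_eq_single β]
        · rw [Finset.mul_sum]
          refine Finset.sum_congr rfl fun δ _ => ?_
          rw [smul_mul_smul_comm, U.mul_e]
        · intro γ _ hne
          rw [Finset.mul_sum]
          refine Finset.sum_eq_zero fun δ _ => ?_
          rw [smul_mul_smul_comm, U.mul_e_of_ne _ _ _ _ _ _ hne.symm, smul_zero]
        · exact fun h => absurd (Finset.mem_univ β) h
      rw [Finset.sum_mul, Finset.sum_congr rfl fun β _ => h β, Finset.sum_comm]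
      refine Finset.sum_congr rfl fun δ _ => ?_
      rw [← Finset.sum_smul]
      rfl
    · intro j' _ hne
      rw [Finset.sum_mul]
      refine Finset.sum_eq_zero fun α _ => ?_
      rw [Finset.sum_mul]
      refine Finset.sum_eq_zero fun β _ => ?_
      rw [Finset.mul_sum]
      refine Finset.sum_eq_zero fun γ _ => ?_
      rw [Finset.mul_sum]
      refine Finset.sum_eq_zero fun δ _ => ?_
      rw [smul_mul_smul_comm, U.mul_e_of_vertex_ne _ _ _ _ _ _ _ hne.symm, smul_zero]
    · exact fun h => absurd (Finset.mem_univ j) h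
  map_star' a := by
    rw [star_sum]
    refine Finset.sum_congr rfl fun j _ => ?_
    rw [star_sum, Finset.sum_comm]
    refine Finset.sum_congr rfl fun α _ => ?_
    rw [star_sum]
    refine Finset.sum_congr rfl fun β _ => ?_
    rw [star_smul, U.star_e]
    rfl

theorem hom_apply (n : ℕ) (a : PathAlg B S n) :
    U.hom n a = ∑ j, ∑ α, ∑ β, a j α β • U.e n j α β := rfl

theorem e_mul_hom_mul_e (n : ℕ) (a : PathAlg B S n) (j : Fin (B.p n)) (α β : PathTo B S n j) :
    U.e n j α α * U.hom n a * U.e n j β α = a j α β • U.e n j α α := by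
  rw [hom_apply, Finset.mul_sum, Finset.sum_mul, Finset.sum_eq_single j]
  · rw [Finset.mul_sum, Finset.sum_mul, Finset.sum_eq_single α]
    · rw [Finset.mul_sum, Finset.sum_mul, Finset.sum_eq_single β]
      · rw [mul_smul_comm, smul_mul_assoc, U.mul_e, U.mul_e]
      · intro γ _ hne
        rw [mul_smul_comm, smul_mul_assoc, U.mul_e, U.mul_e_of_ne _ _ _ _ _ _ hne, smul_zero]
      · exact fun h => absurd (Finset.mem_univ β) h
    · intro γ _ hne
      rw [Finset.mul_sum, Finset.sum_mul]
      refine Finset.sum_eq_zero fun δ _ => ?_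
      rw [mul_smul_comm, U.mul_e_of_ne _ _ _ _ _ _ hne.symm, smul_zero, zero_mul]
    · exact fun h => absurd (Finset.mem_univ α) h
  · intro j' _ hne
    rw [Finset.mul_sum, Finset.sum_mul]
    refine Finset.sum_eq_zero fun γ _ => ?_
    rw [Finset.mul_sum, Finset.sum_mul]
    refine Finset.sum_eq_zero fun δ _ => ?_
    rw [mul_smul_comm, U.mul_e_of_vertex_ne _ _ _ _ _ _ _ hne.symm, smul_zero, zero_mul]
  · exact fun h => absurd (Finset.mem_univ j) h

theorem hom_injective (n : ℕ) : Function.Injective (U.hom n) := by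
  rw [injective_iff_map_eq_zero]
  intro a ha
  funext j
  ext α β
  have h := U.e_mul_hom_mul_e n a j α β
  rw [ha, mul_zero, zero_mul] at h
  exact (smul_eq_zero.1 h.symm).resolve_right (U.ne_zero n j α)

theorem hom_pathMap (n : ℕ) (a : PathAlg B S n) : U.hom (n + 1) (pathMap B S n a) = U.hom n a := by
  have h1 : ∀ i, ∑ x, ∑ y, pathMap B S n a i x y • U.e (n + 1) i x y =
      ∑ j, ∑ k : Fin (B.k n i j), ∑ α, ∑ β, a j α β • U.e (n + 1) i (.snoc k α) (.snoc k β) := by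
    intro i
    rw [PathTo.sum_succ, Finset.sum_eq_zero, zero_add]
    · refine Finset.sum_congr rfl fun j _ => Finset.sum_congr rfl fun k _ =>
        Finset.sum_congr rfl fun α _ => ?_
      rw [PathTo.sum_succ, Finset.sum_eq_zero, zero_add, Finset.sum_eq_single j,
        Finset.sum_eq_single k]
      · refine Finset.sum_congr rfl fun β _ => ?_
        rw [← pathMapFun_snoc a k α β]; rfl
      · intro k' _ hne
        refine Finset.sum_eq_zero fun β _ => ?_
        have := pathMapFun_snoc_ne a k k' α β (fun h => hne (by simpa using h.symm))
        exact (congrArg (· • U.e (n + 1) i (.snoc k α) (.snoc k' β)) this).trans (zero_smul _ _)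
      · exact fun h => absurd (Finset.mem_univ k) h
      · intro j' _ hne
        refine Finset.sum_eq_zero fun k' _ => Finset.sum_eq_zero fun β _ => ?_
        have := pathMapFun_snoc_ne a k k' α β (fun h => hne (congrArg Sigma.fst h).symm)
        exact (congrArg (· • U.e (n + 1) i (.snoc k α) (.snoc k' β)) this).trans (zero_smul _ _)
      · exact fun h => absurd (Finset.mem_univ j) h
      · intro h _
        exact (congrArg (· • U.e (n + 1) i (.snoc k α) (.start h.down))
          (pathMapFun_start_right a h.down _)).trans (zero_smul _ _)
    · intro h _
      refine Finset.sum_eq_zero fun y _ => ?_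
      exact (congrArg (· • U.e (n + 1) i (.start h.down) y)
          (pathMapFun_start_left a h.down _)).trans (zero_smul _ _)
  rw [hom_apply, hom_apply, Finset.sum_congr rfl fun i _ => h1 i, Finset.sum_comm]
  refine Finset.sum_congr rfl fun j _ => ?_
  simp only [U.e_eq_sum n j, Finset.smul_sum]
  rw [Finset.sum_congr rfl fun i _ => Finset.sum_comm]
  rw [Finset.sum_comm]
  refine Finset.sum_congr rfl fun α _ => ?_
  rw [Finset.sum_congr rfl fun i _ => Finset.sum_comm]
  rw [Finset.sum_comm]

theorem hasLimit (hout : ∀ n j, ∃ i, 0 < B.k n i j)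
    (hd : Dense (⋃ n, Set.range (U.hom n))) : (pathSystem B S hout).HasLimit X :=
  ⟨U.hom, U.hom_pathMap, U.hom_injective, hd⟩

theorem hom_single (n : ℕ) (j : Fin (B.p n)) (α β : PathTo B S n j) :
    U.hom n (Pi.single j (Matrix.single α β 1)) = U.e n j α β := by
  classical
  rw [hom_apply, Finset.sum_eq_single j, Finset.sum_eq_single α, Finset.sum_eq_single β]
  · simp
  · intro γ _ hne
    simp [hne.symm]
  · exact fun h => absurd (Finset.mem_univ _) h
  · intro γ _ hne
    refine Finset.sum_eq_zero fun δ _ => ?_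
    simp [hne.symm]
  · exact fun h => absurd (Finset.mem_univ _) h
  · intro j' _ hne
    simp [Pi.single_eq_of_ne hne]
  · exact fun h => absurd (Finset.mem_univ _) h

end MatrixUnits

end BratteliDiagram
end

noncomputable section

/-! ### Realisation of a diagram in a C⋆-algebra -/

open FiniteDimCStar

namespace BratteliDiagram

/-- A realisation of the diagram `B` in the C⋆-algebra `A` along the increasing sequence `G` of
⋆-subalgebras: every vertex is a projection, every edge is a partial isometry from the projection
of its range to a subprojection of the projection of its source, and the ranges of the edges that
leave a vertex decompose its projection. -/
structure Realization (B : BratteliDiagram) (S : ∀ n, Finset (Fin (B.p n))) {A : Type*}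
    [NonUnitalCStarAlgebra A] (G : ℕ → NonUnitalStarSubalgebra ℂ A) where
  p_zero : IsEmpty (Fin (B.p 0))
  proj : ∀ n, Fin (B.p n) → A
  unit : ℕ → A
  t : ∀ n i j, Fin (B.k n i j) → A
  proj_mem : ∀ n j, proj n j ∈ G n
  isProj : ∀ n j, IsStarProjection (proj n j)
  proj_ne_zero : ∀ n j, proj n j ≠ 0
  unit_proj : ∀ n, IsStarProjection (unit n)
  unit_mul : ∀ n, ∀ a ∈ G n, unit n * a = a
  unit_zero : unit 0 = 0
  t_mem : ∀ n i j e, t n i j e ∈ G n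
  star_t_mul_t : ∀ n i j e, star (t n i j e) * t n i j e = proj (n + 1) i
  t_orth : ∀ n j, ∀ x y : Σ i, Fin (B.k n i j), x ≠ y →
    star (t n x.1 j x.2) * t n y.1 j y.2 = 0
  t_mul_proj : ∀ n i j e, t n i j e * proj (n + 1) i = t n i j e
  sum_t : ∀ n j, ∑ i, ∑ e, t n i j e * star (t n i j e) = proj n j
  unit_succ : ∀ n, unit (n + 1) = unit n + ∑ i ∈ S (n + 1), proj (n + 1) i
  proj_mul : ∀ n, ∀ i ∈ S (n + 1), ∀ a ∈ G n, proj (n + 1) i * a = 0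
  corner : ∀ n i, ∀ a ∈ G n, ∃ z : ℂ, proj (n + 1) i * a * proj (n + 1) i = z • proj (n + 1) i
  corner_ne : ∀ n i i', i ≠ i' → ∀ a ∈ G n, proj (n + 1) i * a * proj (n + 1) i' = 0
  exists_in : ∀ n i, i ∉ S (n + 1) → ∃ j, 0 < B.k n i j
  exists_out : ∀ n j, ∃ i, 0 < B.k n i j
  S_orth : ∀ n, ∀ i ∈ S (n + 1), ∀ i' ∈ S (n + 1), i ≠ i' →
    proj (n + 1) i * proj (n + 1) i' = 0

/-- An increasing sequence of finite-dimensional ⋆-subalgebras has a realised diagram. It starts with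
the zero algebra, so that all units are accounted for by vertices of `S`. -/
theorem exists_realization {A : Type*} [NonUnitalCStarAlgebra A]
    (G : ℕ → NonUnitalStarSubalgebra ℂ A) (hfd : ∀ n, FiniteDimensional ℂ (G n))
    (hG : ∀ n, G n ≤ G (n + 1)) (h0 : G 0 = ⊥) :
    ∃ (B : BratteliDiagram) (S : ∀ n, Finset (Fin (B.p n))), Nonempty (Realization B S G) := by
  let X₀ : Level (G 0) :=
    { p := 0
      proj := fun j => j.elim0
      unit := 0
      proj_mem := fun j => j.elim0
      isProj := fun j => j.elim0
      proj_ne_zero := fun j => j.elim0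
      unit_mem := zero_mem _
      unit_proj := IsStarProjection.zero A
      unit_mul := fun a ha => by
        rw [h0, NonUnitalStarAlgebra.mem_bot] at ha
        rw [ha, mul_zero] }
  let X : ∀ n, Level (G n) := fun n =>
    Nat.rec X₀ (fun n Y => (exists_step (hG n) Y).choose) n
  let T : ∀ n, Step (X n) (X (n + 1)) := fun n => (exists_step (hG n) (X n)).choose_spec.some
  let S : ∀ n, Finset (Fin (X n).p) := fun n =>
    match n with
    | 0 => ∅
    | n + 1 => (T n).S
  exact ⟨⟨fun n => (X n).p, fun n => (T n).k⟩, S, ⟨{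
    p_zero := inferInstanceAs (IsEmpty (Fin 0))
    proj := fun n => (X n).proj
    unit := fun n => (X n).unit
    t := fun n => (T n).t
    proj_mem := fun n => (X n).proj_mem
    isProj := fun n => (X n).isProj
    proj_ne_zero := fun n => (X n).proj_ne_zero
    unit_proj := fun n => (X n).unit_proj
    unit_mul := fun n => (X n).unit_mul
    unit_zero := rfl
    t_mem := fun n => (T n).t_mem
    star_t_mul_t := fun n => (T n).star_t_mul_t
    t_orth := fun n => (T n).t_orth
    t_mul_proj := fun n => (T n).t_mul_proj
    sum_t := fun n => (T n).sum_t
    unit_succ := fun n => (T n).unit_eq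
    proj_mul := fun n => (T n).proj_mul
    corner := fun n => (T n).corner
    corner_ne := fun n => (T n).corner_ne
    exists_in := fun n => (T n).exists_in
    exists_out := fun n => (T n).exists_out
    S_orth := fun n => (T n).S_orth }⟩⟩

namespace Realization

variable {B : BratteliDiagram} {S : ∀ n, Finset (Fin (B.p n))} {A : Type*}
  [NonUnitalCStarAlgebra A] {G : ℕ → NonUnitalStarSubalgebra ℂ A} (W : Realization B S G)

theorem nonempty_pathTo (W : Realization B S G) : ∀ n j, Nonempty (PathTo B S n j)
  | 0, j => W.p_zero.elim j
  | n + 1, i => by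
    by_cases h : i ∈ S (n + 1)
    · exact ⟨.start h⟩
    · obtain ⟨j, hj⟩ := W.exists_in n i h
      exact (nonempty_pathTo W n j).map (.snoc ⟨0, hj⟩)

theorem proj_mul_t (n : ℕ) (i j) (e : Fin (B.k n i j)) : W.proj n j * W.t n i j e = W.t n i j e := by
  rw [← W.sum_t, Finset.sum_mul, Finset.sum_eq_single i]
  · rw [Finset.sum_mul, Finset.sum_eq_single e]
    · rw [mul_assoc, W.star_t_mul_t, W.t_mul_proj]
    · intro e' _ hne
      rw [mul_assoc, W.t_orth n j ⟨i, e'⟩ ⟨i, e⟩ (by simpa using hne), mul_zero]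
    · exact fun h => absurd (Finset.mem_univ _) h
  · intro i' _ hne
    rw [Finset.sum_mul]
    refine Finset.sum_eq_zero fun e' _ => ?_
    rw [mul_assoc, W.t_orth n j ⟨i', e'⟩ ⟨i, e⟩ (fun h => hne (congrArg Sigma.fst h)), mul_zero]
  · exact fun h => absurd (Finset.mem_univ _) h

/-- The partial isometry of a path: the product of the partial isometries of its edges. -/
def frame {n : ℕ} {j : Fin (B.p n)} : PathTo B S n j → A
  | .start _ => W.proj n j
  | .snoc e α => frame α * W.t _ _ _ e

variable {W}

theorem frame_mem (hG : ∀ n, G n ≤ G (n + 1)) :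
    ∀ {n : ℕ} {j : Fin (B.p n)} (α : PathTo B S n j), W.frame α ∈ G n
  | _, _, .start _ => W.proj_mem _ _
  | _, _, .snoc e α => hG _ (mul_mem (frame_mem hG α) (W.t_mem _ _ _ e))

theorem frame_mul_proj {n : ℕ} {j : Fin (B.p n)} (α : PathTo B S n j) :
    W.frame α * W.proj n j = W.frame α := by
  cases α with
  | start h => exact (W.isProj n j).isIdempotentElem
  | snoc e α => rw [frame, mul_assoc, W.t_mul_proj]

theorem proj_mul_star_frame {n : ℕ} {j : Fin (B.p n)} (α : PathTo B S n j) :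
    W.proj n j * star (W.frame α) = star (W.frame α) := by
  have := congrArg star (frame_mul_proj (W := W) α)
  rwa [star_mul, (W.isProj n j).isSelfAdjoint.star_eq] at this

theorem star_frame_mul_frame {n : ℕ} {j : Fin (B.p n)} (α : PathTo B S n j) :
    star (W.frame α) * W.frame α = W.proj n j := by
  induction α with
  | start h => rw [frame, (W.isProj _ _).isSelfAdjoint.star_eq, (W.isProj _ _).isIdempotentElem]
  | snoc e α ih =>
    rw [frame, star_mul, mul_assoc, ← mul_assoc (star (W.frame α)), ih, proj_mul_t, W.star_t_mul_t]

theorem frame_ne_zero {n : ℕ} {j : Fin (B.p n)} (α : PathTo B S n j) : W.frame α ≠ 0 := by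
  intro h
  apply W.proj_ne_zero n j
  rw [← star_frame_mul_frame α, h, mul_zero]

theorem star_frame_mul_frame_of_ne (hG : ∀ n, G n ≤ G (n + 1)) :
    ∀ {n : ℕ} {j j' : Fin (B.p n)} (α : PathTo B S n j) (β : PathTo B S n j'),
      (⟨j, α⟩ : Σ j, PathTo B S n j) ≠ ⟨j', β⟩ → star (W.frame α) * W.frame β = 0
  | 0, j, _, _, _, _ => (W.p_zero.false j).elim
  | n + 1, i, i', .start h, .start h', hne => by
    rw [frame, frame, (W.isProj _ _).isSelfAdjoint.star_eq]
    refine W.S_orth n i h i' h' ?_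
    rintro rfl
    exact hne rfl
  | n + 1, i, i', .start h, .snoc e β, _ => by
    rw [frame, frame, (W.isProj _ _).isSelfAdjoint.star_eq, ← mul_assoc,
      W.proj_mul n i h _ (frame_mem hG β), zero_mul]
  | n + 1, i, i', .snoc e α, .start h, _ => by
    rw [← star_star (W.frame (.start h)), ← star_mul, frame, frame,
      (W.isProj _ _).isSelfAdjoint.star_eq, ← mul_assoc,
      W.proj_mul n i' h _ (frame_mem hG α), zero_mul, star_zero]
  | n + 1, i, i', @PathTo.snoc _ _ _ _ j e α, @PathTo.snoc _ _ _ _ j' e' β, hne => by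
    rw [frame, frame, star_mul, mul_assoc, ← mul_assoc (star (W.frame α))]
    by_cases h : (⟨j, α⟩ : Σ j, PathTo B S n j) = ⟨j', β⟩
    · cases h
      rw [star_frame_mul_frame, proj_mul_t]
      refine W.t_orth n j ⟨i, e⟩ ⟨i', e'⟩ fun h' => hne ?_
      cases h'
      rfl
    · rw [star_frame_mul_frame_of_ne hG α β h, zero_mul, mul_zero]

/-- The projections of the paths from `S` to level `n` decompose the unit of level `n`. -/
theorem sum_frame : ∀ n, ∑ j, ∑ α : PathTo B S n j, W.frame α * star (W.frame α) = W.unit n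
  | 0 => by
    have := W.p_zero
    rw [W.unit_zero, Finset.univ_eq_empty, Finset.sum_empty]
  | n + 1 => by
    classical
    have h1 : ∀ i, ∑ α : PathTo B S (n + 1) i, W.frame α * star (W.frame α) =
        (if i ∈ S (n + 1) then W.proj (n + 1) i else 0) + ∑ j, ∑ α : PathTo B S n j, ∑ e,
          W.frame α * (W.t n i j e * star (W.t n i j e)) * star (W.frame α) := by
      intro i
      rw [PathTo.sum_succ]
      congr 1
      · split_ifs with h
        · rw [Fintype.sum_eq_single (⟨h⟩ : PLift (i ∈ S (n + 1))) fun x hx =>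
            absurd (Subsingleton.elim _ _) hx]
          rw [frame, (W.isProj _ _).isSelfAdjoint.star_eq, (W.isProj _ _).isIdempotentElem]
        · exact Finset.sum_eq_zero fun x _ => absurd x.down h
      · refine Finset.sum_congr rfl fun j _ => ?_
        rw [Finset.sum_comm]
        refine Finset.sum_congr rfl fun α _ => Finset.sum_congr rfl fun e _ => ?_
        rw [frame, star_mul]
        simp only [mul_assoc]
    rw [Finset.sum_congr rfl fun i _ => h1 i, Finset.sum_add_distrib, W.unit_succ, add_comm,
      Finset.sum_ite_mem, Finset.univ_inter]
    congr 1
    rw [← sum_frame n, Finset.sum_comm]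
    refine Finset.sum_congr rfl fun j _ => ?_
    rw [Finset.sum_comm]
    refine Finset.sum_congr rfl fun α _ => ?_
    rw [Finset.sum_congr rfl fun i _ => by rw [← Finset.sum_mul, ← Finset.mul_sum],
      ← Finset.sum_mul, ← Finset.mul_sum, W.sum_t, frame_mul_proj]

variable (W)

/-- The matrix units of a realisation. -/
def matrixUnits (hG : ∀ n, G n ≤ G (n + 1)) : MatrixUnits B S A where
  e n j α β := W.frame α * star (W.frame β)
  star_e n j α β := by rw [star_mul, star_star]
  mul_e n j α β δ := by
    rw [mul_assoc, ← mul_assoc (star (W.frame β)), star_frame_mul_frame, proj_mul_star_frame]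
  mul_e_of_ne n j α β γ δ h := by
    rw [mul_assoc, ← mul_assoc (star (W.frame β)),
      star_frame_mul_frame_of_ne hG β γ (by simpa using h), zero_mul, mul_zero]
  mul_e_of_vertex_ne n j j' α β γ δ h := by
    rw [mul_assoc, ← mul_assoc (star (W.frame β)),
      star_frame_mul_frame_of_ne hG β γ (fun h' => h (congrArg Sigma.fst h')), zero_mul, mul_zero]
  ne_zero n j α h := frame_ne_zero α ((CStarRing.mul_star_self_eq_zero_iff _).1 h)
  e_eq_sum n j α β := by
    rw [← frame_mul_proj α, ← W.sum_t, Finset.mul_sum, Finset.sum_mul]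
    refine Finset.sum_congr rfl fun i _ => ?_
    rw [Finset.mul_sum, Finset.sum_mul]
    refine Finset.sum_congr rfl fun e _ => ?_
    rw [frame, frame, star_mul]
    simp only [mul_assoc]

/-- The matrix units of level `n + 1` span an algebra that contains `G n`: their diagonal is a
decomposition of the unit into projections equivalent to the vertex projections, whose corners
in `G n` are one-dimensional and mutually disjoint. -/
theorem mem_range_hom (hG : ∀ n, G n ≤ G (n + 1)) {n : ℕ} {a : A} (ha : a ∈ G n) :
    a ∈ Set.range ((W.matrixUnits hG).hom (n + 1)) := by
  have hua : W.unit (n + 1) * a = a := W.unit_mul _ a (hG n ha)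
  have hau : a * W.unit (n + 1) = a := by
    have := congrArg star (W.unit_mul _ _ (hG n (star_mem ha)))
    rwa [star_mul, star_star, (W.unit_proj _).isSelfAdjoint.star_eq] at this
  have hterm : ∀ i i' (α : PathTo B S (n + 1) i) (β : PathTo B S (n + 1) i'),
      (W.frame α * star (W.frame α)) * a * (W.frame β * star (W.frame β)) ∈
        NonUnitalStarAlgHom.range ((W.matrixUnits hG).hom (n + 1)) := by
    intro i i' α β
    -- The vertices of `S` are orthogonal to `G n`, and the other paths have partial isometries
    -- in `G n`, since the last edge has.
    have hz : star (W.frame α) * a * W.frame β = 0 ∨ star (W.frame α) * a * W.frame β ∈ G n := by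
      cases α with
      | start h =>
        left
        rw [frame, (W.isProj _ _).isSelfAdjoint.star_eq, W.proj_mul n i h a ha, zero_mul]
      | snoc e α =>
        cases β with
        | start h =>
          left
          have := congrArg star (W.proj_mul n i' h _ (star_mem ha))
          rw [star_mul, star_star, (W.isProj _ _).isSelfAdjoint.star_eq, star_zero] at this
          rw [mul_assoc]
          exact (congrArg _ this).trans (mul_zero _)
        | snoc e' β =>
          right
          exact mul_mem (mul_mem (star_mem (mul_mem (frame_mem hG α) (W.t_mem _ _ _ e))) ha)
            (mul_mem (frame_mem hG β) (W.t_mem _ _ _ e'))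
    have hrew : (W.frame α * star (W.frame α)) * a * (W.frame β * star (W.frame β)) =
        W.frame α * (W.proj (n + 1) i * (star (W.frame α) * a * W.frame β) * W.proj (n + 1) i') *
          star (W.frame β) := by
      calc _ = (W.frame α * W.proj (n + 1) i * star (W.frame α)) * a *
            (W.frame β * (W.proj (n + 1) i' * star (W.frame β))) := by
            rw [frame_mul_proj, proj_mul_star_frame]
        _ = _ := by simp only [mul_assoc]
    rw [hrew]
    rcases hz with hz | hz
    · rw [hz, mul_zero, zero_mul, mul_zero, zero_mul]
      exact zero_mem _
    · by_cases hi : i = i'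
      · subst hi
        obtain ⟨z, hz⟩ := W.corner n i _ hz
        rw [hz, mul_smul_comm, smul_mul_assoc, frame_mul_proj]
        exact SMulMemClass.smul_mem z ⟨_, (W.matrixUnits hG).hom_single (n + 1) i α β⟩
      · rw [W.corner_ne n i i' hi _ hz, mul_zero, zero_mul]
        exact zero_mem _
  have hsum : a = ∑ i, ∑ α : PathTo B S (n + 1) i, ∑ i', ∑ β : PathTo B S (n + 1) i',
      (W.frame α * star (W.frame α)) * a * (W.frame β * star (W.frame β)) := by
    simp_rw [← Finset.mul_sum, sum_frame, ← Finset.sum_mul, sum_frame]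
    rw [hua, hau]
  have hmem : a ∈ NonUnitalStarAlgHom.range ((W.matrixUnits hG).hom (n + 1)) := by
    rw [hsum]
    exact sum_mem fun i _ => sum_mem fun α _ => sum_mem fun i' _ => sum_mem fun β _ =>
      hterm i i' α β
  exact hmem

theorem hasLimit (hG : ∀ n, G n ≤ G (n + 1)) (hd : Dense (⋃ n, (G n : Set A))) :
    (pathSystem B S W.exists_out).HasLimit A := by
  refine (W.matrixUnits hG).hasLimit W.exists_out (hd.mono ?_)
  exact Set.iUnion_subset fun n a ha => Set.mem_iUnion.2 ⟨n + 1, W.mem_range_hom hG ha⟩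

end Realization

end BratteliDiagram
end

noncomputable section

/-! ### Limits of inductive systems -/

/-- For two limits of the same system, the closure of the graph of the identification of the dense
subalgebras is a ⋆-subalgebra whose coordinate projections to the two limits are isometric and bijective. -/
theorem FDSystem.HasLimit.exists_graph {D : FDSystem} {A A' : Type*} [NonUnitalCStarAlgebra A]
    [NonUnitalCStarAlgebra A'] {ι : ∀ n, D.alg n →⋆ₙₐ[ℂ] A} {ι' : ∀ n, D.alg n →⋆ₙₐ[ℂ] A'}
    (hι : ∀ n a, ι (n + 1) (D.map n a) = ι n a) (hι' : ∀ n a, ι' (n + 1) (D.map n a) = ι' n a)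
    (hinj : ∀ n, Function.Injective (ι n)) (hinj' : ∀ n, Function.Injective (ι' n))
    (hd : Dense (⋃ n, Set.range (ι n))) (hd' : Dense (⋃ n, Set.range (ι' n))) :
    ∃ Γ : NonUnitalStarSubalgebra ℂ (A × A'),
      (Function.Bijective fun x : Γ => x.1.1) ∧ (Function.Bijective fun x : Γ => x.1.2) := by
  let K : ℕ → NonUnitalStarSubalgebra ℂ (A × A') := fun n =>
    NonUnitalStarAlgHom.range ((ι n).prod (ι' n))
  have hK : Monotone K := monotone_nat_of_le_succ fun n => by
    rintro _ ⟨a, rfl⟩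
    exact ⟨D.map n a, Prod.ext (hι n a) (hι' n a)⟩
  let Γ₀ : NonUnitalStarSubalgebra ℂ (A × A') := ⨆ n, K n
  have hΓ₀ : (Γ₀ : Set (A × A')) = ⋃ n, (K n : Set (A × A')) :=
    NonUnitalStarSubalgebra.coe_iSup_of_directed hK.directed_le
  let Γ := Γ₀.topologicalClosure
  have hΓcl : IsClosed (Γ : Set (A × A')) := NonUnitalStarSubalgebra.isClosed_topologicalClosure _
  have hKΓ : ∀ n a, (ι n a, ι' n a) ∈ Γ := fun n a =>
    NonUnitalStarSubalgebra.le_topologicalClosure _ <| by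
      show _ ∈ (Γ₀ : Set (A × A'))
      rw [hΓ₀]
      exact Set.mem_iUnion.2 ⟨n, a, rfl⟩
  have hnorm : ∀ x ∈ Γ, ‖x.1‖ = ‖x.2‖ := by
    have hcl : IsClosed {x : A × A' | ‖x.1‖ = ‖x.2‖} := isClosed_eq (by fun_prop) (by fun_prop)
    refine fun x hx => closure_minimal (s := (Γ₀ : Set (A × A'))) ?_ hcl hx
    rw [hΓ₀]
    refine Set.iUnion_subset fun n => ?_
    rintro _ ⟨a, rfl⟩
    exact (NonUnitalStarAlgHom.norm_map (ι n) (hinj n) a).trans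
      (NonUnitalStarAlgHom.norm_map (ι' n) (hinj' n) a).symm
  have hcomplete : CompleteSpace Γ := hΓcl.completeSpace_coe
  have h1 : Isometry fun x : Γ => x.1.1 := Isometry.of_dist_eq fun x y => by
    rw [Subtype.dist_eq, Prod.dist_eq, dist_eq_norm, dist_eq_norm,
      ← show ‖x.1.1 - y.1.1‖ = ‖x.1.2 - y.1.2‖ from hnorm _ (x - y).2]
    exact (max_self _).symm
  have h2 : Isometry fun x : Γ => x.1.2 := Isometry.of_dist_eq fun x y => by
    rw [Subtype.dist_eq, Prod.dist_eq, dist_eq_norm, dist_eq_norm,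
      show ‖x.1.1 - y.1.1‖ = ‖x.1.2 - y.1.2‖ from hnorm _ (x - y).2]
    exact (max_self _).symm
  refine ⟨Γ, ⟨h1.injective, ?_⟩, ⟨h2.injective, ?_⟩⟩
  · rw [← Set.range_eq_univ, ← h1.isClosedEmbedding.isClosed_range.closure_eq]
    refine (hd.mono ?_).closure_eq
    refine Set.iUnion_subset fun n => ?_
    rintro _ ⟨a, rfl⟩
    exact ⟨⟨_, hKΓ n a⟩, rfl⟩
  · rw [← Set.range_eq_univ, ← h2.isClosedEmbedding.isClosed_range.closure_eq]
    refine (hd'.mono ?_).closure_eq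
    refine Set.iUnion_subset fun n => ?_
    rintro _ ⟨a, rfl⟩
    exact ⟨⟨_, hKΓ n a⟩, rfl⟩

/-- The C⋆-algebraic limit of a system is unique up to isomorphism. -/
theorem FDSystem.HasLimit.unique {D : FDSystem} {A A' : Type*} [NonUnitalCStarAlgebra A]
    [NonUnitalCStarAlgebra A'] (h : D.HasLimit A) (h' : D.HasLimit A') :
    Nonempty (A ≃⋆ₐ[ℂ] A') := by
  obtain ⟨ι, hι, hinj, hd⟩ := h
  obtain ⟨ι', hι', hinj', hd'⟩ := h'
  obtain ⟨Γ, h1, h2⟩ := FDSystem.HasLimit.exists_graph hι hι' hinj hinj' hd hd'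
  let f₁ : Γ →⋆ₙₐ[ℂ] A := (NonUnitalStarAlgHom.fst ℂ A A').comp
    (NonUnitalStarSubalgebraClass.subtype Γ)
  let f₂ : Γ →⋆ₙₐ[ℂ] A' := (NonUnitalStarAlgHom.snd ℂ A A').comp
    (NonUnitalStarSubalgebraClass.subtype Γ)
  exact ⟨(StarAlgEquiv.ofBijective f₁ h1).symm.trans (StarAlgEquiv.ofBijective f₂ h2)⟩

/-- In a limit the ranges of the finite stages form an increasing sequence of finite-dimensional
⋆-subalgebras with dense union. The zero algebra is put in front of it. -/
theorem FDSystem.HasLimit.exists_chain {D : FDSystem} {A : Type*} [NonUnitalCStarAlgebra A]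
    (h : D.HasLimit A) : ∃ G : ℕ → NonUnitalStarSubalgebra ℂ A,
      (∀ n, FiniteDimensional ℂ (G n)) ∧ (∀ n, G n ≤ G (n + 1)) ∧ G 0 = ⊥ ∧
        Dense (⋃ n, (G n : Set A)) := by
  obtain ⟨ι, hι, -, hd⟩ := h
  refine ⟨fun n => match n with | 0 => ⊥ | n + 1 => NonUnitalStarAlgHom.range (ι n), ?_, ?_, rfl, ?_⟩
  · rintro (_ | n)
    · have : Subsingleton (⊥ : NonUnitalStarSubalgebra ℂ A) := ⟨fun x y => Subtype.ext <| by
        rw [NonUnitalStarAlgebra.mem_bot.1 x.2, NonUnitalStarAlgebra.mem_bot.1 y.2]⟩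
      exact inferInstanceAs (FiniteDimensional ℂ (⊥ : NonUnitalStarSubalgebra ℂ A))
    · let l : D.alg n →ₗ[ℂ] NonUnitalStarAlgHom.range (ι n) :=
        { toFun := fun a => ⟨ι n a, a, rfl⟩
          map_add' := fun a b => Subtype.ext (map_add (ι n) a b)
          map_smul' := fun z a => Subtype.ext (map_smul (ι n) z a) }
      exact Module.Finite.of_surjective l (by rintro ⟨_, a, rfl⟩; exact ⟨a, rfl⟩)
  · rintro (_ | n)
    · exact bot_le
    · rintro _ ⟨a, rfl⟩
      exact ⟨D.map n a, hι n a⟩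
  · refine hd.mono (Set.iUnion_subset fun n => ?_)
    rintro _ ⟨a, rfl⟩
    exact Set.mem_iUnion.2 ⟨n + 1, a, rfl⟩
end

noncomputable section

/-! ### Infinite paths in a Bratteli diagram -/

namespace BratteliDiagram

variable {B : BratteliDiagram} {S : ∀ n, Finset (Fin (B.p n))}

/-- The `j`-th vertex of level `n`. -/
def vertex (n : ℕ) (j : Fin (B.p n)) : B.graph.V := (⟨n, j⟩ : Σ n, Fin (B.p n))

/-- The `e`-th edge from the vertex `j` of level `n` to the vertex `i` of level `n + 1`. -/
def arrow {n : ℕ} {i : Fin (B.p (n + 1))} {j : Fin (B.p n)} (e : Fin (B.k n i j)) : B.graph.Edge :=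
  (⟨n, i, j, e⟩ : Σ (n : ℕ) (i : Fin (B.p (n + 1))) (j : Fin (B.p n)), Fin (B.k n i j))

/-- The set of vertices that is given by a family of subsets of the levels. -/
def vertexSet (S : ∀ n, Finset (Fin (B.p n))) : Set B.graph.V :=
  {v | (show Σ n, Fin (B.p n) from v).2 ∈ S (show Σ n, Fin (B.p n) from v).1}

/-- The level of a vertex. -/
def vlevel (v : B.graph.V) : ℕ := (show Σ n, Fin (B.p n) from v).1

/-- The level at which an infinite path starts. -/
def level (x : B.graph.InfPath) : ℕ := vlevel x.start

theorem vlevel_rng (e : B.graph.Edge) : vlevel (B.graph.rng e) = vlevel (B.graph.src e) + 1 := rfl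

theorem vlevel_edge (x : B.graph.InfPath) (i : ℕ) :
    vlevel (B.graph.src (x.edge i)) = level x + i := by
  induction i with
  | zero => rfl
  | succ i ih => rw [x.chain, vlevel_rng, ih]; rfl

theorem exists_arrow (e : B.graph.Edge) {n : ℕ} {j : Fin (B.p n)}
    (h : B.graph.src e = vertex n j) : ∃ (i : _) (k : Fin (B.k n i j)), e = arrow k := by
  obtain ⟨n', i, j', k⟩ := e
  have h' : (⟨n', j'⟩ : Σ n, Fin (B.p n)) = ⟨n, j⟩ := h
  cases h'
  exact ⟨i, k, rfl⟩

theorem vertex_inj {n : ℕ} {j j' : Fin (B.p n)} (h : vertex n j = vertex n j') : j = j' := by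
  have h' : (⟨n, j⟩ : Σ n, Fin (B.p n)) = ⟨n, j'⟩ := h
  cases h'
  rfl

theorem edge_eq_of_level {x : B.graph.InfPath} {m : ℕ} {n : ℕ} {i : Fin (B.p (n + 1))}
    {j : Fin (B.p n)} {e : Fin (B.k n i j)} (h : x.edge m = arrow e) : level x + m = n := by
  rw [← vlevel_edge, h]; rfl

/-- The infinite path `x` passes through the finite path `α`, that is, `α` is an initial segment
of `x`. As an edge determines its level, only the occurrence of the edges of `α` is required. -/
def HasPrefix (x : B.graph.InfPath) : ∀ {n : ℕ} {j : Fin (B.p n)}, PathTo B S n j → Prop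
  | n, j, .start _ => x.start = vertex n j
  | _, _, .snoc e α => HasPrefix x α ∧ ∃ m, x.edge m = arrow e

namespace HasPrefix

variable {x y : B.graph.InfPath}

theorem start_mem {n : ℕ} {j : Fin (B.p n)} {α : PathTo B S n j} (h : HasPrefix x α) :
    x.start ∈ vertexSet S := by
  induction α with
  | start hs => rw [HasPrefix] at h; rw [h]; exact hs
  | snoc e α ih => exact ih h.1

theorem level_le {n : ℕ} {j : Fin (B.p n)} {α : PathTo B S n j} (h : HasPrefix x α) :
    level x ≤ n := by
  induction α with
  | start hs => rw [HasPrefix] at h; rw [level, h]; exact le_rfl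
  | snoc e α ih => exact (ih h.1).trans (Nat.le_succ _)

theorem src_edge {n : ℕ} {j : Fin (B.p n)} {α : PathTo B S n j} (h : HasPrefix x α) :
    B.graph.src (x.edge (n - level x)) = vertex n j := by
  cases α with
  | @start n _ hs =>
    rw [HasPrefix] at h
    rw [show n - level x = 0 by rw [level, h]; exact Nat.sub_self n]
    exact h
  | @snoc n i j e α =>
    obtain ⟨h, m, hm⟩ := h
    have := edge_eq_of_level hm
    rw [show n + 1 - level x = m + 1 by omega, x.chain, hm]
    rfl

/-- A path has at most one prefix that ends at a given level. -/
theorem unique : ∀ {n : ℕ} {j j' : Fin (B.p n)} {α : PathTo B S n j} {β : PathTo B S n j'},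
    HasPrefix x α → HasPrefix x β → (⟨j, α⟩ : Σ j, PathTo B S n j) = ⟨j', β⟩
  | n, j, j', .start h, .start h', hx, hy => by
    rw [HasPrefix] at hx hy
    obtain rfl := vertex_inj (hx.symm.trans hy)
    rfl
  | n + 1, j, j', .start h, .snoc e β, hx, hy => by
    have h1 : level x = n + 1 := by rw [HasPrefix] at hx; rw [level, hx]; rfl
    have h2 := level_le hy.1
    omega
  | n + 1, j, j', .snoc e α, .start h, hx, hy => by
    have h1 : level x = n + 1 := by rw [HasPrefix] at hy; rw [level, hy]; rfl
    have h2 := level_le hx.1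
    omega
  | n + 1, i, i', .snoc e α, .snoc e' β, hx, hy => by
    have h := unique hx.1 hy.1
    obtain ⟨m, hm⟩ := hx.2
    obtain ⟨m', hm'⟩ := hy.2
    have h1 := edge_eq_of_level hm
    have h2 := edge_eq_of_level hm'
    obtain rfl : m = m' := by omega
    rw [hm] at hm'
    cases h
    cases hm'
    rfl

theorem exists_of_level_le (hx : x.start ∈ vertexSet S) {n : ℕ} (hn : level x ≤ n) :
    ∃ (j : Fin (B.p n)) (α : PathTo B S n j), HasPrefix x α := by
  induction n, hn using Nat.le_induction with
  | base => exact ⟨(show Σ n, Fin (B.p n) from x.start).2, .start hx, rfl⟩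
  | succ n hn ih =>
    obtain ⟨j, α, h⟩ := ih
    obtain ⟨i, k, hk⟩ := exists_arrow _ h.src_edge
    exact ⟨i, .snoc k α, h, _, hk⟩

/-- Having `α` as a prefix depends only on the edges below the level of the end of `α`. -/
theorem congr (hs : x.start = y.start) : ∀ {n : ℕ} {j : Fin (B.p n)} {α : PathTo B S n j},
    (∀ i, level x + i < n → x.edge i = y.edge i) → HasPrefix x α → HasPrefix y α
  | _, _, .start h, _, hx => by
    rw [HasPrefix] at hx ⊢
    rw [← hs, hx]
  | n + 1, _, .snoc e α, he, hx => by
    refine ⟨congr hs (fun i hi => he i (by omega)) hx.1, ?_⟩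
    obtain ⟨m, hm⟩ := hx.2
    have := edge_eq_of_level hm
    exact ⟨m, by rw [← he m (by omega), hm]⟩

theorem start_eq {n : ℕ} {j : Fin (B.p n)} {α : PathTo B S n j} (hx : HasPrefix x α)
    (hy : HasPrefix y α) : x.start = y.start := by
  induction α with
  | start h => rw [HasPrefix] at hx hy; rw [hx, hy]
  | snoc e α ih => exact ih hx.1 hy.1

theorem level_eq {n : ℕ} {j : Fin (B.p n)} {α : PathTo B S n j} (hx : HasPrefix x α)
    (hy : HasPrefix y α) : level x = level y := by rw [level, level, hx.start_eq hy]

theorem edge_eq : ∀ {n : ℕ} {j : Fin (B.p n)} {α : PathTo B S n j} (_ : HasPrefix x α)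
    (_ : HasPrefix y α) (i : ℕ) (_ : level x + i < n), x.edge i = y.edge i
  | n, j, .start h, hx, _, i, hi => by
    rw [HasPrefix] at hx
    have : level x = n := by rw [level, hx]; rfl
    omega
  | n + 1, j, .snoc e α, hx, hy, i, hi => by
    by_cases h : level x + i < n
    · exact edge_eq hx.1 hy.1 i h
    · obtain ⟨m, hm⟩ := hx.2
      obtain ⟨m', hm'⟩ := hy.2
      have h1 := edge_eq_of_level hm
      have h2 := edge_eq_of_level hm'
      have h3 := level_eq hx.1 hy.1
      obtain rfl : m = m' := by omega
      obtain rfl : i = m := by omega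
      rw [hm, hm']

/-- Every finite path from `S` can be continued by every infinite path from its end. -/
theorem exists_append : ∀ {n : ℕ} {j : Fin (B.p n)} (α : PathTo B S n j) (z : B.graph.InfPath)
    (_ : z.start = vertex n j),
    ∃ x : B.graph.InfPath, HasPrefix x α ∧ ∀ i, x.edge (n - level x + i) = z.edge i
  | n, j, .start h, z, hz => by
    refine ⟨z, hz, fun i => ?_⟩
    have : level z = n := by rw [level, hz]; rfl
    rw [this, Nat.sub_self, zero_add]
  | n + 1, i, .snoc e α, z, hz => by
    let z' : B.graph.InfPath :=
      { edge := fun m => match m with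
          | 0 => arrow e
          | m + 1 => z.edge m
        chain := fun m => match m with
          | 0 => hz
          | m + 1 => z.chain m }
    obtain ⟨x, hx, hxz⟩ := exists_append α z' rfl
    have hl := hx.level_le
    refine ⟨x, ⟨hx, n - level x, hxz 0⟩, fun m => ?_⟩
    rw [show n + 1 - level x + m = n - level x + (m + 1) by omega, hxz]

end HasPrefix

/-- The infinite paths `x` and `y` have the same edges from level `n` on. The paths may start at
different levels, so the indices `i` and `j` of the edges of one level may differ. -/
def AgreeFrom (n : ℕ) (x y : B.graph.InfPath) : Prop :=
  ∀ i j, level x + i = level y + j → n ≤ level x + i → x.edge i = y.edge j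

namespace AgreeFrom

variable {n m : ℕ} {x y z : B.graph.InfPath}

theorem symm (h : AgreeFrom n x y) : AgreeFrom n y x := fun i j hij hn =>
  (h j i hij.symm (hij ▸ hn)).symm

theorem mono (h : AgreeFrom n x y) (hnm : n ≤ m) : AgreeFrom m x y := fun i j hij hm =>
  h i j hij (hnm.trans hm)

theorem trans (h : AgreeFrom n x y) (h' : AgreeFrom n y z) (hn : level y ≤ n) :
    AgreeFrom n x z := fun i j hij hi => by
  rw [h i (level x + i - level y) (by omega) hi, h' _ j (by omega) (by omega)]

theorem tailEquiv (h : AgreeFrom n x y) :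
    DirGraph.TailEquiv x ((level x : ℤ) - level y) y :=
  ⟨n, fun i j hi hj => h i j (by omega) (by omega)⟩

theorem eq_of_hasPrefix {j : Fin (B.p n)} {α : PathTo B S n j} (h : AgreeFrom n x y)
    (hx : HasPrefix x α) (hy : HasPrefix y α) : x = y := by
  refine DirGraph.InfPath.ext' fun i => ?_
  by_cases hi : level x + i < n
  · exact hx.edge_eq hy i hi
  · exact h i i (by rw [hx.level_eq hy]) (not_lt.1 hi)

end AgreeFrom

/-- Since edges raise the level by one, the lag is determined by the levels of the two paths. -/
theorem lag_eq (γ : B.graph.PathGroupoid) : γ.lag = (level γ.rng : ℤ) - level γ.src := by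
  obtain ⟨N, hN⟩ := γ.tail
  have h := hN (N + γ.lag.natAbs) ((N + γ.lag.natAbs : ℕ) + γ.lag).toNat (by omega) (by omega)
  have h1 := vlevel_edge γ.rng (N + γ.lag.natAbs)
  rw [h, vlevel_edge] at h1
  omega

/-- The path groupoid of a Bratteli diagram is principal. -/
theorem groupoid_ext {γ η : B.graph.PathGroupoid} (h1 : γ.rng = η.rng) (h2 : γ.src = η.src) :
    γ = η :=
  DirGraph.PathGroupoid.ext h1 (by rw [lag_eq, lag_eq, h1, h2]) h2

theorem exists_agreeFrom (γ : B.graph.PathGroupoid) :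
    ∃ n, level γ.rng ≤ n ∧ level γ.src ≤ n ∧ AgreeFrom n γ.rng γ.src := by
  obtain ⟨N, hN⟩ := γ.tail
  have hl := lag_eq γ
  exact ⟨level γ.rng + level γ.src + N, by omega, by omega, fun i j hij hi =>
    hN i j (by omega) (by omega)⟩

/-! ### Cylinder sets -/

/-- The compact open bisection `Z(α, β)` of a pair of paths from `S` with a common end: the
elements `(α z, k, β z)`. -/
def cylinder {n : ℕ} {j : Fin (B.p n)} (α β : PathTo B S n j) :
    Set (B.graph.Reduction (vertexSet S)) :=
  {γ | HasPrefix γ.1.rng α ∧ HasPrefix γ.1.src β ∧ AgreeFrom n γ.1.rng γ.1.src}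

section Cylinder

variable {n m : ℕ} {j : Fin (B.p n)} {α β : PathTo B S n j}
  {γ η : B.graph.Reduction (vertexSet S)}

theorem reduction_ext (h1 : γ.1.rng = η.1.rng) (h2 : γ.1.src = η.1.src) : γ = η :=
  Subtype.ext (groupoid_ext h1 h2)

/-- The element of the groupoid with range `x` and source `y`. -/
def mkReduction {x y : B.graph.InfPath} (hx : x.start ∈ vertexSet S) (hy : y.start ∈ vertexSet S)
    (h : AgreeFrom n x y) : B.graph.Reduction (vertexSet S) :=
  ⟨⟨x, _, y, h.tailEquiv⟩, hx, hy⟩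

theorem exists_mem_cylinder_of_agreeFrom (h1 : level γ.1.rng ≤ n) (h2 : level γ.1.src ≤ n)
    (h : AgreeFrom n γ.1.rng γ.1.src) :
    ∃ (j : Fin (B.p n)) (α β : PathTo B S n j), γ ∈ cylinder α β := by
  obtain ⟨j, α, hα⟩ := HasPrefix.exists_of_level_le γ.2.1 h1
  obtain ⟨j', β, hβ⟩ := HasPrefix.exists_of_level_le γ.2.2 h2
  have := hα.src_edge
  rw [h _ (n - level γ.1.src) (by omega) (by omega), hβ.src_edge] at this
  obtain rfl := vertex_inj this
  exact ⟨_, α, β, hα, hβ, h⟩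

theorem exists_mem_cylinder (γ : B.graph.Reduction (vertexSet S)) :
    ∃ N, ∀ n, N ≤ n → ∃ (j : Fin (B.p n)) (α β : PathTo B S n j), γ ∈ cylinder α β := by
  obtain ⟨N, h1, h2, h⟩ := exists_agreeFrom γ.1
  exact ⟨N, fun n hn => exists_mem_cylinder_of_agreeFrom (h1.trans hn) (h2.trans hn) (h.mono hn)⟩

theorem exists_mem_cylinder_of_le (h : γ ∈ cylinder α β) (hnm : n ≤ m) :
    ∃ (i : Fin (B.p m)) (α' β' : PathTo B S m i), γ ∈ cylinder α' β' :=
  exists_mem_cylinder_of_agreeFrom (h.1.level_le.trans hnm) (h.2.1.level_le.trans hnm)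
    (h.2.2.mono hnm)

theorem cylinder_unique {j' : Fin (B.p n)} {α' β' : PathTo B S n j'} (h : γ ∈ cylinder α β)
    (h' : γ ∈ cylinder α' β') :
    (⟨j, α, β⟩ : Σ j, PathTo B S n j × PathTo B S n j) = ⟨j', α', β'⟩ := by
  have h1 := h.1.unique h'.1
  have h2 := h.2.1.unique h'.2.1
  cases h1
  cases h2
  rfl

/-- If two elements lie in the same cylinder set of a level `m ≥ n`, they lie in the same
cylinder sets of level `n`. -/
theorem cylinder_nested (hnm : n ≤ m) {i : Fin (B.p m)} {α' β' : PathTo B S m i}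
    (h : γ ∈ cylinder α' β') (h' : η ∈ cylinder α' β') (hη : η ∈ cylinder α β) :
    γ ∈ cylinder α β := by
  have l1 := h.1.level_eq h'.1
  have l2 := h.2.1.level_eq h'.2.1
  refine ⟨hη.1.congr (h'.1.start_eq h.1) fun i hi => h'.1.edge_eq h.1 i (by omega),
    hη.2.1.congr (h'.2.1.start_eq h.2.1) fun i hi => h'.2.1.edge_eq h.2.1 i (by omega),
    fun a b hab ha => ?_⟩
  by_cases ham : level γ.1.rng + a < m
  · rw [h.1.edge_eq h'.1 a ham, h.2.1.edge_eq h'.2.1 b (by omega)]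
    exact hη.2.2 a b (by omega) (by omega)
  · exact h.2.2 a b hab (not_lt.1 ham)

theorem cylinder_rng_inj (h : γ ∈ cylinder α β) (h' : η ∈ cylinder α β)
    (hr : γ.1.rng = η.1.rng) : γ = η := by
  refine reduction_ext hr (AgreeFrom.eq_of_hasPrefix ?_ h.2.1 h'.2.1)
  exact (h.2.2.symm.trans (hr ▸ h'.2.2) h.1.level_le)

theorem cylinder_src_inj (h : γ ∈ cylinder α β) (h' : η ∈ cylinder α β)
    (hs : γ.1.src = η.1.src) : γ = η := by
  refine reduction_ext (AgreeFrom.eq_of_hasPrefix ?_ h.1 h'.1) hs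
  exact (h.2.2.trans (hs ▸ h'.2.2.symm) h.2.1.level_le)

theorem mem_cylinder_iff_snoc : γ ∈ cylinder α β ↔
    ∃ (i : Fin (B.p (n + 1))) (e : Fin (B.k n i j)), γ ∈ cylinder (.snoc e α) (.snoc e β) := by
  constructor
  · rintro ⟨h1, h2, h3⟩
    obtain ⟨i, e, he⟩ := exists_arrow _ h1.src_edge
    have l1 := h1.level_le
    have l2 := h2.level_le
    refine ⟨i, e, ⟨h1, _, he⟩, ⟨h2, n - level γ.1.src, ?_⟩, h3.mono (Nat.le_succ n)⟩
    rw [← he]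
    exact (h3 _ _ (by omega) (by omega)).symm
  · rintro ⟨i, e, ⟨h1, m, hm⟩, ⟨h2, m', hm'⟩, h3⟩
    refine ⟨h1, h2, fun a b hab ha => ?_⟩
    by_cases h : level γ.1.rng + a = n
    · have := edge_eq_of_level hm
      have := edge_eq_of_level hm'
      obtain rfl : a = m := by omega
      obtain rfl : b = m' := by omega
      rw [hm, hm']
    · exact h3 a b hab (by omega)

end Cylinder

end BratteliDiagram
end

noncomputable section

/-! ### The topology of the reduced path groupoid -/

open DirGraph.PathGroupoid (initSeg get_initSeg)

namespace BratteliDiagram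

variable {B : BratteliDiagram} {S : ∀ n, Finset (Fin (B.p n))}

theorem isConcat_initSeg {x z : B.graph.InfPath} {a : ℕ} (hz : ∀ i, x.edge (a + i) = z.edge i) :
    x.IsConcat (initSeg x a) z := by
  refine ⟨congrArg B.graph.src (hz 0), fun i => (get_initSeg x a i).symm, fun i => ?_⟩
  rw [← hz]
  simp [initSeg, DirGraph.FinPath.length]

theorem edge_of_isConcat_initSeg {x y z : B.graph.InfPath} {a : ℕ}
    (h : y.IsConcat (initSeg x a) z) :
    y.start = x.start ∧ (∀ i < a, y.edge i = x.edge i) ∧ ∀ i, y.edge (a + i) = z.edge i := by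
  obtain ⟨h1, h2, h3⟩ := h
  have hl : (initSeg x a).edges.length = a := by simp [initSeg]
  have h2' : ∀ i < a, y.edge i = x.edge i := fun i hi => by
    rw [← get_initSeg x a ⟨i, hl.symm ▸ hi⟩]
    exact h2 ⟨i, hl.symm ▸ hi⟩
  have h3' : ∀ i, y.edge (a + i) = z.edge i := fun i => by
    rw [← h3 i, DirGraph.FinPath.length, hl]
  refine ⟨?_, h2', h3'⟩
  rcases Nat.eq_zero_or_pos a with rfl | ha
  · exact (congrArg B.graph.src (h3' 0)).trans h1.symm
  · exact congrArg B.graph.src (h2' 0 ha)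

theorem isOpen_Z {E : DirGraph} {α β : E.FinPath} (h : α.target = β.target) :
    IsOpen (DirGraph.PathGroupoid.Z α β) :=
  TopologicalSpace.isOpen_generateFrom_of_mem ⟨α, β, h, rfl⟩

theorem isOpen_cylinder {n : ℕ} {j : Fin (B.p n)} (α β : PathTo B S n j) :
    IsOpen (cylinder α β) := by
  rw [isOpen_iff_forall_mem_open]
  rintro γ ⟨h1, h2, h3⟩
  have l1 := h1.level_le
  have l2 := h2.level_le
  let z : B.graph.InfPath :=
    ⟨fun i => γ.1.rng.edge (n - level γ.1.rng + i), fun i => γ.1.rng.chain _⟩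
  refine ⟨Subtype.val ⁻¹' DirGraph.PathGroupoid.Z (initSeg γ.1.rng (n - level γ.1.rng))
    (initSeg γ.1.src (n - level γ.1.src)), ?_, ?_, ?_⟩
  · rintro η ⟨z', k1, k2, k3⟩
    obtain ⟨s1, e1, t1⟩ := edge_of_isConcat_initSeg k1
    obtain ⟨s2, e2, t2⟩ := edge_of_isConcat_initSeg k2
    have m1 : level η.1.rng = level γ.1.rng := by rw [level, s1, level]
    have m2 : level η.1.src = level γ.1.src := by rw [level, s2, level]
    refine ⟨h1.congr s1.symm fun i hi => (e1 i (by omega)).symm,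
      h2.congr s2.symm fun i hi => (e2 i (by omega)).symm, fun a b hab ha => ?_⟩
    have ha' := t1 (a - (n - level γ.1.rng))
    have hb' := t2 (b - (n - level γ.1.src))
    rw [Nat.add_sub_cancel' (by omega)] at ha' hb'
    rw [ha', hb', show a - (n - level γ.1.rng) = b - (n - level γ.1.src) by omega]
  · refine (isOpen_Z ?_).preimage continuous_subtype_val
    exact h1.src_edge.trans h2.src_edge.symm
  · refine ⟨z, isConcat_initSeg fun i => rfl, isConcat_initSeg fun i => ?_, ?_⟩
    · exact (h3 _ _ (by omega) (by omega)).symm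
    · rw [lag_eq]
      simp only [DirGraph.FinPath.length, initSeg, List.length_ofFn]
      omega

/-- The cylinder sets of the high levels form a neighbourhood basis. -/
theorem exists_cylinder_subset {U : Set (B.graph.Reduction (vertexSet S))} (hU : IsOpen U)
    {γ : B.graph.Reduction (vertexSet S)} (hγ : γ ∈ U) :
    ∃ N, ∀ n, N ≤ n → ∀ (j : Fin (B.p n)) (α β : PathTo B S n j), γ ∈ cylinder α β →
      cylinder α β ⊆ U := by
  obtain ⟨V, hV, rfl⟩ := isOpen_induced_iff.1 hU
  induction hV with
  | univ => exact ⟨0, fun _ _ _ _ _ _ => Set.subset_univ _⟩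
  | inter s t hs ht ihs iht =>
    obtain ⟨N, hN⟩ := ihs ((isOpen_induced_iff.2 ⟨s, hs, rfl⟩)) hγ.1
    obtain ⟨M, hM⟩ := iht ((isOpen_induced_iff.2 ⟨t, ht, rfl⟩)) hγ.2
    exact ⟨max N M, fun n hn j α β h => Set.subset_inter
      (hN n (le_of_max_le_left hn) j α β h) (hM n (le_of_max_le_right hn) j α β h)⟩
  | sUnion T hT ih =>
    obtain ⟨t, ht, hγt⟩ := hγ
    obtain ⟨N, hN⟩ := ih t ht (isOpen_induced_iff.2 ⟨t, hT t ht, rfl⟩) hγt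
    exact ⟨N, fun n hn j α β h => (hN n hn j α β h).trans fun η hη => ⟨t, ht, hη⟩⟩
  | basic s hs =>
    obtain ⟨a, b, -, rfl⟩ := hs
    obtain ⟨z, h1, h2, h3⟩ := hγ
    refine ⟨level γ.1.rng + a.length + level γ.1.src + b.length + 1, fun n hn j α β h η hη => ?_⟩
    have l1 := hη.1.level_eq h.1
    have l2 := hη.2.1.level_eq h.2.1
    have hl := lag_eq γ.1
    have hr : ∀ i, level γ.1.rng + i < n → η.1.rng.edge i = γ.1.rng.edge i := fun i hi =>
      hη.1.edge_eq h.1 i (by omega)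
    have hs : ∀ i, level γ.1.src + i < n → η.1.src.edge i = γ.1.src.edge i := fun i hi =>
      hη.2.1.edge_eq h.2.1 i (by omega)
    have hla : a.edges.length = a.length := rfl
    have hlb : b.edges.length = b.length := rfl
    have key : ∀ i, η.1.src.edge (b.length + i) = η.1.rng.edge (a.length + i) := fun i => by
      by_cases hi : level γ.1.rng + (a.length + i) < n
      · rw [hr _ hi, hs _ (by omega), h1.2.2, h2.2.2]
      · exact (hη.2.2 _ _ (by omega) (by omega)).symm
    refine ⟨⟨fun i => η.1.rng.edge (a.length + i), fun i => η.1.rng.chain _⟩,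
      ⟨?_, fun i => ?_, fun i => rfl⟩, ⟨?_, fun i => ?_, key⟩, ?_⟩
    · rw [h1.1]
      show B.graph.src (z.edge 0) = B.graph.src (η.1.rng.edge (a.length + 0))
      rw [hr _ (by omega), h1.2.2]
    · rw [hr i (by omega), h1.2.1]
    · rw [h2.1]
      show B.graph.src (z.edge 0) = B.graph.src (η.1.rng.edge (a.length + 0))
      rw [hr _ (by omega), h1.2.2]
    · rw [hs i (by omega), h2.2.1]
    · have := lag_eq η.1
      omega

theorem isClosed_cylinder {n : ℕ} {j : Fin (B.p n)} (α β : PathTo B S n j) :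
    IsClosed (cylinder α β) := by
  rw [← isOpen_compl_iff, isOpen_iff_forall_mem_open]
  intro γ hγ
  obtain ⟨N, hN⟩ := exists_mem_cylinder γ
  obtain ⟨i, α', β', h⟩ := hN (max N n) (le_max_left N n)
  exact ⟨_, fun η hη hη' => hγ (cylinder_nested (le_max_right N n) h hη hη'),
    isOpen_cylinder α' β', h⟩

theorem finite_edges (n : ℕ) : {e : B.graph.Edge | vlevel (B.graph.src e) = n}.Finite := by
  refine (Set.finite_range fun x : (Σ (i : Fin (B.p (n + 1))) (j : Fin (B.p n)),
    Fin (B.k n i j)) => (arrow x.2.2 : B.graph.Edge)).subset ?_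
  rintro ⟨n', i, j, k⟩ h
  obtain rfl : n' = n := h
  exact ⟨⟨i, j, k⟩, rfl⟩

/-- An ultrafilter on a cylinder set picks an edge on each of the finite levels, and these edges
form the path to which it converges. -/
theorem isCompact_cylinder {n : ℕ} {j : Fin (B.p n)} (α β : PathTo B S n j) :
    IsCompact (cylinder α β) := by
  rw [isCompact_iff_ultrafilter_le_nhds]
  intro 𝓤 h𝓤
  have hcyl : ∀ᶠ γ in (𝓤 : Filter _), γ ∈ cylinder α β := Filter.le_principal_iff.1 h𝓤
  have hc : ∀ i, ∃ c : B.graph.Edge, ∀ᶠ γ : B.graph.Reduction (vertexSet S) in (𝓤 : Filter _),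
      γ.1.rng.edge (n - level γ.1.rng + i) = c := by
    intro i
    have h1 : (⋃ c ∈ {e : B.graph.Edge | vlevel (B.graph.src e) = n + i},
        {γ : B.graph.Reduction (vertexSet S) | γ.1.rng.edge (n - level γ.1.rng + i) = c}) ∈ 𝓤 := by
      filter_upwards [hcyl] with γ hγ
      have := hγ.1.level_le
      refine Set.mem_biUnion (x := γ.1.rng.edge (n - level γ.1.rng + i)) ?_ rfl
      show vlevel _ = _
      rw [vlevel_edge]
      omega
    obtain ⟨c, -, h⟩ := (Ultrafilter.finite_biUnion_mem_iff (finite_edges _)).1 h1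
    exact ⟨c, h⟩
  choose c hc using hc
  let z : B.graph.InfPath := ⟨c, fun i => by
    obtain ⟨γ, h1, h2⟩ := ((hc (i + 1)).and (hc i)).exists
    rw [← h1, ← h2]
    exact γ.1.rng.chain _⟩
  have hz : z.start = vertex n j := by
    obtain ⟨γ, h1, h2⟩ := ((hc 0).and hcyl).exists
    show B.graph.src (c 0) = _
    rw [← h1]
    exact h2.1.src_edge
  obtain ⟨x, hx, hxz⟩ := HasPrefix.exists_append α z hz
  obtain ⟨y, hy, hyz⟩ := HasPrefix.exists_append β z hz
  have lx := hx.level_le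
  have ly := hy.level_le
  have hxy : AgreeFrom n x y := fun a b hab ha => by
    have h1 := hxz (a - (n - level x))
    have h2 := hyz (b - (n - level y))
    rw [Nat.add_sub_cancel' (by omega)] at h1 h2
    rw [h1, h2, show a - (n - level x) = b - (n - level y) by omega]
  let γ₀ : B.graph.Reduction (vertexSet S) := mkReduction hx.start_mem hy.start_mem hxy
  have hγ₀ : γ₀ ∈ cylinder α β := ⟨hx, hy, hxy⟩
  refine ⟨γ₀, hγ₀, fun U hU => ?_⟩
  obtain ⟨V, hVU, hV, hγV⟩ := mem_nhds_iff.1 hU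
  obtain ⟨N, hN⟩ := exists_cylinder_subset hV hγV
  obtain ⟨i, α', β', h⟩ := exists_mem_cylinder_of_le hγ₀ (le_max_left n N)
  refine Filter.mem_of_superset ?_ ((hN _ (le_max_right n N) i α' β' h).trans hVU)
  have hall : ∀ᶠ γ : B.graph.Reduction (vertexSet S) in (𝓤 : Filter _),
      ∀ i ∈ Set.Iio (max n N), γ.1.rng.edge (n - level γ.1.rng + i) = c i :=
    (Filter.eventually_all_finite (Set.finite_Iio _)).2 fun i _ => hc i
  filter_upwards [hall, hcyl] with γ hγ hγc
  have l1 := hγc.1.level_eq hx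
  have l2 := hγc.2.1.level_eq hy
  have hr : ∀ a, level x + a < max n N → x.edge a = γ.1.rng.edge a := fun a ha => by
    by_cases han : level x + a < n
    · exact hx.edge_eq hγc.1 a han
    · have h1 := hxz (a - (n - level x))
      have h2 := hγ (a - (n - level x)) (show a - (n - level x) < max n N by omega)
      rw [l1] at h2
      rw [Nat.add_sub_cancel' (by omega)] at h1 h2
      rw [h1, h2]
  refine ⟨h.1.congr (hx.start_eq hγc.1) hr, h.2.1.congr (hy.start_eq hγc.2.1) fun a ha => ?_,
    hγc.2.2.mono (le_max_left n N)⟩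
  change level y + a < _ at ha
  show y.edge a = _
  by_cases han : level y + a < n
  · exact hy.edge_eq hγc.2.1 a han
  · rw [← hxy (level y + a - level x) a (by omega) (by omega), hr _ (by omega)]
    exact hγc.2.2 _ _ (by omega) (by omega)

end BratteliDiagram
end

noncomputable section

open DirGraph.Reduction (conv invol iNorm tsum_fibre_le iNorm_ne_top)
open DirGraph (universalRep)

namespace BratteliDiagram

variable {B : BratteliDiagram} {S : ∀ n, Finset (Fin (B.p n))}

/-- A path through a vertex can be given any other beginning. -/
theorem HasPrefix.exists_agreeFrom {x : B.graph.InfPath} {n : ℕ} {j : Fin (B.p n)}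
    {α : PathTo B S n j} (h : HasPrefix x α) (β : PathTo B S n j) :
    ∃ y, HasPrefix y β ∧ AgreeFrom n x y := by
  have l := h.level_le
  obtain ⟨y, hy, hyz⟩ := HasPrefix.exists_append β
    ⟨fun i => x.edge (n - level x + i), fun i => x.chain _⟩ h.src_edge
  have l' := hy.level_le
  refine ⟨y, hy, fun a b hab ha => ?_⟩
  have h2 := hyz (b - (n - level y))
  rw [Nat.add_sub_cancel' (by omega)] at h2
  rw [h2]
  show _ = x.edge (n - level x + (b - (n - level y)))
  congr 1
  omega

/-! ### The characteristic functions of the cylinder sets -/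

open scoped Classical in
/-- The characteristic function of the cylinder set of `α` and `β`. -/
def chi {n : ℕ} {j : Fin (B.p n)} (α β : PathTo B S n j) :
    C_c(B.graph.Reduction (vertexSet S), ℂ) where
  toFun γ := if γ ∈ cylinder α β then 1 else 0
  continuous_toFun := by
    have h : IsClopen (cylinder α β) := ⟨isClosed_cylinder α β, isOpen_cylinder α β⟩
    refine Continuous.if (fun a ha => ?_) continuous_const continuous_const
    rw [Set.ofPred_mem_eq, h.frontier_eq] at ha
    exact ha.elim
  hasCompactSupport' := HasCompactSupport.intro' (isCompact_cylinder α β) (isClosed_cylinder α β)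
    fun _ h => if_neg h

variable {n : ℕ} {j : Fin (B.p n)} {γ : B.graph.Reduction (vertexSet S)}

theorem chi_of_mem {α β : PathTo B S n j} (h : γ ∈ cylinder α β) : chi α β γ = 1 := if_pos h

theorem chi_of_notMem {α β : PathTo B S n j} (h : γ ∉ cylinder α β) : chi α β γ = 0 := if_neg h

theorem chi_conv_chi (α β δ : PathTo B S n j) : ⇑(chi α δ) = conv (chi α β) (chi β δ) := by
  funext γ
  rw [conv]
  by_cases hγ : γ ∈ cylinder α δ
  · -- The only nonzero term is at the element that replaces the prefix `α` of the range by `β`.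
    obtain ⟨y, hy, hxy⟩ := hγ.1.exists_agreeFrom β
    let η : B.graph.Reduction (vertexSet S) := mkReduction γ.2.1 hy.start_mem hxy
    have hη : η ∈ cylinder α β := ⟨hγ.1, hy, hxy⟩
    rw [tsum_eq_single ⟨η, rfl⟩, chi_of_mem hγ, chi_of_mem hη, chi_of_mem, one_mul]
    · exact ⟨hy, hγ.2.1, hxy.symm.trans hγ.2.2 hγ.1.level_le⟩
    · intro η' hne
      rw [chi_of_notMem, zero_mul]
      intro h
      exact hne (Subtype.ext (cylinder_rng_inj h hη η'.2))
  · rw [chi_of_notMem hγ]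
    symm
    convert tsum_zero with η
    by_cases h : η.1 ∈ cylinder α β
    · by_cases h' : η.1.inv.mul γ η.2 ∈ cylinder β δ
      · refine (hγ ⟨η.2 ▸ h.1, h'.2.1, ?_⟩).elim
        have h3 := h.2.2
        rw [η.2] at h3
        exact h3.trans h'.2.2 h'.1.level_le
      · rw [chi_of_notMem h', mul_zero]
    · rw [chi_of_notMem h, zero_mul]

theorem conv_chi_eq_zero {j' : Fin (B.p n)} {α β : PathTo B S n j} {α' β' : PathTo B S n j'}
    (h : (⟨j, β⟩ : Σ j, PathTo B S n j) ≠ ⟨j', α'⟩) : conv (chi α β) (chi α' β') = 0 := by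
  funext γ
  rw [conv, Pi.zero_apply]
  convert tsum_zero with η
  by_cases h1 : η.1 ∈ cylinder α β
  · rw [chi_of_notMem (α := α'), mul_zero]
    exact fun h2 => h (h1.2.1.unique h2.1)
  · rw [chi_of_notMem h1, zero_mul]

theorem invol_chi (α β : PathTo B S n j) : ⇑(chi β α) = invol (chi α β) := by
  funext γ
  rw [invol]
  by_cases h : γ ∈ cylinder β α
  · rw [chi_of_mem h, chi_of_mem, star_one]
    exact ⟨h.2.1, h.1, h.2.2.symm⟩
  · rw [chi_of_notMem h, chi_of_notMem, star_zero]
    exact fun h' => h ⟨h'.2.1, h'.1, h'.2.2.symm⟩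

/-- The function which is constant on the cylinder sets of level `n`, with the entries of the
matrices `a j` as its values. -/
def blockFun (a : PathAlg B S n) : C_c(B.graph.Reduction (vertexSet S), ℂ) :=
  ∑ j, ∑ α, ∑ β, a j α β • chi α β

theorem blockFun_apply (a : PathAlg B S n) : blockFun a γ = ∑ j, ∑ α, ∑ β, a j α β * chi α β γ := by
  simp [blockFun, CompactlySupportedContinuousMap.sum_apply]

theorem blockFun_of_mem (a : PathAlg B S n) {α β : PathTo B S n j} (h : γ ∈ cylinder α β) :
    blockFun a γ = a j α β := by
  rw [blockFun_apply, Finset.sum_eq_single j, Finset.sum_eq_single α, Finset.sum_eq_single β,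
    chi_of_mem h, mul_one]
  · intro β' _ hne
    rw [chi_of_notMem, mul_zero]
    intro h'
    have := cylinder_unique h h'
    simp only [Sigma.mk.injEq, heq_eq_eq, Prod.mk.injEq, true_and] at this
    exact hne this.symm
  · simp
  · intro α' _ hne
    refine Finset.sum_eq_zero fun β' _ => ?_
    rw [chi_of_notMem, mul_zero]
    intro h'
    have := cylinder_unique h h'
    simp only [Sigma.mk.injEq, heq_eq_eq, Prod.mk.injEq, true_and] at this
    exact hne this.1.symm
  · simp
  · intro j' _ hne
    refine Finset.sum_eq_zero fun α' _ => Finset.sum_eq_zero fun β' _ => ?_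
    rw [chi_of_notMem, mul_zero]
    intro h'
    exact hne (congrArg Sigma.fst (cylinder_unique h h')).symm
  · simp

theorem blockFun_of_notMem (a : PathAlg B S n)
    (h : ∀ (j : Fin (B.p n)) (α β : PathTo B S n j), γ ∉ cylinder α β) : blockFun a γ = 0 := by
  rw [blockFun_apply]
  exact Finset.sum_eq_zero fun j _ => Finset.sum_eq_zero fun α _ => Finset.sum_eq_zero fun β _ => by
    rw [chi_of_notMem (h j α β), mul_zero]

theorem chi_eq_sum (α β : PathTo B S n j) :
    chi α β = ∑ i, ∑ e : Fin (B.k n i j), chi (.snoc e α) (.snoc e β) := by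
  ext γ
  simp only [CompactlySupportedContinuousMap.sum_apply]
  by_cases h : γ ∈ cylinder α β
  · obtain ⟨i, e, h'⟩ := mem_cylinder_iff_snoc.1 h
    rw [chi_of_mem h, Finset.sum_eq_single i, Finset.sum_eq_single e, chi_of_mem h']
    · intro e' _ hne
      refine chi_of_notMem fun h2 => hne ?_
      have := cylinder_unique h' h2
      simp only [Sigma.mk.injEq, heq_eq_eq, Prod.mk.injEq, true_and] at this
      simpa using this.1.symm
    · simp
    · intro i' _ hne
      refine Finset.sum_eq_zero fun e' _ => chi_of_notMem fun h2 => hne ?_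
      exact (congrArg Sigma.fst (cylinder_unique h' h2)).symm
    · simp
  · rw [chi_of_notMem h]
    exact (Finset.sum_eq_zero fun i _ => Finset.sum_eq_zero fun e _ => chi_of_notMem fun h' =>
      h (mem_cylinder_iff_snoc.2 ⟨i, e, h'⟩)).symm

/-! ### Approximation by locally constant functions -/

/-- The union of the cylinder sets of level `n` on which `f` varies by at most `ε`. -/
def flatPart (f : B.graph.Reduction (vertexSet S) → ℂ) (ε : ℝ) (n : ℕ) :
    Set (B.graph.Reduction (vertexSet S)) :=
  ⋃ t ∈ {t : Σ j, PathTo B S n j × PathTo B S n j |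
    ∀ γ ∈ cylinder t.2.1 t.2.2, ∀ η ∈ cylinder t.2.1 t.2.2, ‖f γ - f η‖ ≤ ε},
    cylinder t.2.1 t.2.2

theorem mem_flatPart {f : B.graph.Reduction (vertexSet S) → ℂ} {ε : ℝ} :
    γ ∈ flatPart f ε n ↔ ∃ (j : Fin (B.p n)) (α β : PathTo B S n j), γ ∈ cylinder α β ∧
      ∀ γ ∈ cylinder α β, ∀ η ∈ cylinder α β, ‖f γ - f η‖ ≤ ε := by
  simp only [flatPart, Set.mem_iUnion, Set.mem_ofPred_eq]
  constructor
  · rintro ⟨⟨j, α, β⟩, h, hγ⟩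
    exact ⟨j, α, β, hγ, h⟩
  · rintro ⟨j, α, β, hγ, h⟩
    exact ⟨⟨j, α, β⟩, h, hγ⟩

theorem flatPart_mono (f : B.graph.Reduction (vertexSet S) → ℂ) (ε : ℝ) :
    Monotone (flatPart (B := B) (S := S) f ε) := by
  intro n m hnm γ hγ
  obtain ⟨j, α, β, h, hf⟩ := mem_flatPart.1 hγ
  obtain ⟨i, α', β', h'⟩ := exists_mem_cylinder_of_le h hnm
  exact mem_flatPart.2 ⟨i, α', β', h', fun η hη η' hη' =>
    hf _ (cylinder_nested hnm hη h' h) _ (cylinder_nested hnm hη' h' h)⟩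

theorem exists_subset_flatPart {f : B.graph.Reduction (vertexSet S) → ℂ} (hf : Continuous f)
    {K : Set (B.graph.Reduction (vertexSet S))} (hK : IsCompact K) {ε : ℝ} (hε : 0 < ε) :
    ∃ n, K ⊆ flatPart f ε n := by
  refine hK.elim_directed_cover (flatPart f ε)
    (fun n => isOpen_biUnion fun t _ => isOpen_cylinder _ _) (fun γ _ => ?_)
    (flatPart_mono f ε).directed_le
  obtain ⟨N, hN⟩ := exists_cylinder_subset
    ((Metric.isOpen_ball (x := f γ) (ε := ε / 2)).preimage hf)
    (Metric.mem_ball_self (half_pos hε))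
  obtain ⟨M, hM⟩ := exists_mem_cylinder γ
  obtain ⟨j, α, β, h⟩ := hM (max N M) (le_max_right _ _)
  have hsub := hN _ (le_max_left _ _) j α β h
  refine Set.mem_iUnion.2 ⟨_, mem_flatPart.2 ⟨j, α, β, h, fun η hη η' hη' => ?_⟩⟩
  have h1 : dist (f η) (f γ) < ε / 2 := hsub hη
  have h2 : dist (f η') (f γ) < ε / 2 := hsub hη'
  rw [← dist_eq_norm]
  linarith [dist_triangle_right (f η) (f η') (f γ)]

/-- The number of terms in a fibre sum of `f - blockFun a` is bounded independently of the level
of `a`, since the supports of both functions lie in the union of the cylinder sets of one fixed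
level. -/
theorem exists_iNorm_sub_le (f : C_c(B.graph.Reduction (vertexSet S), ℂ)) {ε : ℝ} (hε : 0 < ε) :
    ∃ (n : ℕ) (a : PathAlg B S n), iNorm (⇑(f - blockFun a)) ≤ ENNReal.ofReal ε := by
  classical
  -- At this level only the fact matters that the cylinder sets cover the support of `f`.
  obtain ⟨n, hn⟩ := exists_subset_flatPart f.continuous f.hasCompactSupport.isCompact one_pos
  have hn' : ∀ γ, f γ ≠ 0 → ∃ (j : Fin (B.p n)) (α β : PathTo B S n j), γ ∈ cylinder α β := by
    intro γ hγ
    obtain ⟨j, α, β, h, -⟩ := mem_flatPart.1 (hn (subset_tsupport f hγ))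
    exact ⟨j, α, β, h⟩
  let T : Finset (Set (B.graph.Reduction (vertexSet S))) :=
    Finset.univ.image fun t : Σ j, PathTo B S n j × PathTo B S n j => cylinder t.2.1 t.2.2
  -- The bisections in `T` cover the support of `f - blockFun a`, so a pointwise bound `δ` suffices.
  obtain ⟨δ, hδ, hδε⟩ : ∃ δ : ℝ, 0 < δ ∧ T.card * δ ≤ ε := by
    refine ⟨ε / (T.card + 1), by positivity, ?_⟩
    rw [mul_div_assoc', div_le_iff₀ (by positivity)]
    nlinarith
  obtain ⟨m', hm'⟩ := exists_subset_flatPart f.continuous f.hasCompactSupport.isCompact hδ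
  obtain ⟨m, hnm, hm⟩ : ∃ m, n ≤ m ∧ tsupport f ⊆ flatPart f δ m :=
    ⟨max n m', le_max_left _ _, hm'.trans (flatPart_mono f δ (le_max_right _ _))⟩
  let a : PathAlg B S m := fun j α β =>
    if h : (cylinder α β).Nonempty then f h.some else 0
  have ha : ∀ {γ : B.graph.Reduction (vertexSet S)} {j : Fin (B.p m)} {α β : PathTo B S m j},
      γ ∈ cylinder α β → ∃ η ∈ cylinder α β, blockFun a γ = f η := by
    intro γ j α β h
    have hne : (cylinder α β).Nonempty := ⟨γ, h⟩
    exact ⟨hne.some, hne.some_mem, by rw [blockFun_of_mem a h]; exact dif_pos hne⟩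
  have hflat : ∀ {j : Fin (B.p m)} {α β : PathTo B S m j}, ∀ γ ∈ cylinder α β, f γ ≠ 0 →
      ∀ γ ∈ cylinder α β, ∀ η ∈ cylinder α β, ‖f γ - f η‖ ≤ δ := by
    intro j α β γ h hγ
    obtain ⟨j', α', β', h', hf⟩ := mem_flatPart.1 (hm (subset_tsupport f hγ))
    cases cylinder_unique h h'
    exact hf
  have hle : ∀ γ, ‖(f - blockFun a) γ‖ₑ ≤ ENNReal.ofReal δ := by
    intro γ
    rw [← ofReal_norm]
    refine ENNReal.ofReal_le_ofReal ?_
    rw [CompactlySupportedContinuousMap.sub_apply]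
    by_cases hγ : ∃ (j : Fin (B.p m)) (α β : PathTo B S m j), γ ∈ cylinder α β
    · obtain ⟨j, α, β, h⟩ := hγ
      obtain ⟨η, hη, e⟩ := ha h
      rw [e]
      by_cases h0 : f γ = 0
      · by_cases h1 : f η = 0
        · simpa [h0, h1] using hδ.le
        · exact hflat η hη h1 _ h _ hη
      · exact hflat γ h h0 _ h _ hη
    · push Not at hγ
      rw [blockFun_of_notMem a hγ]
      by_cases h0 : f γ = 0
      · simpa [h0] using hδ.le
      · obtain ⟨j, α, β, h⟩ := hn' γ h0
        obtain ⟨j', α', β', h'⟩ := exists_mem_cylinder_of_le h hnm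
        exact (hγ j' α' β' h').elim
  have hT : ∀ γ, (f - blockFun a) γ ≠ 0 → ∃ U ∈ T, γ ∈ U := by
    intro γ hγ
    suffices ∃ (j : Fin (B.p n)) (α β : PathTo B S n j), γ ∈ cylinder α β by
      obtain ⟨j, α, β, h⟩ := this
      exact ⟨_, Finset.mem_image_of_mem _ (Finset.mem_univ ⟨j, α, β⟩), h⟩
    by_cases h0 : f γ = 0
    · by_cases hγ' : ∃ (j : Fin (B.p m)) (α β : PathTo B S m j), γ ∈ cylinder α β
      · obtain ⟨j, α, β, h⟩ := hγ'
        obtain ⟨η, hη, e⟩ := ha h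
        have h1 : f η ≠ 0 := fun h1 => hγ (by
          rw [CompactlySupportedContinuousMap.sub_apply, h0, e, h1, sub_zero])
        obtain ⟨j', α', β', h'⟩ := hn' η h1
        exact ⟨j', α', β', cylinder_nested hnm h hη h'⟩
      · push Not at hγ'
        exact (hγ (by
          rw [CompactlySupportedContinuousMap.sub_apply, h0, blockFun_of_notMem a hγ',
            sub_zero])).elim
    · exact hn' γ h0
  have hcard : T.card * ENNReal.ofReal δ ≤ ENNReal.ofReal ε := by
    rw [← ENNReal.ofReal_natCast, ← ENNReal.ofReal_mul (Nat.cast_nonneg _)]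
    exact ENNReal.ofReal_le_ofReal hδε
  refine ⟨m, a, max_le (iSup_le fun u => ?_) (iSup_le fun u => ?_)⟩
  · refine (tsum_fibre_le (fun γ => γ.1.rng) _ _ hle T hT (fun U hU => ?_) u).trans hcard
    obtain ⟨t, -, rfl⟩ := Finset.mem_image.1 hU
    exact fun γ hγ η hη h => cylinder_rng_inj hγ hη h
  · refine (tsum_fibre_le (fun γ => γ.1.src) _ _ hle T hT (fun U hU => ?_) u).trans hcard
    obtain ⟨t, -, rfl⟩ := Finset.mem_image.1 hU
    exact fun γ hγ η hη h => cylinder_src_inj hγ hη h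

end BratteliDiagram

/-! ### The universal representation -/

namespace DirGraph

variable {E : DirGraph} {S : Set E.V}

theorem universalRep_add (f g : C_c(E.Reduction S, ℂ)) :
    universalRep E S (f + g) = universalRep E S f + universalRep E S g :=
  lp.ext (funext fun π => map_add π.π f g)

set_option synthInstance.maxHeartbeats 200000 in
theorem universalRep_smul (z : ℂ) (f : C_c(E.Reduction S, ℂ)) :
    universalRep E S (z • f) = z • universalRep E S f :=
  lp.ext (funext fun π => map_smul π.π z f)

set_option synthInstance.maxHeartbeats 200000 in
variable (E S) in
/-- The universal representation as a linear map. -/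
def universalRepₗ : C_c(E.Reduction S, ℂ) →ₗ[ℂ] RepProduct E S where
  toFun := universalRep E S
  map_add' := universalRep_add
  map_smul' := universalRep_smul

theorem universalRep_conv {f g h : C_c(E.Reduction S, ℂ)} (hh : ⇑h = conv f g) :
    universalRep E S h = universalRep E S f * universalRep E S g :=
  lp.ext (funext fun π => π.map_conv f g h hh)

theorem universalRep_invol {f g : C_c(E.Reduction S, ℂ)} (hg : ⇑g = invol f) :
    universalRep E S g = star (universalRep E S f) :=
  lp.ext (funext fun π => π.map_invol f g hg)

theorem norm_universalRep_le (f : C_c(E.Reduction S, ℂ)) :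
    ‖universalRep E S f‖ ≤ (iNorm f).toReal :=
  lp.norm_le_of_forall_le ENNReal.toReal_nonneg fun π => by
    have := ENNReal.toReal_mono (iNorm_ne_top f) (π.bound f)
    rwa [toReal_enorm] at this

end DirGraph
end

noncomputable section

/-! ### Operators given by matrices with bounded row and column sums -/

namespace SchurOperator

variable {X : Type}

theorem tsum_enorm_sq (ξ : lp (fun _ : X => ℂ) 2) : ∑' x, ‖ξ x‖ₑ ^ 2 = ‖ξ‖ₑ ^ 2 := by
  have h := lp.hasSum_norm (p := 2) (by norm_num) ξ
  simp only [ENNReal.toReal_ofNat, Real.rpow_ofNat] at h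
  have h2 := ENNReal.ofReal_tsum_of_nonneg (fun x => sq_nonneg ‖ξ x‖) h.summable
  rw [h.tsum_eq] at h2
  rw [← ofReal_norm, ← ENNReal.ofReal_pow (norm_nonneg _), h2]
  refine tsum_congr fun x => ?_
  rw [← ofReal_norm, ← ENNReal.ofReal_pow (norm_nonneg _)]

theorem memℓp_two_of_tsum_ne_top {f : X → ℂ} (h : ∑' x, ‖f x‖ₑ ^ 2 ≠ ⊤) : Memℓp f 2 := by
  refine memℓp_gen ?_
  simp only [ENNReal.toReal_ofNat, Real.rpow_ofNat]
  have h2 := ENNReal.summable_toReal h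
  simpa using h2

/-- The Cauchy–Schwarz inequality for the weights `w`. -/
theorem tsum_mul_sq_le (w b : X → ℝ≥0∞) :
    (∑' x, w x * b x) ^ 2 ≤ (∑' x, w x) * ∑' x, w x * b x ^ 2 := by
  have h : ∑' x, w x * b x ≤ ((∑' x, w x) * ∑' x, w x * b x ^ 2) ^ (2⁻¹ : ℝ) := by
    rw [ENNReal.tsum_eq_iSup_sum]
    refine iSup_le fun s => ?_
    refine (ENNReal.inner_le_weight_mul_Lp_of_nonneg s one_le_two w b).trans ?_
    rw [show (1 : ℝ) - 2⁻¹ = 2⁻¹ by norm_num, ← ENNReal.mul_rpow_of_nonneg _ _ (by norm_num)]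
    refine ENNReal.rpow_le_rpow ?_ (by norm_num)
    simp only [ENNReal.rpow_ofNat]
    exact mul_le_mul' (ENNReal.sum_le_tsum s) (ENNReal.sum_le_tsum s)
  calc (∑' x, w x * b x) ^ 2 ≤ (((∑' x, w x) * ∑' x, w x * b x ^ 2) ^ (2⁻¹ : ℝ)) ^ 2 := by gcongr
    _ = _ := by rw [← ENNReal.rpow_natCast, ← ENNReal.rpow_mul]; norm_num

variable {K : X → X → ℂ} {C : ℝ≥0∞}

theorem tsum_tsum_sq_le (hr : ∀ x, ∑' y, ‖K x y‖ₑ ≤ C) (hc : ∀ y, ∑' x, ‖K x y‖ₑ ≤ C)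
    (ξ : lp (fun _ : X => ℂ) 2) :
    ∑' x, (∑' y, ‖K x y‖ₑ * ‖ξ y‖ₑ) ^ 2 ≤ (C * ‖ξ‖ₑ) ^ 2 := by
  calc ∑' x, (∑' y, ‖K x y‖ₑ * ‖ξ y‖ₑ) ^ 2 ≤ ∑' x, C * ∑' y, ‖K x y‖ₑ * ‖ξ y‖ₑ ^ 2 :=
        ENNReal.tsum_le_tsum fun x => (tsum_mul_sq_le _ _).trans (by gcongr; exact hr x)
    _ = C * ∑' y, (∑' x, ‖K x y‖ₑ) * ‖ξ y‖ₑ ^ 2 := by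
        rw [ENNReal.tsum_mul_left, ENNReal.tsum_comm]
        simp only [ENNReal.tsum_mul_right]
    _ ≤ C * ∑' y, C * ‖ξ y‖ₑ ^ 2 := by gcongr with y; exact hc y
    _ = (C * ‖ξ‖ₑ) ^ 2 := by rw [ENNReal.tsum_mul_left, tsum_enorm_sq]; ring

theorem summable_mul (hC : C ≠ ⊤) (hr : ∀ x, ∑' y, ‖K x y‖ₑ ≤ C) (hc : ∀ y, ∑' x, ‖K x y‖ₑ ≤ C)
    (ξ : lp (fun _ : X => ℂ) 2) (x : X) : Summable fun y => K x y * ξ y := by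
  have h1 : (∑' y, ‖K x y‖ₑ * ‖ξ y‖ₑ) ^ 2 ≠ ⊤ :=
    ne_top_of_le_ne_top (ENNReal.pow_ne_top (ENNReal.mul_ne_top hC enorm_ne_top))
      ((ENNReal.le_tsum x).trans (tsum_tsum_sq_le hr hc ξ))
  have h2 : ∑' y, ‖K x y * ξ y‖ₑ ≠ ⊤ := by
    simp only [enorm_mul]
    exact fun h => h1 (by rw [h]; rfl)
  refine Summable.of_norm ?_
  simpa using ENNReal.summable_toReal h2

theorem tsum_enorm_tsum_sq_le (hr : ∀ x, ∑' y, ‖K x y‖ₑ ≤ C) (hc : ∀ y, ∑' x, ‖K x y‖ₑ ≤ C)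
    (ξ : lp (fun _ : X => ℂ) 2) :
    ∑' x, ‖∑' y, K x y * ξ y‖ₑ ^ 2 ≤ (C * ‖ξ‖ₑ) ^ 2 := by
  refine le_trans (ENNReal.tsum_le_tsum fun x => ?_) (tsum_tsum_sq_le hr hc ξ)
  gcongr
  refine enorm_tsum_le_tsum_enorm.trans_eq ?_
  simp only [enorm_mul]

/-- The operator on `ℓ²(X)` that is given by a matrix `K` whose absolute row and column sums are
bounded by `C`. Its norm is at most `C`, by Schur's test. -/
def op (K : X → X → ℂ) (hC : C ≠ ⊤) (hr : ∀ x, ∑' y, ‖K x y‖ₑ ≤ C)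
    (hc : ∀ y, ∑' x, ‖K x y‖ₑ ≤ C) : lp (fun _ : X => ℂ) 2 →L[ℂ] lp (fun _ : X => ℂ) 2 :=
  LinearMap.mkContinuous
    { toFun := fun ξ => ⟨fun x => ∑' y, K x y * ξ y, memℓp_two_of_tsum_ne_top
        (ne_top_of_le_ne_top (ENNReal.pow_ne_top (ENNReal.mul_ne_top hC enorm_ne_top))
          (tsum_enorm_tsum_sq_le hr hc ξ))⟩
      map_add' := fun ξ η => lp.ext <| funext fun x => by
        show ∑' y, K x y * (ξ y + η y) = (∑' y, K x y * ξ y) + ∑' y, K x y * η y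
        rw [← (summable_mul hC hr hc ξ x).tsum_add (summable_mul hC hr hc η x)]
        simp only [mul_add]
      map_smul' := fun z ξ => lp.ext <| funext fun x => by
        show ∑' y, K x y * (z * ξ y) = z * ∑' y, K x y * ξ y
        rw [← tsum_mul_left]
        exact tsum_congr fun y => by ring }
    C.toReal fun ξ => by
      have h : ‖(⟨fun x => ∑' y, K x y * ξ y, memℓp_two_of_tsum_ne_top
        (ne_top_of_le_ne_top (ENNReal.pow_ne_top (ENNReal.mul_ne_top hC enorm_ne_top))
          (tsum_enorm_tsum_sq_le hr hc ξ))⟩ : lp (fun _ : X => ℂ) 2)‖ₑ ^ 2 ≤ (C * ‖ξ‖ₑ) ^ 2 := by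
        rw [← tsum_enorm_sq]
        exact tsum_enorm_tsum_sq_le hr hc ξ
      have h' := ENNReal.toReal_mono (ENNReal.mul_ne_top hC enorm_ne_top)
        ((ENNReal.pow_le_pow_left_iff two_ne_zero).1 h)
      rwa [ENNReal.toReal_mul, toReal_enorm, toReal_enorm] at h'

theorem op_apply (hC : C ≠ ⊤) (hr : ∀ x, ∑' y, ‖K x y‖ₑ ≤ C) (hc : ∀ y, ∑' x, ‖K x y‖ₑ ≤ C)
    (ξ : lp (fun _ : X => ℂ) 2) (x : X) : op K hC hr hc ξ x = ∑' y, K x y * ξ y := rfl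

theorem enorm_op_le (hC : C ≠ ⊤) (hr : ∀ x, ∑' y, ‖K x y‖ₑ ≤ C) (hc : ∀ y, ∑' x, ‖K x y‖ₑ ≤ C) :
    ‖op K hC hr hc‖ₑ ≤ C := by
  rw [← ofReal_norm]
  exact (ENNReal.ofReal_le_ofReal (LinearMap.mkContinuous_norm_le _ ENNReal.toReal_nonneg _)).trans
    ENNReal.ofReal_toReal_le

variable [DecidableEq X]

theorem op_single (hC : C ≠ ⊤) (hr : ∀ x, ∑' y, ‖K x y‖ₑ ≤ C) (hc : ∀ y, ∑' x, ‖K x y‖ₑ ≤ C)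
    (x y : X) (c : ℂ) : op K hC hr hc (lp.single 2 y c) x = K x y * c := by
  rw [op_apply, tsum_eq_single y]
  · simp
  · intro z hz
    simp [hz]

/-- Operators on `ℓ²(X)` with the same matrix coefficients are equal. -/
theorem ext_single {T T' : lp (fun _ : X => ℂ) 2 →L[ℂ] lp (fun _ : X => ℂ) 2}
    (h : ∀ x y, T (lp.single 2 y 1) x = T' (lp.single 2 y 1) x) : T = T' := by
  have : Fact ((1 : ℝ≥0∞) ≤ 2) := ⟨by norm_num⟩
  refine lp.ext_continuousLinearMap (by norm_num) fun y => ?_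
  refine ContinuousLinearMap.ext_ring ?_
  refine lp.ext (funext fun x => ?_)
  simpa using h x y

theorem op_mul {K' K'' : X → X → ℂ} {C' C'' : ℝ≥0∞} (hC : C ≠ ⊤) (hr : ∀ x, ∑' y, ‖K x y‖ₑ ≤ C)
    (hc : ∀ y, ∑' x, ‖K x y‖ₑ ≤ C) (hC' : C' ≠ ⊤) (hr' : ∀ x, ∑' y, ‖K' x y‖ₑ ≤ C')
    (hc' : ∀ y, ∑' x, ‖K' x y‖ₑ ≤ C') (hC'' : C'' ≠ ⊤) (hr'' : ∀ x, ∑' y, ‖K'' x y‖ₑ ≤ C'')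
    (hc'' : ∀ y, ∑' x, ‖K'' x y‖ₑ ≤ C'') (h : ∀ x y, K'' x y = ∑' z, K x z * K' z y) :
    op K'' hC'' hr'' hc'' = op K hC hr hc * op K' hC' hr' hc' := by
  refine ext_single fun x y => ?_
  rw [op_single, mul_apply_eq_comp, op_apply, mul_one, h]
  simp only [op_single, mul_one]

theorem op_star {K' : X → X → ℂ} {C' : ℝ≥0∞} (hC : C ≠ ⊤) (hr : ∀ x, ∑' y, ‖K x y‖ₑ ≤ C)
    (hc : ∀ y, ∑' x, ‖K x y‖ₑ ≤ C) (hC' : C' ≠ ⊤) (hr' : ∀ x, ∑' y, ‖K' x y‖ₑ ≤ C')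
    (hc' : ∀ y, ∑' x, ‖K' x y‖ₑ ≤ C') (h : ∀ x y, K' x y = star (K y x)) :
    op K' hC' hr' hc' = star (op K hC hr hc) := by
  refine ext_single fun x y => ?_
  rw [op_single, mul_one, h, ContinuousLinearMap.star_eq_adjoint]
  have h1 := ContinuousLinearMap.adjoint_inner_right (op K hC hr hc) (lp.single 2 x (1 : ℂ))
    (lp.single 2 y (1 : ℂ))
  rw [lp.inner_single_left, lp.inner_single_right, op_single] at h1
  simpa using h1.symm

end SchurOperator

/-! ### The regular representation -/

namespace BratteliDiagram

open DirGraph.Reduction (conv invol iNorm iNorm_ne_top)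
open DirGraph (universalRep)

variable {B : BratteliDiagram} {S : ∀ n, Finset (Fin (B.p n))}

/-- The unit space of the reduced groupoid. -/
abbrev UnitSpace (B : BratteliDiagram) (S : ∀ n, Finset (Fin (B.p n))) : Type :=
  {x : B.graph.InfPath // x.start ∈ vertexSet S}

open scoped Classical in
/-- A function on the groupoid as a matrix over the unit space: an element of the groupoid is
determined by its range and its source. -/
def kernel (f : B.graph.Reduction (vertexSet S) → ℂ) (x y : UnitSpace B S) : ℂ :=
  if h : ∃ γ : B.graph.Reduction (vertexSet S), γ.1.rng = x ∧ γ.1.src = y then f h.choose else 0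

variable {f g : B.graph.Reduction (vertexSet S) → ℂ}

theorem kernel_mk (f : B.graph.Reduction (vertexSet S) → ℂ) (γ : B.graph.Reduction (vertexSet S)) :
    kernel f ⟨γ.1.rng, γ.2.1⟩ ⟨γ.1.src, γ.2.2⟩ = f γ := by
  have h : ∃ η : B.graph.Reduction (vertexSet S), η.1.rng = γ.1.rng ∧ η.1.src = γ.1.src :=
    ⟨γ, rfl, rfl⟩
  rw [kernel, dif_pos h]
  congr 1
  exact reduction_ext h.choose_spec.1 h.choose_spec.2

theorem kernel_of_eq {x y : UnitSpace B S} {γ : B.graph.Reduction (vertexSet S)}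
    (hx : γ.1.rng = x) (hy : γ.1.src = y) : kernel f x y = f γ := by
  obtain ⟨x, _⟩ := x
  obtain ⟨y, _⟩ := y
  subst hx hy
  exact kernel_mk f γ

theorem kernel_eq_zero {x y : UnitSpace B S}
    (h : ¬∃ γ : B.graph.Reduction (vertexSet S), γ.1.rng = x ∧ γ.1.src = y) : kernel f x y = 0 :=
  dif_neg h

theorem exists_of_kernel_ne_zero {x y : UnitSpace B S} (h : kernel f x y ≠ 0) :
    ∃ γ : B.graph.Reduction (vertexSet S), γ.1.rng = x ∧ γ.1.src = y :=
  not_not.1 fun h' => h (kernel_eq_zero h')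

theorem tsum_rng_fibre {M : Type*} [AddCommMonoid M] [TopologicalSpace M] (x : UnitSpace B S)
    (F : UnitSpace B S → M)
    (hF : ∀ y, F y ≠ 0 → ∃ γ : B.graph.Reduction (vertexSet S), γ.1.rng = x ∧ γ.1.src = y) :
    ∑' y, F y = ∑' η : {η : B.graph.Reduction (vertexSet S) // η.1.rng = x},
      F ⟨η.1.1.src, η.1.2.2⟩ := by
  symm
  refine Function.Injective.tsum_eq (f := F)
    (g := fun η : {η : B.graph.Reduction (vertexSet S) // η.1.rng = x} =>
      (⟨η.1.1.src, η.1.2.2⟩ : UnitSpace B S)) ?_ ?_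
  · intro η η' h
    exact Subtype.ext (reduction_ext (η.2.trans η'.2.symm) (congrArg Subtype.val h))
  · intro y hy
    obtain ⟨γ, h1, h2⟩ := hF y hy
    exact ⟨⟨γ, h1⟩, Subtype.ext h2⟩

theorem tsum_enorm_kernel_row_le (x : UnitSpace B S) : ∑' y, ‖kernel f x y‖ₑ ≤ iNorm f := by
  rw [tsum_rng_fibre x _ fun y hy => exists_of_kernel_ne_zero (f := f) (enorm_ne_zero.1 hy)]
  refine le_trans (le_of_eq (tsum_congr fun η => ?_)) (le_max_of_le_left (le_iSup
    (fun u => ∑' η : {η : B.graph.Reduction (vertexSet S) // η.1.rng = u}, ‖f η.1‖ₑ) x.1))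
  rw [kernel_of_eq η.2 rfl]

theorem kernel_invol (x y : UnitSpace B S) : kernel (invol f) x y = star (kernel f y x) := by
  by_cases h : ∃ γ : B.graph.Reduction (vertexSet S), γ.1.rng = x ∧ γ.1.src = y
  · obtain ⟨γ, h1, h2⟩ := h
    rw [kernel_of_eq h1 h2, kernel_of_eq (γ := γ.inv) h2 h1, invol]
  · rw [kernel_eq_zero h, kernel_eq_zero, star_zero]
    rintro ⟨γ, h1, h2⟩
    exact h ⟨γ.inv, h2, h1⟩

theorem tsum_enorm_kernel_column_le (y : UnitSpace B S) : ∑' x, ‖kernel f x y‖ₑ ≤ iNorm f := by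
  have h : ∀ x, ‖kernel f x y‖ₑ = ‖kernel (invol f) y x‖ₑ := fun x => by
    rw [kernel_invol]
    exact (congrArg ENNReal.ofNNReal (nnnorm_star _)).symm
  simp only [h]
  rw [tsum_rng_fibre y _ fun x hx => exists_of_kernel_ne_zero (f := invol f) (enorm_ne_zero.1 hx)]
  refine le_trans (le_of_eq ?_) (le_max_of_le_right (le_iSup
    (fun u => ∑' η : {η : B.graph.Reduction (vertexSet S) // η.1.src = u}, ‖f η.1‖ₑ) y.1))
  let σ : {η : B.graph.Reduction (vertexSet S) // η.1.rng = y} ≃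
      {η : B.graph.Reduction (vertexSet S) // η.1.src = y} :=
    { toFun := fun η => ⟨η.1.inv, η.2⟩
      invFun := fun η => ⟨η.1.inv, η.2⟩
      left_inv := fun η => Subtype.ext (reduction_ext rfl rfl)
      right_inv := fun η => Subtype.ext (reduction_ext rfl rfl) }
  rw [← σ.tsum_eq]
  refine tsum_congr fun η => ?_
  rw [kernel_of_eq η.2 rfl, invol]
  exact congrArg ENNReal.ofNNReal (nnnorm_star _)

theorem kernel_conv (x y : UnitSpace B S) :
    kernel (conv f g) x y = ∑' z, kernel f x z * kernel g z y := by
  by_cases h : ∃ γ : B.graph.Reduction (vertexSet S), γ.1.rng = x ∧ γ.1.src = y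
  · obtain ⟨γ, h1, h2⟩ := h
    rw [kernel_of_eq h1 h2, conv,
      tsum_rng_fibre x _ fun z hz => exists_of_kernel_ne_zero (left_ne_zero_of_mul hz)]
    obtain ⟨x, _⟩ := x
    subst h1
    refine tsum_congr fun η => ?_
    rw [kernel_of_eq (γ := η.1) η.2 rfl, kernel_of_eq (γ := η.1.inv.mul γ η.2) rfl h2]
  · rw [kernel_eq_zero h]
    symm
    convert tsum_zero with z
    by_contra hz
    obtain ⟨γ, h1, h2⟩ := exists_of_kernel_ne_zero (left_ne_zero_of_mul hz)
    obtain ⟨η, h3, h4⟩ := exists_of_kernel_ne_zero (right_ne_zero_of_mul hz)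
    exact h ⟨γ.mul η (h2.trans h3.symm), h1, h4⟩

theorem kernel_add (x y : UnitSpace B S) : kernel (f + g) x y = kernel f x y + kernel g x y := by
  by_cases h : ∃ γ : B.graph.Reduction (vertexSet S), γ.1.rng = x ∧ γ.1.src = y
  · obtain ⟨γ, h1, h2⟩ := h
    simp only [kernel_of_eq h1 h2, Pi.add_apply]
  · simp only [kernel_eq_zero h, add_zero]

theorem kernel_smul (c : ℂ) (x y : UnitSpace B S) : kernel (c • f) x y = c * kernel f x y := by
  by_cases h : ∃ γ : B.graph.Reduction (vertexSet S), γ.1.rng = x ∧ γ.1.src = y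
  · obtain ⟨γ, h1, h2⟩ := h
    simp only [kernel_of_eq h1 h2, Pi.smul_apply, smul_eq_mul]
  · simp only [kernel_eq_zero h, mul_zero]

/-- The operator of `f` in the regular representation on `ℓ²` of the unit space. -/
def regularOp (f : C_c(B.graph.Reduction (vertexSet S), ℂ)) :
    lp (fun _ : UnitSpace B S => ℂ) 2 →L[ℂ] lp (fun _ : UnitSpace B S => ℂ) 2 :=
  SchurOperator.op (kernel f) (iNorm_ne_top f) tsum_enorm_kernel_row_le tsum_enorm_kernel_column_le

open scoped Classical in
theorem regularOp_single (f : C_c(B.graph.Reduction (vertexSet S), ℂ)) (x y : UnitSpace B S) :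
    regularOp f (lp.single 2 y 1) x = kernel f x y := by
  rw [regularOp, SchurOperator.op_single, mul_one]

variable (B S) in
/-- The representation on `ℓ²` of the unit space in which an element of the groupoid moves the
basis vector of its source to the basis vector of its range. -/
def regularRep : DirGraph.BoundedRep B.graph (vertexSet S) where
  H := lp (fun _ : UnitSpace B S => ℂ) 2
  π :=
    { toFun := regularOp
      map_add' := fun f g => by
        classical
        refine SchurOperator.ext_single fun x y => ?_
        rw [add_apply, lp.coeFn_add, Pi.add_apply]
        simp only [regularOp_single]
        exact kernel_add x y
      map_smul' := fun c f => by
        classical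
        refine SchurOperator.ext_single fun x y => ?_
        rw [RingHom.id_apply, smul_apply, lp.coeFn_smul, Pi.smul_apply]
        simp only [regularOp_single]
        exact kernel_smul c x y }
  map_conv f g h hh := by
    classical
    show regularOp h = regularOp f * regularOp g
    exact SchurOperator.op_mul _ _ _ _ _ _ _ _ _ fun x y => by rw [hh, kernel_conv]
  map_invol f g hg := by
    classical
    show regularOp g = star (regularOp f)
    exact SchurOperator.op_star _ _ _ _ _ _ fun x y => by rw [hg, kernel_invol]
  bound f := SchurOperator.enorm_op_le (iNorm_ne_top f) tsum_enorm_kernel_row_le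
    tsum_enorm_kernel_column_le

theorem universalRep_ne_zero {f : C_c(B.graph.Reduction (vertexSet S), ℂ)} (hf : f ≠ 0) :
    universalRep B.graph (vertexSet S) f ≠ 0 := by
  classical
  obtain ⟨γ, hγ⟩ : ∃ γ, f γ ≠ 0 := by
    by_contra! h
    exact hf (CompactlySupportedContinuousMap.ext h)
  intro h0
  have h1 : regularOp f = 0 :=
    congrFun (congrArg (fun a : DirGraph.RepProduct B.graph (vertexSet S) =>
      (a : ∀ π : DirGraph.BoundedRep B.graph (vertexSet S), π.H →L[ℂ] π.H)) h0) (regularRep B S)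
  have h2 := regularOp_single f ⟨γ.1.rng, γ.2.1⟩ ⟨γ.1.src, γ.2.2⟩
  rw [h1, kernel_mk] at h2
  exact hγ h2.symm

/-- If every vertex emits an edge, every vertex is the start of an infinite path. -/
theorem exists_infPath (hout : ∀ n j, ∃ i, 0 < B.k n i j) (n : ℕ) (j : Fin (B.p n)) :
    ∃ z : B.graph.InfPath, z.start = vertex n j := by
  choose t ht using hout
  let v : ℕ → Σ n, Fin (B.p n) := fun m => Nat.rec ⟨n, j⟩ (fun _ v => ⟨v.1 + 1, t v.1 v.2⟩) m
  exact ⟨⟨fun m => arrow (i := t (v m).1 (v m).2) (j := (v m).2) ⟨0, ht _ _⟩, fun m => rfl⟩, rfl⟩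

theorem chi_ne_zero (hout : ∀ n j, ∃ i, 0 < B.k n i j) {n : ℕ} {j : Fin (B.p n)}
    (α : PathTo B S n j) : chi α α ≠ 0 := by
  obtain ⟨z, hz⟩ := exists_infPath hout n j
  obtain ⟨x, hx, -⟩ := HasPrefix.exists_append α z hz
  intro h0
  have hxx : AgreeFrom n x x := fun a b hab _ => by rw [Nat.add_left_cancel hab]
  have h1 : chi α α (mkReduction hx.start_mem hx.start_mem hxx) = 1 := chi_of_mem ⟨hx, hx, hxx⟩
  rw [h0] at h1
  exact zero_ne_one h1

end BratteliDiagram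
end

noncomputable section

/-! ### The groupoid C⋆-algebra as a limit -/

namespace BratteliDiagram

open DirGraph.Reduction (conv invol iNorm)
open DirGraph (universalRep RepProduct groupoidSubalgebra GroupoidCStarAlgebra universalRepₗ)

variable {B : BratteliDiagram} {S : ∀ n, Finset (Fin (B.p n))}

theorem universalRep_sum {ι : Type} (s : Finset ι)
    (f : ι → C_c(B.graph.Reduction (vertexSet S), ℂ)) :
    universalRep B.graph (vertexSet S) (∑ i ∈ s, f i) =
      ∑ i ∈ s, universalRep B.graph (vertexSet S) (f i) :=
  map_sum (universalRepₗ B.graph (vertexSet S)) f s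

theorem universalRep_eq_zero_of_conv {f g : C_c(B.graph.Reduction (vertexSet S), ℂ)}
    (h : conv f g = 0) :
    universalRep B.graph (vertexSet S) f * universalRep B.graph (vertexSet S) g = 0 := by
  rw [← DirGraph.universalRep_conv (h := 0) h.symm]
  exact map_zero (universalRepₗ B.graph (vertexSet S))

/-- The images of the characteristic functions of the cylinder sets are matrix units. -/
def groupoidMatrixUnits (hout : ∀ n j, ∃ i, 0 < B.k n i j) :
    MatrixUnits B S (RepProduct B.graph (vertexSet S)) where
  e n j α β := universalRep B.graph (vertexSet S) (chi α β)
  star_e n j α β := (DirGraph.universalRep_invol (invol_chi α β)).symm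
  mul_e n j α β δ := (DirGraph.universalRep_conv (chi_conv_chi α β δ)).symm
  mul_e_of_ne n j α β γ δ h := universalRep_eq_zero_of_conv (conv_chi_eq_zero (by simpa using h))
  mul_e_of_vertex_ne n j j' α β γ δ h := universalRep_eq_zero_of_conv
    (conv_chi_eq_zero fun h' => h (congrArg Sigma.fst h'))
  ne_zero n j α := universalRep_ne_zero (chi_ne_zero hout α)
  e_eq_sum n j α β := by
    rw [chi_eq_sum, universalRep_sum]
    exact Finset.sum_congr rfl fun i _ => universalRep_sum _ _

theorem groupoidMatrixUnits_hom (hout : ∀ n j, ∃ i, 0 < B.k n i j) {n : ℕ} (a : PathAlg B S n) :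
    (groupoidMatrixUnits hout).hom n a = universalRep B.graph (vertexSet S) (blockFun a) := by
  rw [MatrixUnits.hom_apply, blockFun, universalRep_sum]
  refine Finset.sum_congr rfl fun j _ => ?_
  rw [universalRep_sum]
  refine Finset.sum_congr rfl fun α _ => ?_
  rw [universalRep_sum]
  exact Finset.sum_congr rfl fun β _ => (DirGraph.universalRep_smul _ _).symm

theorem groupoidMatrixUnits_hom_mem (hout : ∀ n j, ∃ i, 0 < B.k n i j) {n : ℕ}
    (a : PathAlg B S n) :
    (groupoidMatrixUnits hout).hom n a ∈ groupoidSubalgebra B.graph (vertexSet S) := by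
  rw [groupoidMatrixUnits_hom]
  exact NonUnitalStarSubalgebra.le_topologicalClosure _
    (NonUnitalStarAlgebra.subset_adjoin ℂ _ ⟨_, rfl⟩)

theorem universalRep_mem_closure (hout : ∀ n j, ∃ i, 0 < B.k n i j)
    (f : C_c(B.graph.Reduction (vertexSet S), ℂ)) :
    universalRep B.graph (vertexSet S) f ∈
      closure (⋃ n, Set.range ((groupoidMatrixUnits (S := S) hout).hom n)) := by
  rw [Metric.mem_closure_iff]
  intro ε hε
  obtain ⟨n, a, h⟩ := exists_iNorm_sub_le f (half_pos hε)
  refine ⟨_, Set.mem_iUnion.2 ⟨n, a, rfl⟩, ?_⟩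
  rw [groupoidMatrixUnits_hom, dist_eq_norm]
  have h1 : universalRep B.graph (vertexSet S) f -
      universalRep B.graph (vertexSet S) (blockFun a) =
      universalRep B.graph (vertexSet S) (f - blockFun a) :=
    (map_sub (universalRepₗ B.graph (vertexSet S)) f (blockFun a)).symm
  rw [h1]
  refine (DirGraph.norm_universalRep_le _).trans_lt ?_
  have h2 := ENNReal.toReal_mono ENNReal.ofReal_ne_top h
  rw [ENNReal.toReal_ofReal (half_pos hε).le] at h2
  linarith

theorem monotone_range_hom {X : Type*} [NonUnitalCStarAlgebra X] (U : MatrixUnits B S X) :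
    Monotone fun n => NonUnitalStarAlgHom.range (U.hom n) := by
  refine monotone_nat_of_le_succ fun n => ?_
  rintro _ ⟨a, rfl⟩
  exact ⟨pathMap B S n a, U.hom_pathMap n a⟩

theorem groupoidSubalgebra_subset_closure (hout : ∀ n j, ∃ i, 0 < B.k n i j) :
    (groupoidSubalgebra B.graph (vertexSet S) : Set (RepProduct B.graph (vertexSet S))) ⊆
      closure (⋃ n, Set.range ((groupoidMatrixUnits (S := S) hout).hom n)) := by
  let N := (⨆ n, NonUnitalStarAlgHom.range
    ((groupoidMatrixUnits (S := S) hout).hom n)).topologicalClosure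
  have hN : (N : Set (RepProduct B.graph (vertexSet S))) =
      closure (⋃ n, Set.range ((groupoidMatrixUnits (S := S) hout).hom n)) := by
    exact congrArg closure
      (NonUnitalStarSubalgebra.coe_iSup_of_directed (monotone_range_hom _).directed_le)
  rw [← hN, SetLike.coe_subset_coe]
  refine NonUnitalStarSubalgebra.topologicalClosure_minimal _
    (NonUnitalStarAlgebra.adjoin_le ?_) (NonUnitalStarSubalgebra.isClosed_topologicalClosure _)
  rintro _ ⟨f, rfl⟩
  rw [hN]
  exact universalRep_mem_closure hout f

/-- The groupoid C⋆-algebra of a Bratteli diagram is the limit of the path algebras. -/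
theorem hasLimit_groupoidCStarAlgebra (hout : ∀ n j, ∃ i, 0 < B.k n i j) :
    (pathSystem B S hout).HasLimit (GroupoidCStarAlgebra B.graph (vertexSet S)) := by
  let U := groupoidMatrixUnits (S := S) hout
  let ι : ∀ n, PathAlg B S n →⋆ₙₐ[ℂ] groupoidSubalgebra B.graph (vertexSet S) := fun n =>
    NonUnitalStarAlgHom.codRestrict (U.hom n) _ (groupoidMatrixUnits_hom_mem hout)
  have h1 : ∀ n a, ι (n + 1) (pathMap B S n a) = ι n a := fun n a =>
    Subtype.ext (U.hom_pathMap n a)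
  have h2 : ∀ n, Function.Injective (ι n) := fun n a b h =>
    U.hom_injective n (congrArg Subtype.val h)
  have h3 : Dense (⋃ n, Set.range (ι n)) := by
    rw [Subtype.dense_iff]
    refine (groupoidSubalgebra_subset_closure hout).trans (closure_mono ?_)
    refine Set.iUnion_subset fun n => ?_
    rintro _ ⟨a, rfl⟩
    exact ⟨ι n a, Set.mem_iUnion.2 ⟨n, a, rfl⟩, rfl⟩
  exact ⟨ι, h1, h2, h3⟩

end BratteliDiagram
end

theorem theorem3p1 (D : FDSystem) (A : Type*) [NonUnitalCStarAlgebra A] (hA : D.HasLimit A) :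
    ∃ (B : BratteliDiagram) (S : Set B.graph.V), B.IsDiagramFor A ∧
      Nonempty (DirGraph.GroupoidCStarAlgebra B.graph S ≃⋆ₐ[ℂ] A) := by
  obtain ⟨G, hfd, hG, h0, hd⟩ := hA.exists_chain
  obtain ⟨B, S, ⟨W⟩⟩ := BratteliDiagram.exists_realization G hfd hG h0
  have hlim := W.hasLimit hG hd
  exact ⟨B, BratteliDiagram.vertexSet S,
    ⟨_, hlim, BratteliDiagram.corresponds_pathSystem W.exists_out W.nonempty_pathTo⟩,
    FDSystem.HasLimit.unique (BratteliDiagram.hasLimit_groupoidCStarAlgebra W.exists_out) hlim⟩
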